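/- Let $q>0$ be real. For $q\neq 1$ put $[x]=(q^x-q^{-x})/(q-q^{-1})$, and $[x]=x$ for $q=1$; $[n]!=[n][n-1]\cdots[1]$ for integers $n\ge 0$, and $1/[n]!=0$ for integers $n<0$; $(a|q)_n=\prod_{k=0}^{n-1}[a+k]$. A triple $a,b,c$ of non-negative integers or half-integers satisfies the triangle condition if $a+b-c$, $a-b+c$, $b+c-a$ are non-negative integers. Let $$\nabla[abc]=\left(\frac{[a+b-c]!\,[a-b+c]!\,[a+b+c+1]!}{[b+c-a]!}\right)^{1/2},\qquad \Delta[abc]=\left(\frac{[a+b-c]!\,[a-b+c]!\,[b+c-a]!}{[a+b+c+1]!}\right)^{1/2}.$$ The $q$-$6j$ coefficient of $u_q(2)$ is, if $(a,b,e),(a,c,f),(d,b,f),(d,c,e)$ satisfy the triangle condition, $$\left\{\begin{array}{lll}a&b&e\\ d&c&f\end{array}\right\}_q=\Delta[abe]\Delta[acf]\Delta[dbf]\Delta[dce]\sum_t\frac{(-1)^t[t+1]!}{[t-a-b-e]!\,[t-a-c-f]!\,[t-d-b-f]!\,[t-d-c-e]!\,[a+b+c+d-t]!\,[a+d+e+f-t]!\,[b+c+e+f-t]!},$$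 and $0$ otherwise. Let $j_i,l_i,k_i$ ($1\le i\le 4$) be such that the triples $(k_1,j_1,l_1)$, $(j_3,k_2,l_1)$, $(k_3,j_1,l_2)$, $(j_3,k_4,l_2)$, $(k_1,j_2,l_3)$, $(j_4,k_2,l_3)$, $(k_3,j_2,l_4)$, $(j_4,k_4,l_4)$ satisfy the triangle condition. The $q$-$12j$ coefficient of the second kind (without braiding) of $u_q(2)$ is $$W=\left[\begin{array}{llll}j_1&j_2&j_3&j_4\\ l_1&l_2&l_3&l_4\\ k_1&k_2&k_3&k_4\end{array}\right]_q=(-1)^{l_1-l_2-l_3+l_4}\sum_x[2x+1]\left\{\begin{array}{lll}k_1&j_1&l_1\\ j_3&k_2&x\end{array}\right\}_q\left\{\begin{array}{lll}k_3&k_4&x\\ j_3&j_1&l_2\end{array}\right\}_q\left\{\begin{array}{lll}k_3&j_2&l_4\\ j_4&k_4&x\end{array}\right\}_q\left\{\begin{array}{lll}k_1&k_2&x\\ j_4&j_2&l_3\end{array}\right\}_q ,$$ the sum being over all non-negative integers and half-integers $x$. The following holds. 1. (Rearranged expansions.) $W$ also equals $(-1)^{l_1-l_2-l_3+l_4}\sum_x[2x+1]\,P(x)$,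 where $P(x)$ is any one of the products $$\left\{\begin{array}{lll}k_1&j_1&l_1\\ j_3&k_2&x\end{array}\right\}_q\left\{\begin{array}{lll}j_3&x&j_1\\ k_3&l_2&k_4\end{array}\right\}_q\left\{\begin{array}{lll}k_3&k_4&x\\ j_4&j_2&l_4\end{array}\right\}_q\left\{\begin{array}{lll}k_1&x&k_2\\ j_4&l_3&j_2\end{array}\right\}_q,$$ $$\left\{\begin{array}{lll}k_1&j_1&l_1\\ j_3&k_2&x\end{array}\right\}_q\left\{\begin{array}{lll}k_3&k_4&x\\ j_3&j_1&l_2\end{array}\right\}_q\left\{\begin{array}{lll}j_4&x&j_2\\ k_3&l_4&k_4\end{array}\right\}_q\left\{\begin{array}{lll}k_1&x&k_2\\ j_4&l_3&j_2\end{array}\right\}_q,$$ $$\left\{\begin{array}{lll}j_3&x&j_1\\ k_1&l_1&k_2\end{array}\right\}_q\left\{\begin{array}{lll}k_3&x&k_4\\ j_3&l_2&j_1\end{array}\right\}_q\left\{\begin{array}{lll}j_4&x&j_2\\ k_3&l_4&k_4\end{array}\right\}_q\left\{\begin{array}{lll}l_3&j_2&k_1\\ x&k_2&j_4\end{array}\right\}_q.$$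 2. (Fourfold sums.) In each of the formulas (A)-(D) below let $z_1,z_2,z_3,z_4$ be non-negative integers that run through the box $0\le z_i\le N_i$, where $N_i$ is the minimum of the triangle combinations $b$ (sums of the form $a+a'-a''$ over one of the eight triples) for which a factor $[b-z_i]!$ stands in the denominator. Each formula holds whenever it contains only $q$-factorials of non-negative integers in its numerator, that is, whenever on the whole box the following arguments are non-negative: - for (A): $k_1+k_3+j_3+j_4-l_2-l_3-z_2-z_4$; - for (B): $j_3+j_4+l_2-l_4-z_2-z_3$, $\;k_1+k_3+l_3-l_4-z_3-z_4$, $\;j_3-j_4+k_1-k_3+l_2+l_3-z_2-z_4$; - for (C): $j_3+j_4-l_2+l_4-z_2-z_3$, $\;j_3-j_4+k_1+k_3-l_2+l_3-z_2-z_4$, $\;k_1-k_3+l_3+l_4-z_3-z_4$; - for (D): $l_1+l_2-k_1+k_3-z_1-z_2$, $\;j_3+j_4-k_3-k_1+l_1+l_4-z_1-z_3$, $\;l_2+l_4-j_3+j_4-z_2-z_3$. (The arguments of the other numerator factorials are non-negative on the box, except that $l_2+l_3-l_1-l_4+z_1+z_2+z_3+z_4$ in (A) may be negative; the corresponding terms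 contain a factor $1/[n]!$ with $n<0$ and count as $0$.) (A) $$W=(-1)^{l_2-l_3+k_1-k_3-j_3+j_4}\frac{\nabla [k_3j_1l_2] \nabla [j_3k_4l_2]\nabla [k_1j_2l_3]\nabla [j_4k_2l_3]}{\nabla [k_1j_1l_1] \nabla [j_3k_2l_1]\nabla [k_3j_2l_4]\nabla [j_4k_4l_4]} \times \sum_{z_1,z_2,z_3,z_4}\frac{(-1)^{z_1+z_2+z_3+z_4} [k_2+j_3-l_1+z_1]![k_1+j_1-l_1+z_1]!}{[z_1]![z_2]![z_3]![z_4]! [l_1+k_2-j_3-z_1]![j_1+l_1-k_1-z_1]!} \times \frac{[2l_1-z_1]![j_1+l_2-k_3+z_2]![l_2-j_3+k_4+ z_2]!}{[j_1-l_2+k_3-z_2]![j_3+k_4-l_2-z_2]![2l_2+z_2+1]!} \times \frac{[j_4+k_4-l_4+z_3]![j_2+k_3-l_4+z_3]! [2l_4-z_3]!}{[k_4+l_4-j_4-z_3]![j_2-k_3+l_4-z_3]![k_1+j_2-l_3-z_4]! [2l_3+z_4+1]!} \times \frac{[j_2+l_3-k_1+z_4]![k_2+l_3-j_4+z_4]!}{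 [k_2-l_3+j_4-z_4]![k_1+k_3+j_3+j_4-l_1-l_4+z_1+z_3+1]!} \times \frac{[k_1+k_3+j_3+j_4-l_2-l_3-z_2-z_4]!}{ [k_1+l_2-l_1-k_3+z_1+z_2]![l_3-l_1+j_3-j_4+z_1+z_4]!} \times \frac{[l_2+l_3-l_1-l_4+z_1+z_2+z_3+z_4]!}{[l_2 -l_4-j_3+j_4+z_2+z_3]![k_3-k_1+l_3-l_4+z_3+z_4]!}$$ (B) $$W=(-1)^{j_1-j_3-k_1+k_2-l_1-l_2-l_3+l_4}\frac{\nabla [j_3k_4l_2] \nabla [k_3j_2l_4]\nabla [k_1j_2l_3]\nabla [j_4k_4l_4]}{\nabla [k_1j_1l_1] \nabla [j_3k_2l_1]\nabla [k_3j_1l_2]\nabla [j_4k_2l_3]} \times \sum_{z_1,z_2,z_3,z_4}\frac{(-1)^{z_2+z_3+z_4}[k_2 +j_3-l_1+z_1]![k_1+j_1-l_1+z_1]!}{[z_1]![z_2]![z_3]![z_4]![l_1+k_2-j_3 -z_1]![j_1+l_1-k_1-z_1]!} \times \frac{[2l_1-z_1]![2l_2-z_2]![j_1-l_2+k_3+z_2]!}{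 [l_2+j_3-k_4-z_2]![j_1+l_2-k_3-z_2]![l_2+j_3+k_4-z_2+1]!} \times \frac{[j_2-k_3+l_4+z_3]![k_4+l_4-j_4+z_3]!}{[j_4+ k_4-l_4-z_3]![j_2+k_3-l_4-z_3]![2l_4+z_3+1]![k_1-j_2+l_3-z_4]!} \times \frac{[2l_3-z_4]![k_2-l_3+j_4+z_4]!}{ [k_2+l_3-j_4-z_4]![k_1+j_2+l_3-z_4+1]![k_1+k_3-l_1-l_2+z_1+z_2]!} \times \frac{[j_3+j_4+l_2-l_4-z_2-z_3]![k_1+k_3+l_3-l_4 -z_3-z_4]!}{[k_1-k_3+j_3-j_4-l_1+l_4+z_1+z_3]![j_3+j_4-l_1-l_3+z_1+z_4]!} \times \frac{[j_3-j_4+k_1-k_3+l_2+l_3-z_2-z_4]!}{ [l_1+l_2+l_3-l_4-z_1-z_2-z_3-z_4]!}$$ (C) $$W=(-1)^{k_1-k_2+l_1-l_2+l_3+l_4-j_2+j_4}\frac{\nabla [k_3j_1l_2] \nabla [j_3k_4l_2]\nabla [j_4k_4l_4]\nabla [k_1j_2l_3]}{\nabla [k_1j_1l_1] \nabla [j_3k_2l_1]\nabla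 [k_3j_2l_4]\nabla [j_4k_2l_3]} \times \sum_{z_1,z_2,z_3,z_4}\frac{(-1)^{z_2+z_3+z_4} [j_3+k_2-l_1+z_1]![j_1+k_1-l_1+z_1]!}{[z_1]![z_2]![z_3]![z_4]![l_1+k_2 -j_3-z_1]![j_1-k_1+l_1-z_1]!} \times \frac{[2l_1-z_1]![j_1+l_2-k_3+z_2]![l_2-j_3+k_4+ z_2]!}{[j_1-l_2+k_3-z_2]![j_3+k_4-l_2-z_2]![2l_2+z_2+1]![j_4-k_4+l_4 -z_3]!} \times \frac{[2l_4-z_3]![j_2-l_4+k_3+z_3]!}{[j_2-k_3+l_4 -z_3]![j_4+k_4+l_4-z_3+1]![k_1-j_2+l_3-z_4]!} \times \frac{[2l_3-z_4]![k_2-l_3+j_4+z_4]!}{[k_2+l_3-j_4 -z_4]![k_1+j_2+l_3-z_4+1]![k_1-k_3-l_1+l_2+z_1+z_2]!} \times \frac{[j_3+j_4-l_2+l_4-z_2-z_3]![j_3-j_4+k_1 +k_3-l_2+l_3-z_2-z_4]!}{[j_3-j_4+k_1+k_3-l_1-l_4+z_1+z_3]! [j_3+j_4-l_1-l_3+z_1+z_4]!}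 \times \frac{[k_1-k_3+l_3+l_4-z_3-z_4]!}{ [l_1-l_2+l_3+l_4-z_1-z_2-z_3-z_4]!}$$ (D) $$W=(-1)^{k_3+k_4-l_1+l_2+l_3-l_4-j_1-j_3}\frac{\nabla [j_3k_2l_1] \nabla [k_3j_1l_2]\nabla [j_4k_4l_4]\nabla [k_1j_2l_3]}{\nabla [k_1j_1l_1] \nabla [j_3k_4l_2]\nabla [k_3j_2l_4]\nabla [j_4k_2l_3]} \times \sum_{z_1,z_2,z_3,z_4}\frac{(-1)^{z_1+z_2+z_3} [2l_1-z_1]![j_1+k_1-l_1+z_1]!}{[z_1]![l_1-k_2+j_3-z_1]![j_1-k_1+l_1-z_1]! [l_1+k_2+j_3-z_1+1]!} \times \frac{[2l_2-z_2]![k_4+j_3-l_2+z_2]!}{[z_2]! [k_3+l_2-j_1-z_2]![l_2-j_3+k_4-z_2]![j_1+l_2+k_3-z_2+1]!} \times \frac{[2l_4-z_3]![j_2+k_3-l_4+z_3]!}{[z_3]![z_4]! [j_4+l_4-k_4-z_3]![j_2-k_3+l_4-z_3]![j_4+k_4+l_4-z_3+1]!} \times \frac{[2j_2-z_4]![j_2+j_4+k_1-k_2-z_4]![j_2+j_4+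 k_1+k_2-z_4+1]!}{[k_1+j_2-l_3-z_4]![k_1+j_2+l_3-z_4+1]![j_2+k_3-l_4+z_3 -z_4]!} \times \frac{[l_1+l_2-k_1+k_3-z_1-z_2]![j_3+j_4-k_3-k_1 +l_1+l_4-z_1-z_3]!}{[j_2-j_3+j_4+k_1-l_1+z_1-z_4]![j_2+j_3+j_4-k_3-l_2 +z_2-z_4]!} \times \frac{[l_2+l_4-j_3+j_4-z_2-z_3]!}{ [l_1+l_2+l_4-k_1-j_2-z_1-z_2-z_3+z_4]!}$$ 3. (Each separate sum is balanced.) Let a formula among (A)-(D) satisfy its condition in 2. For each $i$ and any fixed values of the other three variables in the box, write the general term as a function $t(z_i)$, $0\le z_i\le N_i$. Let $\alpha$ consist of the five numbers $A+1$ for the factors $[A+z_i]!$ in the numerator and $-B$ for the factors $[B-z_i]!$ in the denominator, and let $\beta$ consist of the four numbers $A+1$ for the factors $[A+z_i]!$ in the denominator other than $[z_i]!$ and $-B$ for the factors $[B-z_i]!$ in the numerator. Then there is an integer $m\ge 0$ with $t(n)=0$ for $n<m$, such that, with $\alpha'=\alpha+m$ and with $\beta'$ defined by requiring that $\beta',1$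 are the five numbers $\beta+m,1+m$ in some order, one has $\sum\alpha'-\sum\beta'=-1$ and, whenever $m+k\le N_i$, $$t(m+k)=t(m)\,\frac{(\alpha'_1|q)_k\cdots(\alpha'_5|q)_k}{(\beta'_1|q)_k\cdots(\beta'_4|q)_k\,(1|q)_k}$$ with non-zero denominators. Hence the sum over $z_i$ is $t(m)$ times a finite balanced series ${}_5F_4[\alpha';\beta';q,1]$. 4. (Symmetry.) The $q$-$12j$ coefficient is invariant under the substitution $$\left[\begin{array}{llll}j_1&j_2&j_3&j_4\\ l_1&l_2&l_3&l_4\\ k_1&k_2&k_3&k_4\end{array}\right]\longrightarrow\left[\begin{array}{llll}k_2&k_4&k_1&k_3\\ l_1&l_3&l_2&l_4\\ j_3&j_1&j_4&j_2\end{array}\right],$$ and so are the expressions (A) and (B) themselves: their prefactors do not change, and their summation boxes and general terms change only by the interchange of $z_2$ and $z_4$. -/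

import Mathlib

open Finset

set_option linter.unusedVariables false

/-- The `q`-number `[x] = (q^x - q^(-x)) / (q - q⁻¹)`, equal to `x` at `q = 1`. -/
noncomputable def qnum (q : ℝ) (x : ℚ) : ℝ :=
  if q = 1 then (x : ℝ) else (q ^ (x : ℝ) - q ^ (-(x : ℝ))) / (q - q⁻¹)

/-- The `q`-factorial `[x]! = [x][x-1]⋯[2][1]` of a nonnegative integer `x`. -/
noncomputable def qF (q : ℝ) (x : ℚ) : ℝ :=
  ∏ i ∈ range ⌊x⌋₊, qnum q ((i : ℚ) + 1)

/-- The reciprocal `q`-factorial `1 / [x]!` of an integer `x`, which is `0` for negative `x`. -/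
noncomputable def qR (q : ℝ) (x : ℚ) : ℝ :=
  if 0 ≤ x then (qF q x)⁻¹ else 0

/-- The `q`-Pochhammer symbol `(a|q)_n = [a][a+1]⋯[a+n-1]`. -/
noncomputable def qPoch (q : ℝ) (a : ℚ) (n : ℕ) : ℝ :=
  ∏ k ∈ range n, qnum q (a + k)

/-- The sign `(-1)^x` for an integer `x`. -/
noncomputable def sgn (x : ℚ) : ℝ := (-1) ^ ⌊x⌋

/-- The triangle condition: `a + b - c`, `a - b + c` and `b + c - a` are nonnegative integers
(so that `a`, `b`, `c` are nonnegative integers or half-integers). -/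
def Triangle (a b c : ℚ) : Prop :=
  (∃ n : ℕ, a + b - c = n) ∧ (∃ n : ℕ, a - b + c = n) ∧ (∃ n : ℕ, b + c - a = n)

/-- The asymmetric triangle coefficient `∇[abc]`. -/
noncomputable def nabla (q : ℝ) (a b c : ℚ) : ℝ :=
  Real.sqrt (qF q (a + b - c) * qF q (a - b + c) * qF q (a + b + c + 1) / qF q (b + c - a))

/-- The symmetric triangle coefficient `Δ[abc]`. -/
noncomputable def delta (q : ℝ) (a b c : ℚ) : ℝ :=
  Real.sqrt (qF q (a + b - c) * qF q (a - b + c) * qF q (b + c - a) / qF q (a + b + c + 1))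

open Classical in
/-- The `q`-`6j` coefficient `{a b e; d c f}_q` of `u_q(2)` (Racah's formula); it vanishes unless
the four triangle conditions hold. -/
noncomputable def sixj (q : ℝ) (a b e d c f : ℚ) : ℝ :=
  if Triangle a b e ∧ Triangle a c f ∧ Triangle d b f ∧ Triangle d c e then
    delta q a b e * delta q a c f * delta q d b f * delta q d c e *
      ∑ t ∈ range (⌊a + b + c + d⌋₊ + 1),
        (-1) ^ t * qF q ((t : ℚ) + 1) *
          (qR q (t - a - b - e) * qR q (t - a - c - f) * qR q (t - d - b - f) *
            qR q (t - d - c - e)) *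
          (qR q (a + b + c + d - t) * qR q (a + d + e + f - t) * qR q (b + c + e + f - t))
  else 0

/-- The twelve parameters of a `12j` coefficient of the second kind, i.e. of the array
`[j1 j2 j3 j4; l1 l2 l3 l4; k1 k2 k3 k4]`. -/
structure Spins where
  (j1 j2 j3 j4 l1 l2 l3 l4 k1 k2 k3 k4 : ℚ)

/-- The eight triangle conditions of a `12j` coefficient of the second kind. -/
def Admissible : Spins → Prop
  | ⟨j1, j2, j3, j4, l1, l2, l3, l4, k1, k2, k3, k4⟩ =>
    Triangle k1 j1 l1 ∧ Triangle j3 k2 l1 ∧ Triangle k3 j1 l2 ∧ Triangle j3 k4 l2 ∧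
    Triangle k1 j2 l3 ∧ Triangle j4 k2 l3 ∧ Triangle k3 j2 l4 ∧ Triangle j4 k4 l4

/-- The sum `∑ₓ [2x+1] f(x)` over the nonnegative integers and half-integers `x ≤ m`. -/
noncomputable def spinSum (q : ℝ) (m : ℚ) (f : ℚ → ℝ) : ℝ :=
  ∑ n ∈ range (⌊2 * m⌋₊ + 1), qnum q ((n : ℚ) + 1) * f ((n : ℚ) / 2)

/-- The `q`-`12j` coefficient of the second kind of `u_q(2)`. -/
noncomputable def q12j (q : ℝ) : Spins → ℝ
  | ⟨j1, j2, j3, j4, l1, l2, l3, l4, k1, k2, k3, k4⟩ =>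
    sgn (l1 - l2 - l3 + l4) * spinSum q (k1 + k2) fun x =>
      sixj q k1 j1 l1 j3 k2 x * sixj q k3 k4 x j3 j1 l2 *
        sixj q k3 j2 l4 j4 k4 x * sixj q k1 k2 x j4 j2 l3

/-- The second of the expansions in terms of `q`-`6j` coefficients. -/
noncomputable def expansionB (q : ℝ) : Spins → ℝ
  | ⟨j1, j2, j3, j4, l1, l2, l3, l4, k1, k2, k3, k4⟩ =>
    sgn (l1 - l2 - l3 + l4) * spinSum q (k1 + k2) fun x =>
      sixj q k1 j1 l1 j3 k2 x * sixj q j3 x j1 k3 l2 k4 *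
        sixj q k3 k4 x j4 j2 l4 * sixj q k1 x k2 j4 l3 j2

/-- The third of the expansions in terms of `q`-`6j` coefficients. -/
noncomputable def expansionC (q : ℝ) : Spins → ℝ
  | ⟨j1, j2, j3, j4, l1, l2, l3, l4, k1, k2, k3, k4⟩ =>
    sgn (l1 - l2 - l3 + l4) * spinSum q (k1 + k2) fun x =>
      sixj q k1 j1 l1 j3 k2 x * sixj q k3 k4 x j3 j1 l2 *
        sixj q j4 x j2 k3 l4 k4 * sixj q k1 x k2 j4 l3 j2

/-- The fourth of the expansions in terms of `q`-`6j` coefficients. -/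
noncomputable def expansionD (q : ℝ) : Spins → ℝ
  | ⟨j1, j2, j3, j4, l1, l2, l3, l4, k1, k2, k3, k4⟩ =>
    sgn (l1 - l2 - l3 + l4) * spinSum q (k1 + k2) fun x =>
      sixj q j3 x j1 k1 l1 k2 * sixj q k3 x k4 j3 l2 j1 *
        sixj q j4 x j2 k3 l4 k4 * sixj q l3 j2 k1 x k2 j4

/-- The summation range `0 ≤ z i ≤ b i`. -/
def sumBox (b : Fin 4 → ℕ) : Finset (Fin 4 → ℕ) :=
  Fintype.piFinset fun i => range (b i + 1)

/-- The term with index `k` of the basic hypergeometric series `₅F₄[α; β; q, x]`. -/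
noncomputable def hypTerm (q : ℝ) (α : Fin 5 → ℚ) (β : Fin 4 → ℚ) (x : ℝ) (k : ℕ) : ℝ :=
  (∏ i, qPoch q (α i) k) / ((∏ i, qPoch q (β i) k) * qPoch q 1 k) * x ^ k

/-- The sum `∑_{n=0}^{N} t n` is, term by term, a multiple of a finite balanced series
`₅F₄[α'; β'; q, 1]` (balanced: `∑ α' - ∑ β' = -1`). Its parameters are determined by `α` and `β`:
if `t m` is the leading term, then `α' = α + m`, and `β', 1` are the numbers `β + m, 1 + m` in some
order (in particular `α' = α` and `β' = β` if `m = 0` and no entry of `β` is `1`). -/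
def IsBalancedSum (q : ℝ) (α : Fin 5 → ℚ) (β : Fin 4 → ℚ) (N : ℕ) (t : ℕ → ℝ) : Prop :=
  ∃ (m : ℕ) (r : Fin 5) (α' : Fin 5 → ℚ) (β' : Fin 4 → ℚ),
    (∀ i, α' i = α i + m) ∧
    (Fin.cons 1 β : Fin 5 → ℚ) r + m = 1 ∧
    (∀ i, β' i = (Fin.cons 1 β : Fin 5 → ℚ) (r.succAbove i) + m) ∧
    (∑ i, α' i) - ∑ i, β' i = -1 ∧
    (∀ k < m, t k = 0) ∧
    (∀ k, m + k ≤ N →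
      (∀ i, qPoch q (β' i) k ≠ 0) ∧ t (m + k) = t m * hypTerm q α' β' 1 k) ∧
    ∑ n ∈ range (N + 1), t n = t m * ∑ k ∈ range (N + 1 - m), hypTerm q α' β' 1 k

/-- The transposition of the array of parameters into
`[k2 k4 k1 k3; l1 l3 l2 l4; j3 j1 j4 j2]`. -/
def Spins.flip : Spins → Spins
  | ⟨j1, j2, j3, j4, l1, l2, l3, l4, k1, k2, k3, k4⟩ =>
    ⟨k2, k4, k1, k3, l1, l3, l2, l4, j3, j1, j4, j2⟩

/-- The factor in front of the fourfold sum in formula (A). -/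
noncomputable def prefactorA (q : ℝ) : Spins → ℝ
  | ⟨j1, j2, j3, j4, l1, l2, l3, l4, k1, k2, k3, k4⟩ =>
    sgn (l2 - l3 + k1 - k3 - j3 + j4) *
      ((nabla q k3 j1 l2 * nabla q j3 k4 l2 * nabla q k1 j2 l3 * nabla q j4 k2 l3) /
        (nabla q k1 j1 l1 * nabla q j3 k2 l1 * nabla q k3 j2 l4 * nabla q j4 k4 l4))

/-- The general term of the fourfold sum in formula (A). -/
noncomputable def summandA (q : ℝ) : Spins → (Fin 4 → ℕ) → ℝ
  | ⟨j1, j2, j3, j4, l1, l2, l3, l4, k1, k2, k3, k4⟩, z =>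
    let z1 : ℚ := z 0; let z2 : ℚ := z 1; let z3 : ℚ := z 2; let z4 : ℚ := z 3
    (-1) ^ (z 0 + z 1 + z 2 + z 3) *
      (qF q (k2 + j3 - l1 + z1) * qF q (k1 + j1 - l1 + z1) * qF q (2*l1 - z1) *
       qF q (j1 + l2 - k3 + z2) * qF q (l2 - j3 + k4 + z2) * qF q (j4 + k4 - l4 + z3) *
       qF q (j2 + k3 - l4 + z3) * qF q (2*l4 - z3) * qF q (j2 + l3 - k1 + z4) *
       qF q (k2 + l3 - j4 + z4) * qF q (k1 + k3 + j3 + j4 - l2 - l3 - z2 - z4) *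
       qF q (l2 + l3 - l1 - l4 + z1 + z2 + z3 + z4)) *
      (qR q (z1) * qR q (z2) * qR q (z3) * qR q (z4) * qR q (l1 + k2 - j3 - z1) *
       qR q (j1 + l1 - k1 - z1) * qR q (j1 - l2 + k3 - z2) * qR q (j3 + k4 - l2 - z2) *
       qR q (2*l2 + z2 + 1) * qR q (k4 + l4 - j4 - z3) * qR q (j2 - k3 + l4 - z3) *
       qR q (k1 + j2 - l3 - z4) * qR q (2*l3 + z4 + 1) * qR q (k2 - l3 + j4 - z4) *
       qR q (k1 + k3 + j3 + j4 - l1 - l4 + z1 + z3 + 1) * qR q (k1 + l2 - l1 - k3 + z1 + z2) *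
       qR q (l3 - l1 + j3 - j4 + z1 + z4) * qR q (l2 - l4 - j3 + j4 + z2 + z3) *
       qR q (k3 - k1 + l3 - l4 + z3 + z4))

/-- The largest value of each summation variable in formula (A). -/
def boundA : Spins → Fin 4 → ℕ
  | ⟨j1, j2, j3, j4, l1, l2, l3, l4, k1, k2, k3, k4⟩ =>
    ![⌊min (l1 + k2 - j3) (j1 + l1 - k1)⌋₊,
      ⌊min (j1 - l2 + k3) (j3 + k4 - l2)⌋₊,
      ⌊min (k4 + l4 - j4) (j2 - k3 + l4)⌋₊,
      ⌊min (k1 + j2 - l3) (k2 - l3 + j4)⌋₊]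

/-- On the whole summation range of formula (A), the numerator contains only `q`-factorials of
nonnegative integers. -/
def DefinedA : Spins → Prop
  | ⟨j1, j2, j3, j4, l1, l2, l3, l4, k1, k2, k3, k4⟩ =>
    ∀ z ∈ sumBox (boundA ⟨j1, j2, j3, j4, l1, l2, l3, l4, k1, k2, k3, k4⟩),
      let z1 : ℚ := z 0; let z2 : ℚ := z 1; let z3 : ℚ := z 2; let z4 : ℚ := z 3
      0 ≤ k1 + k3 + j3 + j4 - l2 - l3 - z2 - z4

/-- The numerator parameters of the series formed by the separate sums in formula (A). -/
def upperA : Spins → (Fin 4 → ℕ) → Fin 4 → Fin 5 → ℚ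
  | ⟨j1, j2, j3, j4, l1, l2, l3, l4, k1, k2, k3, k4⟩, z =>
    let z1 : ℚ := z 0; let z2 : ℚ := z 1; let z3 : ℚ := z 2; let z4 : ℚ := z 3
    ![![k2 + j3 - l1 + 1, k1 + j1 - l1 + 1, j3 - l1 - k2, k1 - j1 - l1,
      l2 + l3 - l1 - l4 + z2 + z3 + z4 + 1],
     ![j1 + l2 - k3 + 1, l2 - j3 + k4 + 1, l2 - j1 - k3, l2 - j3 - k4,
      l2 + l3 - l1 - l4 + z1 + z3 + z4 + 1],
     ![j4 + k4 - l4 + 1, j2 + k3 - l4 + 1, j4 - k4 - l4, k3 - j2 - l4,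
      l2 + l3 - l1 - l4 + z1 + z2 + z4 + 1],
     ![l3 - k1 - j2, j2 + l3 - k1 + 1, k2 + l3 - j4 + 1, l3 - k2 - j4,
      l2 + l3 - l1 - l4 + z1 + z2 + z3 + 1]]

/-- The denominator parameters of the series formed by the separate sums in formula (A). -/
def lowerA : Spins → (Fin 4 → ℕ) → Fin 4 → Fin 4 → ℚ
  | ⟨j1, j2, j3, j4, l1, l2, l3, l4, k1, k2, k3, k4⟩, z =>
    let z1 : ℚ := z 0; let z2 : ℚ := z 1; let z3 : ℚ := z 2; let z4 : ℚ := z 3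
    ![![-2*l1, k1 + k3 + j3 + j4 - l1 - l4 + z3 + 2, k1 + l2 - l1 - k3 + z2 + 1,
      l3 - l1 + j3 - j4 + z4 + 1],
     ![2*l2 + 2, l2 - k1 - k3 - j3 - j4 + l3 + z4, k1 + l2 - l1 - k3 + z1 + 1,
      l2 - l4 - j3 + j4 + z3 + 1],
     ![-2*l4, k1 + k3 + j3 + j4 - l1 - l4 + z1 + 2, l2 - l4 - j3 + j4 + z2 + 1,
      k3 - k1 + l3 - l4 + z4 + 1],
     ![2*l3 + 2, l2 - k1 - k3 - j3 - j4 + l3 + z2, l3 - l1 + j3 - j4 + z1 + 1,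
      k3 - k1 + l3 - l4 + z3 + 1]]

/-- The factor in front of the fourfold sum in formula (B). -/
noncomputable def prefactorB (q : ℝ) : Spins → ℝ
  | ⟨j1, j2, j3, j4, l1, l2, l3, l4, k1, k2, k3, k4⟩ =>
    sgn (j1 - j3 - k1 + k2 - l1 - l2 - l3 + l4) *
      ((nabla q j3 k4 l2 * nabla q k3 j2 l4 * nabla q k1 j2 l3 * nabla q j4 k4 l4) /
        (nabla q k1 j1 l1 * nabla q j3 k2 l1 * nabla q k3 j1 l2 * nabla q j4 k2 l3))

/-- The general term of the fourfold sum in formula (B). -/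
noncomputable def summandB (q : ℝ) : Spins → (Fin 4 → ℕ) → ℝ
  | ⟨j1, j2, j3, j4, l1, l2, l3, l4, k1, k2, k3, k4⟩, z =>
    let z1 : ℚ := z 0; let z2 : ℚ := z 1; let z3 : ℚ := z 2; let z4 : ℚ := z 3
    (-1) ^ (z 1 + z 2 + z 3) *
      (qF q (k2 + j3 - l1 + z1) * qF q (k1 + j1 - l1 + z1) * qF q (2*l1 - z1) *
       qF q (2*l2 - z2) * qF q (j1 - l2 + k3 + z2) * qF q (j2 - k3 + l4 + z3) *
       qF q (k4 + l4 - j4 + z3) * qF q (2*l3 - z4) * qF q (k2 - l3 + j4 + z4) *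
       qF q (j3 + j4 + l2 - l4 - z2 - z3) * qF q (k1 + k3 + l3 - l4 - z3 - z4) *
       qF q (j3 - j4 + k1 - k3 + l2 + l3 - z2 - z4)) *
      (qR q (z1) * qR q (z2) * qR q (z3) * qR q (z4) * qR q (l1 + k2 - j3 - z1) *
       qR q (j1 + l1 - k1 - z1) * qR q (l2 + j3 - k4 - z2) * qR q (j1 + l2 - k3 - z2) *
       qR q (l2 + j3 + k4 - z2 + 1) * qR q (j4 + k4 - l4 - z3) * qR q (j2 + k3 - l4 - z3) *
       qR q (2*l4 + z3 + 1) * qR q (k1 - j2 + l3 - z4) * qR q (k2 + l3 - j4 - z4) *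
       qR q (k1 + j2 + l3 - z4 + 1) * qR q (k1 + k3 - l1 - l2 + z1 + z2) *
       qR q (k1 - k3 + j3 - j4 - l1 + l4 + z1 + z3) * qR q (j3 + j4 - l1 - l3 + z1 + z4) *
       qR q (l1 + l2 + l3 - l4 - z1 - z2 - z3 - z4))

/-- The largest value of each summation variable in formula (B). -/
def boundB : Spins → Fin 4 → ℕ
  | ⟨j1, j2, j3, j4, l1, l2, l3, l4, k1, k2, k3, k4⟩ =>
    ![⌊min (l1 + k2 - j3) (j1 + l1 - k1)⌋₊,
      ⌊min (l2 + j3 - k4) (j1 + l2 - k3)⌋₊,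
      ⌊min (j4 + k4 - l4) (j2 + k3 - l4)⌋₊,
      ⌊min (k1 - j2 + l3) (k2 + l3 - j4)⌋₊]

/-- On the whole summation range of formula (B), the numerator contains only `q`-factorials of
nonnegative integers. -/
def DefinedB : Spins → Prop
  | ⟨j1, j2, j3, j4, l1, l2, l3, l4, k1, k2, k3, k4⟩ =>
    ∀ z ∈ sumBox (boundB ⟨j1, j2, j3, j4, l1, l2, l3, l4, k1, k2, k3, k4⟩),
      let z1 : ℚ := z 0; let z2 : ℚ := z 1; let z3 : ℚ := z 2; let z4 : ℚ := z 3
      0 ≤ j3 + j4 + l2 - l4 - z2 - z3 ∧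
      0 ≤ k1 + k3 + l3 - l4 - z3 - z4 ∧
      0 ≤ j3 - j4 + k1 - k3 + l2 + l3 - z2 - z4

/-- The numerator parameters of the series formed by the separate sums in formula (B). -/
def upperB : Spins → (Fin 4 → ℕ) → Fin 4 → Fin 5 → ℚ
  | ⟨j1, j2, j3, j4, l1, l2, l3, l4, k1, k2, k3, k4⟩, z =>
    let z1 : ℚ := z 0; let z2 : ℚ := z 1; let z3 : ℚ := z 2; let z4 : ℚ := z 3
    ![![k2 + j3 - l1 + 1, k1 + j1 - l1 + 1, j3 - l1 - k2, k1 - j1 - l1,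
      l4 - l1 - l2 - l3 + z2 + z3 + z4],
     ![j1 - l2 + k3 + 1, k4 - l2 - j3, k3 - j1 - l2, -l2 - j3 - k4 - 1,
      l4 - l1 - l2 - l3 + z1 + z3 + z4],
     ![j2 - k3 + l4 + 1, k4 + l4 - j4 + 1, l4 - j4 - k4, l4 - j2 - k3,
      l4 - l1 - l2 - l3 + z1 + z2 + z4],
     ![j2 - k1 - l3, k2 - l3 + j4 + 1, j4 - k2 - l3, -k1 - j2 - l3 - 1,
      l4 - l1 - l2 - l3 + z1 + z2 + z3]]

/-- The denominator parameters of the series formed by the separate sums in formula (B). -/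
def lowerB : Spins → (Fin 4 → ℕ) → Fin 4 → Fin 4 → ℚ
  | ⟨j1, j2, j3, j4, l1, l2, l3, l4, k1, k2, k3, k4⟩, z =>
    let z1 : ℚ := z 0; let z2 : ℚ := z 1; let z3 : ℚ := z 2; let z4 : ℚ := z 3
    ![![-2*l1, k1 + k3 - l1 - l2 + z2 + 1, k1 - k3 + j3 - j4 - l1 + l4 + z3 + 1,
      j3 + j4 - l1 - l3 + z4 + 1],
     ![-2*l2, k1 + k3 - l1 - l2 + z1 + 1, l4 - j3 - j4 - l2 + z3,
      j4 - j3 - k1 + k3 - l2 - l3 + z4],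
     ![2*l4 + 2, l4 - j3 - j4 - l2 + z2, l4 - k1 - k3 - l3 + z4,
      k1 - k3 + j3 - j4 - l1 + l4 + z1 + 1],
     ![-2*l3, l4 - k1 - k3 - l3 + z3, j3 + j4 - l1 - l3 + z1 + 1,
      j4 - j3 - k1 + k3 - l2 - l3 + z2]]

/-- The factor in front of the fourfold sum in formula (C). -/
noncomputable def prefactorC (q : ℝ) : Spins → ℝ
  | ⟨j1, j2, j3, j4, l1, l2, l3, l4, k1, k2, k3, k4⟩ =>
    sgn (k1 - k2 + l1 - l2 + l3 + l4 - j2 + j4) *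
      ((nabla q k3 j1 l2 * nabla q j3 k4 l2 * nabla q j4 k4 l4 * nabla q k1 j2 l3) /
        (nabla q k1 j1 l1 * nabla q j3 k2 l1 * nabla q k3 j2 l4 * nabla q j4 k2 l3))

/-- The general term of the fourfold sum in formula (C). -/
noncomputable def summandC (q : ℝ) : Spins → (Fin 4 → ℕ) → ℝ
  | ⟨j1, j2, j3, j4, l1, l2, l3, l4, k1, k2, k3, k4⟩, z =>
    let z1 : ℚ := z 0; let z2 : ℚ := z 1; let z3 : ℚ := z 2; let z4 : ℚ := z 3
    (-1) ^ (z 1 + z 2 + z 3) *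
      (qF q (j3 + k2 - l1 + z1) * qF q (j1 + k1 - l1 + z1) * qF q (2*l1 - z1) *
       qF q (j1 + l2 - k3 + z2) * qF q (l2 - j3 + k4 + z2) * qF q (2*l4 - z3) *
       qF q (j2 - l4 + k3 + z3) * qF q (2*l3 - z4) * qF q (k2 - l3 + j4 + z4) *
       qF q (j3 + j4 - l2 + l4 - z2 - z3) * qF q (j3 - j4 + k1 + k3 - l2 + l3 - z2 - z4) *
       qF q (k1 - k3 + l3 + l4 - z3 - z4)) *
      (qR q (z1) * qR q (z2) * qR q (z3) * qR q (z4) * qR q (l1 + k2 - j3 - z1) *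
       qR q (j1 - k1 + l1 - z1) * qR q (j1 - l2 + k3 - z2) * qR q (j3 + k4 - l2 - z2) *
       qR q (2*l2 + z2 + 1) * qR q (j4 - k4 + l4 - z3) * qR q (j2 - k3 + l4 - z3) *
       qR q (j4 + k4 + l4 - z3 + 1) * qR q (k1 - j2 + l3 - z4) * qR q (k2 + l3 - j4 - z4) *
       qR q (k1 + j2 + l3 - z4 + 1) * qR q (k1 - k3 - l1 + l2 + z1 + z2) *
       qR q (j3 - j4 + k1 + k3 - l1 - l4 + z1 + z3) * qR q (j3 + j4 - l1 - l3 + z1 + z4) *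
       qR q (l1 - l2 + l3 + l4 - z1 - z2 - z3 - z4))

/-- The largest value of each summation variable in formula (C). -/
def boundC : Spins → Fin 4 → ℕ
  | ⟨j1, j2, j3, j4, l1, l2, l3, l4, k1, k2, k3, k4⟩ =>
    ![⌊min (l1 + k2 - j3) (j1 - k1 + l1)⌋₊,
      ⌊min (j1 - l2 + k3) (j3 + k4 - l2)⌋₊,
      ⌊min (j4 - k4 + l4) (j2 - k3 + l4)⌋₊,
      ⌊min (k1 - j2 + l3) (k2 + l3 - j4)⌋₊]

/-- On the whole summation range of formula (C), the numerator contains only `q`-factorials of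
nonnegative integers. -/
def DefinedC : Spins → Prop
  | ⟨j1, j2, j3, j4, l1, l2, l3, l4, k1, k2, k3, k4⟩ =>
    ∀ z ∈ sumBox (boundC ⟨j1, j2, j3, j4, l1, l2, l3, l4, k1, k2, k3, k4⟩),
      let z1 : ℚ := z 0; let z2 : ℚ := z 1; let z3 : ℚ := z 2; let z4 : ℚ := z 3
      0 ≤ j3 + j4 - l2 + l4 - z2 - z3 ∧
      0 ≤ j3 - j4 + k1 + k3 - l2 + l3 - z2 - z4 ∧
      0 ≤ k1 - k3 + l3 + l4 - z3 - z4

/-- The numerator parameters of the series formed by the separate sums in formula (C). -/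
def upperC : Spins → (Fin 4 → ℕ) → Fin 4 → Fin 5 → ℚ
  | ⟨j1, j2, j3, j4, l1, l2, l3, l4, k1, k2, k3, k4⟩, z =>
    let z1 : ℚ := z 0; let z2 : ℚ := z 1; let z3 : ℚ := z 2; let z4 : ℚ := z 3
    ![![j3 + k2 - l1 + 1, j1 + k1 - l1 + 1, j3 - l1 - k2, k1 - j1 - l1,
      l2 - l1 - l3 - l4 + z2 + z3 + z4],
     ![j1 + l2 - k3 + 1, l2 - j3 + k4 + 1, l2 - j1 - k3, l2 - j3 - k4,
      l2 - l1 - l3 - l4 + z1 + z3 + z4],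
     ![k4 - j4 - l4, j2 - l4 + k3 + 1, k3 - j2 - l4, -j4 - k4 - l4 - 1,
      l2 - l1 - l3 - l4 + z1 + z2 + z4],
     ![j2 - k1 - l3, k2 - l3 + j4 + 1, j4 - k2 - l3, -k1 - j2 - l3 - 1,
      l2 - l1 - l3 - l4 + z1 + z2 + z3]]

/-- The denominator parameters of the series formed by the separate sums in formula (C). -/
def lowerC : Spins → (Fin 4 → ℕ) → Fin 4 → Fin 4 → ℚ
  | ⟨j1, j2, j3, j4, l1, l2, l3, l4, k1, k2, k3, k4⟩, z =>
    let z1 : ℚ := z 0; let z2 : ℚ := z 1; let z3 : ℚ := z 2; let z4 : ℚ := z 3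
    ![![-2*l1, k1 - k3 - l1 + l2 + z2 + 1, j3 - j4 + k1 + k3 - l1 - l4 + z3 + 1,
      j3 + j4 - l1 - l3 + z4 + 1],
     ![2*l2 + 2, k1 - k3 - l1 + l2 + z1 + 1, l2 - j3 - j4 - l4 + z3,
      j4 - j3 - k1 - k3 + l2 - l3 + z4],
     ![-2*l4, l2 - j3 - j4 - l4 + z2, j3 - j4 + k1 + k3 - l1 - l4 + z1 + 1,
      k3 - k1 - l3 - l4 + z4],
     ![-2*l3, j4 - j3 - k1 - k3 + l2 - l3 + z2, j3 + j4 - l1 - l3 + z1 + 1,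
      k3 - k1 - l3 - l4 + z3]]

/-- The factor in front of the fourfold sum in formula (D). -/
noncomputable def prefactorD (q : ℝ) : Spins → ℝ
  | ⟨j1, j2, j3, j4, l1, l2, l3, l4, k1, k2, k3, k4⟩ =>
    sgn (k3 + k4 - l1 + l2 + l3 - l4 - j1 - j3) *
      ((nabla q j3 k2 l1 * nabla q k3 j1 l2 * nabla q j4 k4 l4 * nabla q k1 j2 l3) /
        (nabla q k1 j1 l1 * nabla q j3 k4 l2 * nabla q k3 j2 l4 * nabla q j4 k2 l3))

/-- The general term of the fourfold sum in formula (D). -/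
noncomputable def summandD (q : ℝ) : Spins → (Fin 4 → ℕ) → ℝ
  | ⟨j1, j2, j3, j4, l1, l2, l3, l4, k1, k2, k3, k4⟩, z =>
    let z1 : ℚ := z 0; let z2 : ℚ := z 1; let z3 : ℚ := z 2; let z4 : ℚ := z 3
    (-1) ^ (z 0 + z 1 + z 2) *
      (qF q (2*l1 - z1) * qF q (j1 + k1 - l1 + z1) * qF q (2*l2 - z2) *
       qF q (k4 + j3 - l2 + z2) * qF q (2*l4 - z3) * qF q (j2 + k3 - l4 + z3) *
       qF q (2*j2 - z4) * qF q (j2 + j4 + k1 - k2 - z4) * qF q (j2 + j4 + k1 + k2 - z4 + 1) *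
       qF q (l1 + l2 - k1 + k3 - z1 - z2) * qF q (j3 + j4 - k3 - k1 + l1 + l4 - z1 - z3) *
       qF q (l2 + l4 - j3 + j4 - z2 - z3)) *
      (qR q (z1) * qR q (l1 - k2 + j3 - z1) * qR q (j1 - k1 + l1 - z1) *
       qR q (l1 + k2 + j3 - z1 + 1) * qR q (z2) * qR q (k3 + l2 - j1 - z2) *
       qR q (l2 - j3 + k4 - z2) * qR q (j1 + l2 + k3 - z2 + 1) * qR q (z3) * qR q (z4) *
       qR q (j4 + l4 - k4 - z3) * qR q (j2 - k3 + l4 - z3) * qR q (j4 + k4 + l4 - z3 + 1) *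
       qR q (k1 + j2 - l3 - z4) * qR q (k1 + j2 + l3 - z4 + 1) * qR q (j2 + k3 - l4 + z3 - z4) *
       qR q (j2 - j3 + j4 + k1 - l1 + z1 - z4) * qR q (j2 + j3 + j4 - k3 - l2 + z2 - z4) *
       qR q (l1 + l2 + l4 - k1 - j2 - z1 - z2 - z3 + z4))

/-- The largest value of each summation variable in formula (D). -/
def boundD : Spins → Fin 4 → ℕ
  | ⟨j1, j2, j3, j4, l1, l2, l3, l4, k1, k2, k3, k4⟩ =>
    ![⌊min (l1 - k2 + j3) (j1 - k1 + l1)⌋₊,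
      ⌊min (k3 + l2 - j1) (l2 - j3 + k4)⌋₊,
      ⌊min (j4 + l4 - k4) (j2 - k3 + l4)⌋₊,
      ⌊k1 + j2 - l3⌋₊]

/-- On the whole summation range of formula (D), the numerator contains only `q`-factorials of
nonnegative integers. -/
def DefinedD : Spins → Prop
  | ⟨j1, j2, j3, j4, l1, l2, l3, l4, k1, k2, k3, k4⟩ =>
    ∀ z ∈ sumBox (boundD ⟨j1, j2, j3, j4, l1, l2, l3, l4, k1, k2, k3, k4⟩),
      let z1 : ℚ := z 0; let z2 : ℚ := z 1; let z3 : ℚ := z 2; let z4 : ℚ := z 3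
      0 ≤ l1 + l2 - k1 + k3 - z1 - z2 ∧
      0 ≤ j3 + j4 - k3 - k1 + l1 + l4 - z1 - z3 ∧
      0 ≤ l2 + l4 - j3 + j4 - z2 - z3

/-- The numerator parameters of the series formed by the separate sums in formula (D). -/
def upperD : Spins → (Fin 4 → ℕ) → Fin 4 → Fin 5 → ℚ
  | ⟨j1, j2, j3, j4, l1, l2, l3, l4, k1, k2, k3, k4⟩, z =>
    let z1 : ℚ := z 0; let z2 : ℚ := z 1; let z3 : ℚ := z 2; let z4 : ℚ := z 3
    ![![j1 + k1 - l1 + 1, k2 - l1 - j3, k1 - j1 - l1, -l1 - k2 - j3 - 1,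
      k1 - l1 - l2 - l4 + j2 + z2 + z3 - z4],
     ![k4 + j3 - l2 + 1, j1 - k3 - l2, j3 - l2 - k4, -j1 - l2 - k3 - 1,
      k1 - l1 - l2 - l4 + j2 + z1 + z3 - z4],
     ![j2 + k3 - l4 + 1, k4 - j4 - l4, k3 - j2 - l4, -j4 - k4 - l4 - 1,
      k1 - l1 - l2 - l4 + j2 + z1 + z2 - z4],
     ![l3 - k1 - j2, -k1 - j2 - l3 - 1, l4 - j2 - k3 - z3, j3 - j2 - j4 - k1 + l1 - z1,
      k3 - j2 - j3 - j4 + l2 - z2]]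

/-- The denominator parameters of the series formed by the separate sums in formula (D). -/
def lowerD : Spins → (Fin 4 → ℕ) → Fin 4 → Fin 4 → ℚ
  | ⟨j1, j2, j3, j4, l1, l2, l3, l4, k1, k2, k3, k4⟩, z =>
    let z1 : ℚ := z 0; let z2 : ℚ := z 1; let z3 : ℚ := z 2; let z4 : ℚ := z 3
    ![![-2*l1, k1 - l1 - l2 - k3 + z2, k3 - j3 - j4 + k1 - l1 - l4 + z3,
      j2 - j3 + j4 + k1 - l1 - z4 + 1],
     ![-2*l2, k1 - l1 - l2 - k3 + z1, j2 + j3 + j4 - k3 - l2 - z4 + 1, j3 - l2 - l4 - j4 + z3],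
     ![-2*l4, j2 + k3 - l4 - z4 + 1, k3 - j3 - j4 + k1 - l1 - l4 + z1, j3 - l2 - l4 - j4 + z2],
     ![-2*j2, k2 - j2 - j4 - k1, -j2 - j4 - k1 - k2 - 1,
      l1 + l2 + l4 - k1 - j2 - z1 - z2 - z3 + 1]]

/-- The right-hand side of formula (A). -/
noncomputable def formulaA (q : ℝ) (s : Spins) : ℝ :=
  prefactorA q s * ∑ z ∈ sumBox (boundA s), summandA q s z

/-- The right-hand side of formula (B). -/
noncomputable def formulaB (q : ℝ) (s : Spins) : ℝ :=
  prefactorB q s * ∑ z ∈ sumBox (boundB s), summandB q s z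

/-- The right-hand side of formula (C). -/
noncomputable def formulaC (q : ℝ) (s : Spins) : ℝ :=
  prefactorC q s * ∑ z ∈ sumBox (boundC s), summandC q s z

/-- The right-hand side of formula (D). -/
noncomputable def formulaD (q : ℝ) (s : Spins) : ℝ :=
  prefactorD q s * ∑ z ∈ sumBox (boundD s), summandD q s z

/-! Up to sign, the `x`-dependence of a `6j` coefficient can be separated. Racah's sum transforms
into other single sums over a new index `z`, in which `x` occurs only in `∇` factors, a sign, and
one factor per term: either `cutAbove q p x = 1/([p-x]![p+x+1]!)` or `cutBelow q v x =
[x+v]!/[x-v]!`, with `p` or `v` depending on `z`. There are four such expansions (`sixj_eq_coefOne`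
to `sixj_eq_coefFour`). They come from expanding part of the Racah summand by a Saalschütz sum read
backwards and then doing the original sum by a Saalschütz sum again.

For each of (A)-(D) the four `6j` coefficients are expanded so that the `∇` factors containing `x`
cancel in the product. The sums are interchanged. What remains for each `(z₁,…,z₄)` is a sum over
`x` with weight `[2x+1]` of either two `cutAbove` and two `cutBelow` factors, without sign (formula
(A)), or one `cutAbove` and three `cutBelow` factors, with sign `(-1)^x` (formulas (B)-(D)). Both
are terminating very-well-poised series and are summed by `dougall`. The factorials `[vᵢ+vⱼ]!` that
appear are the ones whose arguments the conditions in part 2 require to be non-negative.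

The interchange has one obstacle: the expansions represent the `6j` coefficients only where the
triangle conditions on `x` hold, but Dougall's sum runs over the whole common support of the four
factors. It must be shown that the product of the four expansions vanishes at the other `x`. Part of
this is visible from the supports. The rest holds because the expansion then is an `n`-th
alternating `q`-binomial sum of a product of exactly `n-1` brackets `[s+z]`, which is `0`
(`sum_alternating_rise_eq_zero`). The implications obtained from the four expansions chain together
to give all the triangle inequalities.

Balancedness is a statement about term ratios: they are read off the factorials, and the leading
index `m` is fixed by the smallest relevant denominator parameter (`isBalancedSum_of_recurrence`).
The rearrangements and the symmetry of the coefficient follow from the classical symmetries of the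
`6j` coefficients. -/

section

variable {q : ℝ}

/-! ### `q`-numbers, `q`-factorials and rising `q`-factorials of integers. -/

/-- The `q`-number of an integer. -/
noncomputable def qInt (q : ℝ) (n : ℤ) : ℝ := qnum q n

/-- The `q`-factorial of an integer (equal to `1` at negative arguments). -/
noncomputable def qFac (q : ℝ) (n : ℤ) : ℝ := qF q n

/-- The reciprocal `q`-factorial of an integer, `0` at negative arguments. -/
noncomputable def qInv (q : ℝ) (n : ℤ) : ℝ := qR q n

/-- The rising `q`-factorial `[a][a+1]⋯[a+n-1]` of an integer. -/
noncomputable def qRise (q : ℝ) (a : ℤ) (n : ℕ) : ℝ := ∏ k ∈ range n, qInt q (a + k)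

lemma qInt_eq_of_ne (hq : 0 < q) (h1 : q ≠ 1) (n : ℤ) :
    qInt q n = (q ^ n - (q ^ n)⁻¹) / (q - q⁻¹) := by
  have h2 : (((n : ℚ) : ℝ)) = ((n : ℤ) : ℝ) := by push_cast; rfl
  rw [qInt, qnum, if_neg h1, h2, Real.rpow_neg hq.le, Real.rpow_intCast]

lemma qInt_one_left (n : ℤ) : qInt 1 n = n := by simp [qInt, qnum]

lemma sub_inv_ne_zero (hq : 0 < q) (h1 : q ≠ 1) : q - q⁻¹ ≠ 0 := by
  intro h
  have : q * q = 1 := by field_simp at h; nlinarith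
  exact h1 (by nlinarith)

/-- Product-to-sum formula, as for `sinh`. The function `C` differs for `q = 1` and `q ≠ 1`, but
only its existence matters. -/
lemma exists_qInt_mul (hq : 0 < q) : ∃ C : ℤ → ℝ, ∀ x y,
    qInt q x * qInt q y = C (x + y) - C (x - y) := by
  by_cases h1 : q = 1
  · subst h1
    exact ⟨fun n => (n : ℝ) ^ 2 / 4, fun x y => by simp only [qInt_one_left]; push_cast; ring⟩
  · refine ⟨fun n => (q ^ n + (q ^ n)⁻¹) / (q - q⁻¹) ^ 2, fun x y => ?_⟩
    have h0 := hq.ne'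
    have := sub_inv_ne_zero hq h1
    simp only [qInt_eq_of_ne hq h1, zpow_add₀ h0, zpow_sub₀ h0]
    have hx : q ^ x ≠ 0 := zpow_ne_zero _ h0
    have hy : q ^ y ≠ 0 := zpow_ne_zero _ h0
    generalize q ^ x = X at *
    generalize q ^ y = Y at *
    generalize q - q⁻¹ = D at *
    field_simp
    ring

/-- The values of `C` telescope. This three-term relation carries the induction steps of all three
summation formulas below, so that `q = 1` needs no separate treatment there. -/
lemma qInt_mul_eq_add (hq : 0 < q) {x y z w u v : ℤ} (h1 : x + y = z + w) (h2 : z - w = u + v)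
    (h3 : x - y = u - v) : qInt q x * qInt q y = qInt q z * qInt q w + qInt q u * qInt q v := by
  obtain ⟨C, hC⟩ := exists_qInt_mul hq
  rw [hC, hC, hC, h1, h2, h3]; ring

@[simp] lemma qInt_zero : qInt q 0 = 0 := by
  by_cases h : q = 1 <;> simp [qInt, qnum, h]

lemma qInt_neg (n : ℤ) : qInt q (-n) = -qInt q n := by
  by_cases h : q = 1
  · simp [qInt, qnum, h]
  · simp only [qInt, qnum, if_neg h]; push_cast; rw [neg_neg]; ring

lemma qInt_pos (hq : 0 < q) {n : ℤ} (hn : 0 < n) : 0 < qInt q n := by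
  by_cases h1 : q = 1
  · subst h1; rw [qInt_one_left]; exact_mod_cast hn
  · rw [qInt_eq_of_ne hq h1]
    rcases lt_or_gt_of_ne h1 with h | h
    · have a0 : 0 < q ^ n := zpow_pos hq _
      have a1 : q ^ n < 1 := by
        lift n to ℕ using hn.le
        rw [zpow_natCast]
        exact pow_lt_one₀ hq.le h (by omega)
      have a2 : 1 < (q ^ n)⁻¹ := (one_lt_inv₀ a0).2 a1
      have a3 : 1 < q⁻¹ := (one_lt_inv₀ hq).2 h
      exact div_pos_of_neg_of_neg (by linarith) (by linarith)
    · have a1 : 1 < q ^ n := one_lt_zpow₀ h hn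
      have a2 : (q ^ n)⁻¹ < 1 := inv_lt_one_of_one_lt₀ a1
      have a3 : q⁻¹ < 1 := inv_lt_one_of_one_lt₀ h
      exact div_pos (by linarith) (by linarith)

lemma qInt_ne_zero (hq : 0 < q) {n : ℤ} (hn : n ≠ 0) : qInt q n ≠ 0 := by
  rcases lt_or_gt_of_ne hn with h | h
  · have := qInt_pos hq (n := -n) (by omega)
    rw [qInt_neg] at this
    intro h; rw [h] at this; simp at this
  · exact (qInt_pos hq h).ne'

lemma qFac_eq_prod (n : ℤ) : qFac q n = ∏ i ∈ range n.toNat, qInt q (i + 1) := by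
  have : ⌊(n : ℚ)⌋₊ = n.toNat := by
    rcases le_total 0 n with h | h
    · lift n to ℕ using h; simp
    · rw [Int.toNat_of_nonpos h, Nat.floor_of_nonpos (by exact_mod_cast h)]
  simp only [qFac, qF, qInt, this]
  push_cast; rfl

lemma qFac_natCast_succ (n : ℕ) : qFac q (n + 1) = qFac q n * qInt q (n + 1) := by
  rw [qFac_eq_prod, qFac_eq_prod, show ((n : ℤ) + 1).toNat = n + 1 by omega, prod_range_succ,
    show ((n : ℤ)).toNat = n by omega]

lemma qFac_succ {n : ℤ} (hn : 0 ≤ n) : qFac q (n + 1) = qFac q n * qInt q (n + 1) := by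
  lift n to ℕ using hn; exact qFac_natCast_succ n

lemma qFac_pos (hq : 0 < q) (n : ℤ) : 0 < qFac q n := by
  rw [qFac_eq_prod]; exact prod_pos fun i _ => qInt_pos hq (by omega)

lemma qFac_ne_zero (hq : 0 < q) (n : ℤ) : qFac q n ≠ 0 := (qFac_pos hq n).ne'

lemma qInv_of_nonneg {n : ℤ} (hn : 0 ≤ n) : qInv q n = (qFac q n)⁻¹ := by
  have : (0 : ℚ) ≤ n := by exact_mod_cast hn
  rw [qInv, qR, if_pos this, qFac]

lemma qInv_of_neg {n : ℤ} (hn : n < 0) : qInv q n = 0 := by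
  have : ¬ (0 : ℚ) ≤ n := by push Not; exact_mod_cast hn
  rw [qInv, qR, if_neg this]

lemma nonneg_of_qInv_ne_zero {n : ℤ} (h : qInv q n ≠ 0) : 0 ≤ n := by
  by_contra hn; exact h (qInv_of_neg (by omega))

@[simp] lemma qFac_zero : qFac q 0 = 1 := by simp [qFac_eq_prod]

@[simp] lemma qInv_zero : qInv q 0 = 1 := by rw [qInv_of_nonneg le_rfl]; simp

lemma qInv_ne_zero (hq : 0 < q) {n : ℤ} (hn : 0 ≤ n) : qInv q n ≠ 0 := by
  rw [qInv_of_nonneg hn]; exact inv_ne_zero (qFac_ne_zero hq n)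

lemma qFac_mul_qInv (hq : 0 < q) {n : ℤ} (hn : 0 ≤ n) : qFac q n * qInv q n = 1 := by
  rw [qInv_of_nonneg hn, mul_inv_cancel₀ (qFac_ne_zero hq n)]

/-- Unlike the recurrence for `qFac`, this holds for every integer: at `n = -1` the factor `[0]`
agrees with the convention `1/[n]! = 0` for `n < 0`. -/
lemma qInv_eq_mul_succ (hq : 0 < q) (n : ℤ) : qInv q n = qInt q (n + 1) * qInv q (n + 1) := by
  rcases lt_trichotomy n (-1) with h | rfl | h
  · rw [qInv_of_neg (by omega), qInv_of_neg (by omega), mul_zero]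
  · simp [qInv_of_neg]
  · rw [qInv_of_nonneg (by omega), qInv_of_nonneg (by omega), qFac_succ (by omega)]
    have := qInt_ne_zero hq (n := n + 1) (by omega)
    have := qFac_ne_zero hq n
    field_simp

@[simp] lemma qRise_zero (a : ℤ) : qRise q a 0 = 1 := by simp [qRise]

lemma qRise_succ (a : ℤ) (n : ℕ) : qRise q a (n + 1) = qRise q a n * qInt q (a + n) := by
  rw [qRise, prod_range_succ, ← qRise]

lemma qRise_succ' (a : ℤ) (n : ℕ) : qRise q a (n + 1) = qInt q a * qRise q (a + 1) n := by
  rw [qRise, prod_range_succ', mul_comm, qRise]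
  simp only [Nat.cast_zero, add_zero, Nat.cast_add, Nat.cast_one]
  congr 1; exact prod_congr rfl fun k _ => by rw [show a + ((k : ℤ) + 1) = a + 1 + k by ring]

/-- `a` itself may be non-positive: then the product contains `[0]`, and `1/[a-1]!` is `0` as well.
-/
lemma qRise_eq_fac (hq : 0 < q) (a : ℤ) (n : ℕ) (h : 0 < a + n) :
    qRise q a n = qFac q (a + n - 1) * qInv q (a - 1) := by
  induction n generalizing a with
  | zero => simp only [qRise_zero, Nat.cast_zero, add_zero] at *; rw [qFac_mul_qInv hq (by omega)]
  | succ n ih =>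
    rw [qRise_succ', ih (a + 1) (by push_cast at *; omega), qInv_eq_mul_succ hq (a - 1)]
    push_cast
    ring_nf

lemma qRise_neg_eq_fac (hq : 0 < q) (b : ℤ) (n : ℕ) (h : 0 ≤ b) :
    qRise q (-b) n = (-1) ^ n * qFac q b * qInv q (b - n) := by
  induction n with
  | zero => simp [qFac_mul_qInv hq h]
  | succ n ih =>
    rw [qRise_succ, ih, show -b + (n : ℤ) = -(b - n) by ring, qInt_neg,
      show (b - ((n + 1 : ℕ) : ℤ)) = b - n - 1 by push_cast; ring,
      qInv_eq_mul_succ hq (b - n - 1)]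
    ring_nf

/-! ### Three terminating summation formulas: Saalschütz, vanishing alternating sums, Dougall. -/

/-- The `q`-Saalschütz sum with parameter denominators cleared, so that it holds for all integers
`a, b, c`. Induction on `n`: after multiplication by `[n+1]` each term splits into a part with
factor `[p.2]` and a part with factor `[p.1]`. Shifting these indices gives two sums over the
smaller antidiagonal, whose terms recombine by the three-term relation. -/
lemma saalschutz (hq : 0 < q) (a b c : ℤ) (n : ℕ) :
    ∑ p ∈ antidiagonal n, qInv q p.1 * qInv q p.2 * qRise q a p.1 * qRise q b p.1 *
      qRise q (c + p.1) p.2 * qRise q (c - a - b) p.2 =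
    qInv q n * qRise q (c - a) n * qRise q (c - b) n := by
  induction n with
  | zero => simp
  | succ n ih =>
    have h0 : qInt q ((n : ℤ) + 1) ≠ 0 := qInt_ne_zero hq (by omega)
    apply mul_left_cancel₀ h0
    have e1 : qInt q ((n : ℤ) + 1) * (qInv q ((n + 1 : ℕ) : ℤ) * qRise q (c - a) (n + 1) *
        qRise q (c - b) (n + 1)) = qInt q (c - a + n) * qInt q (c - b + n) *
        (qInv q n * qRise q (c - a) n * qRise q (c - b) n) := by
      rw [qInv_eq_mul_succ hq n, qRise_succ, qRise_succ]; push_cast; ring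
    rw [e1, ← ih, mul_sum, mul_sum]
    -- The truncated subtraction in `p.2 - 1` is harmless, since `[p.2] = 0` at `p.2 = 0`.
    set G1 : ℕ × ℕ → ℝ := fun p => qInt q (c + n + p.1) * qInt q p.2 * qInv q p.1 * qInv q p.2 *
      qRise q a p.1 * qRise q b p.1 * qRise q (c + p.1) (p.2 - 1) * qRise q (c - a - b) p.2 with hG1
    set G2 : ℕ × ℕ → ℝ := fun p => qInt q p.1 * qInv q p.1 * qInv q p.2 *
      qRise q a p.1 * qRise q b p.1 * qRise q (c + p.1 - 1) p.2 * qRise q (c - a - b) p.2 with hG2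
    have s1 : ∑ p ∈ antidiagonal (n + 1), G1 p = ∑ p ∈ antidiagonal n, G1 (p.1, p.2 + 1) := by
      rw [Nat.sum_antidiagonal_succ']; simp [hG1]
    have s2 : ∑ p ∈ antidiagonal (n + 1), G2 p = ∑ p ∈ antidiagonal n, G2 (p.1 + 1, p.2) := by
      rw [Nat.sum_antidiagonal_succ]; simp [hG2]
    have e2 : ∀ p ∈ antidiagonal (n + 1), qInt q ((n : ℤ) + 1) * (qInv q p.1 * qInv q p.2 *
        qRise q a p.1 * qRise q b p.1 * qRise q (c + p.1) p.2 * qRise q (c - a - b) p.2) =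
        G1 p + G2 p := by
      rintro ⟨i, j⟩ h
      rw [HasAntidiagonal.mem_antidiagonal] at h
      simp only [hG1, hG2] at h ⊢
      have : qInt q ((n : ℤ) + 1) * qRise q (c + i) j = qInt q i * qRise q (c + i - 1) j +
          qInt q (c + n + i) * qInt q j * qRise q (c + i) (j - 1) := by
        rcases j with _ | j
        · simp only [qRise_zero, Nat.cast_zero, qInt_zero]
          rw [show (n : ℤ) + 1 = i by omega]; ring
        · rw [qRise_succ, qRise_succ', Nat.add_sub_cancel, sub_add_cancel,
            show c + (i : ℤ) + j = c + n by omega]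
          have := qInt_mul_eq_add hq (x := n + 1) (y := c + n) (z := c + n + i) (w := j + 1)
            (u := i) (v := c + i - 1) (by omega) (by omega) (by omega)
          push_cast
          linear_combination (qRise q (c + i) j) * this
      linear_combination (qInv q i * qInv q j * qRise q a i * qRise q b i *
        qRise q (c - a - b) j) * this
    rw [sum_congr rfl e2, sum_add_distrib, s1, s2, ← sum_add_distrib]
    refine sum_congr rfl ?_
    rintro ⟨i, j⟩ h
    rw [HasAntidiagonal.mem_antidiagonal] at h
    simp only [hG1, hG2] at h ⊢
    have h3 := qInt_mul_eq_add hq (x := c - a + n) (y := c - b + n) (z := c + n + i)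
      (w := c - a - b + j) (u := b + i) (v := a + i) (by omega) (by omega) (by omega)
    rw [h3, qInv_eq_mul_succ hq i, qInv_eq_mul_succ hq j, qRise_succ, qRise_succ, qRise_succ]
    push_cast
    rw [show c + ((i : ℤ) + 1) - 1 = c + i by ring]
    ring

/-- A `q`-analogue of the vanishing of `n`-th differences of polynomials of degree `n - 1`. For `q ≠
1` the number of brackets matters also modulo 2: the alternating `q`-binomial sum annihilates `q^(m
i)` for `m = -(n-1), -(n-3), …, n-1`, and a product of `n - 1` brackets contains just these
exponents. In the proof `[n+1][a+i] = [a+n+1][i] + [j][a]` removes one bracket from the list. -/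
lemma sum_alternating_rise_eq_zero (hq : 0 < q) (n : ℕ) (L : List ℤ) (hL : L.length + 1 = n) :
    ∑ p ∈ antidiagonal n, (-1) ^ p.1 * qInv q p.1 * qInv q p.2 *
      (L.map fun s => qInt q (s + p.1)).prod = 0 := by
  induction n generalizing L with
  | zero => omega
  | succ n ih =>
    rcases L with _ | ⟨a, L⟩
    · obtain rfl : n = 0 := by simpa using hL.symm
      simp [Nat.antidiagonal_succ]
    simp only [List.length_cons, Nat.add_right_cancel_iff] at hL
    have h0 : qInt q ((n : ℤ) + 1) ≠ 0 := qInt_ne_zero hq (by omega)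
    apply mul_left_cancel₀ h0
    rw [mul_zero, mul_sum]
    set G1 : ℕ × ℕ → ℝ := fun p => qInt q a * qInt q p.2 * ((-1) ^ p.1 * qInv q p.1 * qInv q p.2 *
      (L.map fun s => qInt q (s + p.1)).prod) with hG1
    set G2 : ℕ × ℕ → ℝ := fun p => qInt q (a + n + 1) * qInt q p.1 * ((-1) ^ p.1 * qInv q p.1 *
      qInv q p.2 * (L.map fun s => qInt q (s + p.1)).prod) with hG2
    have s1 : ∑ p ∈ antidiagonal (n + 1), G1 p = ∑ p ∈ antidiagonal n, G1 (p.1, p.2 + 1) := by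
      rw [Nat.sum_antidiagonal_succ']; simp [hG1]
    have s2 : ∑ p ∈ antidiagonal (n + 1), G2 p = ∑ p ∈ antidiagonal n, G2 (p.1 + 1, p.2) := by
      rw [Nat.sum_antidiagonal_succ]; simp [hG2]
    have e2 : ∀ p ∈ antidiagonal (n + 1), qInt q ((n : ℤ) + 1) * ((-1) ^ p.1 * qInv q p.1 *
        qInv q p.2 * ((a :: L).map fun s => qInt q (s + p.1)).prod) = G1 p + G2 p := by
      rintro ⟨i, j⟩ h
      rw [HasAntidiagonal.mem_antidiagonal] at h
      simp only [hG1, hG2, List.map_cons, List.prod_cons] at h ⊢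
      have := qInt_mul_eq_add hq (x := n + 1) (y := a + i) (z := a + n + 1) (w := i)
            (u := j) (v := a) (by omega) (by omega) (by omega)
      linear_combination ((-1) ^ i * qInv q i * qInv q j *
        (L.map fun s => qInt q (s + i)).prod) * this
    rw [sum_congr rfl e2, sum_add_distrib, s1, s2]
    have f1 : ∑ p ∈ antidiagonal n, G1 (p.1, p.2 + 1) = 0 := by
      rw [← mul_zero (qInt q a), ← ih L hL, mul_sum]
      refine sum_congr rfl ?_
      rintro ⟨i, j⟩ h
      simp only [hG1]
      rw [qInv_eq_mul_succ hq j]; push_cast; ring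
    have f2 : ∑ p ∈ antidiagonal n, G2 (p.1 + 1, p.2) = 0 := by
      rw [← mul_zero (-qInt q (a + n + 1)), ← ih (L.map (1 + ·)) (by simpa using hL), mul_sum]
      refine sum_congr rfl ?_
      rintro ⟨i, j⟩ h
      simp only [hG2, List.map_map, Function.comp_def]
      rw [qInv_eq_mul_succ hq i]
      have : ∀ s : ℤ, s + ((i + 1 : ℕ) : ℤ) = 1 + s + i := fun s => by push_cast; ring
      simp only [this]
      push_cast; ring
    rw [f1, f2, add_zero]

/-- The terminating very-well-poised sum `₅F₄(a, 1+a/2, b, c, -n; …; 1)` in its `q`-version. The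
induction lowers `n` and raises `a` by one; after the index shifts both parts have the same
denominator `(a+1+i)_(n+1)`. Positivity of `a` keeps the inverted factors non-zero. -/
lemma dougall (hq : 0 < q) (a b c : ℤ) (n : ℕ) (ha : 0 < a) :
    ∑ p ∈ antidiagonal n, (-1) ^ p.1 * qInv q p.1 * qInv q p.2 * qInt q (a + 2 * p.1) *
      qRise q b p.1 * qRise q c p.1 * qRise q (1 + a - b + p.1) p.2 *
      qRise q (1 + a - c + p.1) p.2 * (qRise q (a + p.1) (n + 1))⁻¹ =
    qInv q n * qRise q (1 + a - b - c) n := by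
  induction n generalizing a with
  | zero =>
    have := qInt_ne_zero hq ha.ne'
    simp [qRise_succ, this]
  | succ n ih =>
    have h0 : qInt q ((n : ℤ) + 1) ≠ 0 := qInt_ne_zero hq (by omega)
    apply mul_left_cancel₀ h0
    have e1 : qInt q ((n : ℤ) + 1) * (qInv q ((n + 1 : ℕ) : ℤ) * qRise q (1 + a - b - c) (n + 1)) =
        qInt q (1 + a - b - c) * (qInv q n * qRise q (1 + (a + 1) - b - c) n) := by
      rw [qInv_eq_mul_succ hq n, qRise_succ', show 1 + a - b - c + 1 = 1 + (a + 1) - b - c by ring]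
      push_cast; ring
    rw [e1, ← ih (a + 1) (by omega), mul_sum, mul_sum]
    set g : ℕ × ℕ → ℝ := fun p => (-1) ^ p.1 * qInv q p.1 * qInv q p.2 *
      qRise q b p.1 * qRise q c p.1 * qRise q (1 + a - b + p.1) p.2 *
      qRise q (1 + a - c + p.1) p.2 with hg
    set G1 : ℕ × ℕ → ℝ := fun p => qInt q p.2 * g p * (qRise q (a + p.1 + 1) (n + 1))⁻¹ with hG1
    set G2 : ℕ × ℕ → ℝ := fun p => qInt q p.1 * g p * (qRise q (a + p.1) (n + 1))⁻¹ with hG2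
    have s1 : ∑ p ∈ antidiagonal (n + 1), G1 p = ∑ p ∈ antidiagonal n, G1 (p.1, p.2 + 1) := by
      rw [Nat.sum_antidiagonal_succ']; simp [hG1]
    have s2 : ∑ p ∈ antidiagonal (n + 1), G2 p = ∑ p ∈ antidiagonal n, G2 (p.1 + 1, p.2) := by
      rw [Nat.sum_antidiagonal_succ]; simp [hG2]
    have e2 : ∀ p ∈ antidiagonal (n + 1), qInt q ((n : ℤ) + 1) *
        ((-1) ^ p.1 * qInv q p.1 * qInv q p.2 * qInt q (a + 2 * p.1) *
        qRise q b p.1 * qRise q c p.1 * qRise q (1 + a - b + p.1) p.2 *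
        qRise q (1 + a - c + p.1) p.2 * (qRise q (a + p.1) (n + 1 + 1))⁻¹) = G1 p + G2 p := by
      rintro ⟨i, j⟩ h
      rw [HasAntidiagonal.mem_antidiagonal] at h
      simp only [hG1, hG2, hg] at h ⊢
      have h1 := qInt_mul_eq_add hq (x := n + 1) (y := a + 2 * i) (z := a + n + 1 + i) (w := i)
            (u := j) (v := a + i) (by omega) (by omega) (by omega)
      have h2 : (qRise q (a + i) (n + 1))⁻¹ =
          qInt q (a + n + 1 + i) * (qRise q (a + i) (n + 1 + 1))⁻¹ := by
        rw [qRise_succ _ (n + 1)]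
        have : qInt q (a + n + 1 + i) ≠ 0 := qInt_ne_zero hq (by omega)
        rw [show a + (i : ℤ) + ((n + 1 : ℕ) : ℤ) = a + n + 1 + i by push_cast; ring, mul_inv,
          mul_comm (_⁻¹), mul_inv_cancel_left₀ this]
      have h3 : (qRise q (a + i + 1) (n + 1))⁻¹ =
          qInt q (a + i) * (qRise q (a + i) (n + 1 + 1))⁻¹ := by
        rw [qRise_succ' _ (n + 1)]
        have : qInt q (a + i) ≠ 0 := qInt_ne_zero hq (by omega)
        rw [mul_inv, mul_inv_cancel_left₀ this]
      rw [h2, h3]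
      linear_combination ((-1) ^ i * qInv q i * qInv q j *
        qRise q b i * qRise q c i * qRise q (1 + a - b + i) j *
        qRise q (1 + a - c + i) j * (qRise q (a + i) (n + 1 + 1))⁻¹) * h1
    rw [sum_congr rfl e2, sum_add_distrib, s1, s2, ← sum_add_distrib]
    refine sum_congr rfl ?_
    rintro ⟨i, j⟩ h
    rw [HasAntidiagonal.mem_antidiagonal] at h
    simp only [hG1, hG2, hg] at h ⊢
    -- This recombination produces the very-well-poised factor `[(a+1)+2i]` of the induction
    -- hypothesis and the constant `[1+a-b-c]` of the right-hand side.
    have h3 := qInt_mul_eq_add hq (x := 1 + a - b + i) (y := 1 + a - c + i) (z := 1 + a + 2 * i)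
      (w := 1 + a - b - c) (u := c + i) (v := b + i) (by omega) (by omega) (by omega)
    rw [qInv_eq_mul_succ hq i, qInv_eq_mul_succ hq j, qRise_succ b, qRise_succ c,
      qRise_succ' (1 + a - b + i), qRise_succ' (1 + a - c + i)]
    push_cast
    rw [show 1 + a - b + ((i : ℤ) + 1) = 1 + (a + 1) - b + i by ring,
      show 1 + a - c + ((i : ℤ) + 1) = 1 + (a + 1) - c + i by ring,
      show 1 + a - b + (i : ℤ) + 1 = 1 + (a + 1) - b + i by ring,
      show 1 + a - c + (i : ℤ) + 1 = 1 + (a + 1) - c + i by ring,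
      show a + ((i : ℤ) + 1) = a + 1 + i by ring, show a + (i : ℤ) + 1 = a + 1 + i by ring,
      show a + 1 + 2 * (i : ℤ) = 1 + a + 2 * i by ring]
    linear_combination ((-1) ^ i * (qInt q ((i : ℤ) + 1) * qInv q ((i : ℤ) + 1)) *
      (qInt q ((j : ℤ) + 1) * qInv q ((j : ℤ) + 1)) * qRise q b i * qRise q c i *
      qRise q (1 + (a + 1) - b + i) j * qRise q (1 + (a + 1) - c + i) j *
      (qRise q (a + 1 + i) (n + 1))⁻¹) * h3

/-! ### Reindexing, and Saalschütz sums in terms of factorials. -/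

/-- Both sides sum `f` over its support, once downwards from `c` and once upwards from `b`; the
lengths of the ranges are otherwise arbitrary. -/
lemma sum_range_reindex (f : ℤ → ℝ) (b c : ℤ) (N n : ℕ)
    (h : ∀ w, f w ≠ 0 → (0 ≤ c - w ∧ c - w < N) ∧ (0 ≤ w - b ∧ w - b < n)) :
    ∑ z ∈ range N, f (c - z) = ∑ k ∈ range n, f (b + k) := by
  refine sum_bij_ne_zero (fun z _ _ => (c - z - b).toNat) ?_ ?_ ?_ ?_
  · intro z _ h0
    have := h _ h0
    rw [mem_range]; omega
  · intro z _ h0 z' _ h0' he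
    have := h _ h0
    have := h _ h0'
    omega
  · intro k _ h0
    have := h _ h0
    refine ⟨(c - (b + k)).toNat, by rw [mem_range]; omega, ?_, by omega⟩
    rw [show c - (((c - (b + k)).toNat : ℕ) : ℤ) = b + k by omega]; exact h0
  · intro z _ h0
    have := h _ h0
    congr 1; omega

lemma sum_range_eq_of_support (f : ℕ → ℝ) (m n : ℕ) (h : ∀ z, f z ≠ 0 → z < m ∧ z < n) :
    ∑ z ∈ range m, f z = ∑ z ∈ range n, f z := by
  refine sum_bij_ne_zero (fun z _ _ => z) ?_ ?_ ?_ ?_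
  · intro z _ h0; exact mem_range.2 (h z h0).2
  · intro z _ _ z' _ _ he; exact he
  · intro z _ h0; exact ⟨z, mem_range.2 (h z h0).1, h0, rfl⟩
  · intro z _ _; rfl

/-- This is `saalschutz` with `a = -B`, `b = -C`, `c = G + 1`, `n = A`; the two signs `(-1)^k`
cancel. The inequalities keep the arguments of all numerator factorials non-negative. -/
lemma saalschutz_fac (hq : 0 < q) (A : ℕ) (B C G : ℤ) (hB : 0 ≤ B) (hC : 0 ≤ C)
    (hA : 0 ≤ A + G) (hBG : 0 ≤ B + G) (hCG : 0 ≤ C + G) :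
    ∑ z ∈ range (A + 1), qFac q (A + B + C + G - z) * qInv q z * qInv q (A - z) *
      qInv q (B - z) * qInv q (C - z) * qInv q (G + z) =
    qFac q (A + B + G) * qFac q (A + C + G) * qFac q (B + C + G) * qInv q A * qInv q B *
      qInv q C * qInv q (A + G) * qInv q (B + G) * qInv q (C + G) := by
  have h := saalschutz hq (-B) (-C) (G + 1) A
  rw [Nat.sum_antidiagonal_eq_sum_range_succ (fun i j => qInv q i * qInv q j * qRise q (-B) i *
    qRise q (-C) i * qRise q (G + 1 + i) j * qRise q (G + 1 - -B - -C) j)] at h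
  have e : ∀ k ∈ range A.succ, qInv q k * qInv q ((A - k : ℕ) : ℤ) * qRise q (-B) k *
      qRise q (-C) k * qRise q (G + 1 + k) (A - k) * qRise q (G + 1 - -B - -C) (A - k) =
      (qFac q B * qFac q C * qFac q (A + G) * qInv q (B + C + G)) *
      (qFac q (A + B + C + G - k) * qInv q k * qInv q (A - k) *
      qInv q (B - k) * qInv q (C - k) * qInv q (G + k)) := by
    intro k hk
    rw [mem_range] at hk
    have hk' : ((A - k : ℕ) : ℤ) = A - k := by omega
    rw [qRise_neg_eq_fac hq _ _ hB, qRise_neg_eq_fac hq _ _ hC, qRise_eq_fac hq _ _ (by omega),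
      qRise_eq_fac hq _ _ (by omega), hk']
    rw [show G + 1 + (k : ℤ) + (A - k) - 1 = A +
        G by ring, show G + 1 + (k : ℤ) - 1 = G + k by ring,
      show G + 1 - -B - -C + ((A : ℤ) - k) - 1 = A + B + C + G - k by ring,
      show G + 1 - -B - -C - 1 = B + C + G by ring]
    have : ((-1 : ℝ) ^ k) * (-1) ^ k = 1 := by rw [← mul_pow]; simp
    linear_combination (qFac q B * qFac q C * qFac q (A + G) * qInv q (B + C + G) *
      (qFac q (A + B + C + G - k) * qInv q k * qInv q (A - k) *
      qInv q (B - k) * qInv q (C - k) * qInv q (G + k))) * this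
  rw [sum_congr rfl e, ← mul_sum, qRise_eq_fac hq _ _ (by omega), qRise_eq_fac hq _ _ (by omega),
    show G + 1 - -B + (A : ℤ) - 1 = A + B + G by ring, show G + 1 - -B - 1 = B + G by ring,
    show G + 1 - -C + (A : ℤ) - 1 = A + C + G by ring, show G + 1 - -C - 1 = C + G by ring] at h
  have f1 := qFac_mul_qInv hq hB
  have f2 := qFac_mul_qInv hq hC
  have f3 := qFac_mul_qInv hq hA
  have f4 := qFac_mul_qInv hq (n := B + C + G) (by omega)
  have hne : qFac q B * qFac q C * qFac q (A + G) * qInv q (B + C + G) ≠ 0 := by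
    have := qFac_ne_zero hq B
    have := qFac_ne_zero hq C
    have := qFac_ne_zero hq (A + G)
    have := qInv_ne_zero hq (n := B + C + G) (by omega)
    positivity
  apply mul_left_cancel₀ hne
  rw [Nat.succ_eq_add_one] at h
  rw [h]
  rw [show ∀ a b c d e f g h i j k l m : ℝ, a * b * c * d * (e * f * g * h * i * j * k * l * m) =
    (a * i) * (b * j) * (c * k) * (g * d) * (h * (e * l) * (f * m)) by intros; ring, f1, f2, f3, f4]
  ring

/-- Under `t = b₁ - z` this is `saalschutz_fac` with `A = b₁ - a₁`, `B = b₁ - a₂`, `C = b₁ - a₃`, `G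
= b₂ - b₁`. The form is adapted to Racah's sum: three lower and two upper limits for `t`, with the
balancing condition built into the numerator factorial. -/
lemma saalschutz_symm (hq : 0 < q) (a₁ a₂ a₃ b₁ b₂ : ℤ) (T : ℕ) (h0 : 0 ≤ a₁) (hT : b₁ < T)
    (h11 : a₁ ≤ b₁) (h12 : a₁ ≤ b₂) (h21 : a₂ ≤ b₁) (h22 : a₂ ≤ b₂) (h31 : a₃ ≤ b₁)
    (h32 : a₃ ≤ b₂) :
    ∑ t ∈ range T, qFac q (t - (a₁ + a₂ + a₃ - b₁ - b₂)) * qInv q (t - a₁) * qInv q (t - a₂) *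
      qInv q (t - a₃) * qInv q (b₁ - t) * qInv q (b₂ - t) =
    qFac q (b₁ + b₂ - a₁ - a₂) * qFac q (b₁ + b₂ - a₁ - a₃) * qFac q (b₁ + b₂ - a₂ - a₃) *
      (qInv q (b₁ - a₁) * qInv q (b₁ - a₂) * qInv q (b₁ - a₃) * qInv q (b₂ - a₁) *
      qInv q (b₂ - a₂) * qInv q (b₂ - a₃)) := by
  obtain ⟨A, hA⟩ := Int.eq_ofNat_of_zero_le (sub_nonneg.2 h11)
  have h := saalschutz_fac hq A (b₁ - a₂) (b₁ - a₃) (b₂ - b₁) (by omega) (by omega) (by omega)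
    (by omega) (by omega)
  have r := sum_range_reindex (fun t : ℤ => qFac q (t - (a₁ + a₂ + a₃ - b₁ - b₂)) *
    qInv q (t - a₁) * qInv q (t - a₂) * qInv q (t - a₃) * qInv q (b₁ - t) * qInv q (b₂ - t)) 0 b₁
    (A + 1) T (by
      intro w hw
      simp only [mul_ne_zero_iff] at hw
      have := nonneg_of_qInv_ne_zero hw.1.1.1.1.2
      have := nonneg_of_qInv_ne_zero hw.1.2
      omega)
  simp only [zero_add] at r
  rw [← r, ← hA] at *
  simp only [show ∀ z : ℤ, b₁ - (b₁ - z) = z by intro; ring,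
    show ∀ z : ℤ, b₂ - (b₁ - z) = b₂ - b₁ + z by intro; ring,
    show ∀ z : ℤ, b₁ - z - a₁ = b₁ - a₁ - z by intro; ring,
    show ∀ z : ℤ, b₁ - z - a₂ = b₁ - a₂ - z by intro; ring,
    show ∀ z : ℤ, b₁ - z - a₃ = b₁ - a₃ - z by intro; ring]
  rw [show b₁ - a₁ + (b₁ - a₂) + (b₂ - b₁) = b₁ + b₂ - a₁ - a₂ by ring,
    show b₁ - a₁ + (b₁ - a₃) + (b₂ - b₁) = b₁ + b₂ - a₁ - a₃ by ring,
    show b₁ - a₂ + (b₁ - a₃) + (b₂ - b₁) = b₁ + b₂ - a₂ - a₃ by ring,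
    show b₁ - a₁ + (b₂ - b₁) = b₂ - a₁ by ring, show b₁ - a₂ + (b₂ - b₁) = b₂ - a₂ by ring,
    show b₁ - a₃ + (b₂ - b₁) = b₂ - a₃ by ring] at h
  rw [← mul_assoc, ← mul_assoc, ← mul_assoc, ← mul_assoc, ← mul_assoc, ← h]
  refine sum_congr rfl fun z _ => ?_
  rw [show b₁ - a₁ + (b₁ - a₂) + (b₁ - a₃) + (b₂ - b₁) - (z : ℤ) =
    b₁ - z - (a₁ + a₂ + a₃ - b₁ - b₂) by ring]
  ring

lemma neg_one_zpow_mul_self (n : ℤ) : ((-1 : ℝ) ^ n) * (-1) ^ n = 1 := by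
  rw [← mul_zpow]; simp

/-- Saalschütz with `n = t - b`, read from right to left. It trades the four factors
`1/([t-a]![t-b]![f-t]![g-t]!)` for sums in which `t` occurs in only two reciprocal factorials, so
that a subsequent sum over `t` becomes Saalschützian. Below `a` or `b` both sides vanish. -/
lemma inv_expand_alternating (hq : 0 < q) (a b f g t : ℤ) (N : ℕ) (haf : a ≤ f) (hag : a ≤ g)
    (hbf : b ≤ f) (hbg : b ≤ g) (hN : t - b < N) :
    ∑ k ∈ range N, (-1 : ℝ) ^ (b + k) * qFac q (k + f - a) * qFac q (k + g - a) *
      qInv q (b + k - a) * qInv q k * qInv q (t - b - k) * qInv q (f + g - a + 1 - t + k) =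
    (-1) ^ t * (qFac q (f - a) * qFac q (f - b) * qFac q (g - a) * qFac q (g - b) *
      qInv q (f + g - a - b + 1)) *
      (qInv q (t - a) * qInv q (t - b) * qInv q (f - t) * qInv q (g - t)) := by
  rcases lt_or_ge t b with htb | htb
  · rw [qInv_of_neg (n := t - b) (by omega), sum_eq_zero]
    · ring
    · intro k _; rw [qInv_of_neg (n := t - b - k) (by omega)]; ring
  rcases lt_or_ge t a with hta | hta
  · rw [qInv_of_neg (n := t - a) (by omega), sum_eq_zero]
    · ring
    · intro k _
      rcases lt_or_ge (t - b - k) 0 with h | h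
      · rw [qInv_of_neg h]; ring
      · rw [qInv_of_neg (n := b + k - a) (by omega)]; ring
  obtain ⟨n, hn⟩ := Int.eq_ofNat_of_zero_le (sub_nonneg.2 htb)
  rw [sum_range_eq_of_support _ N (n + 1) (by
    intro z hz
    simp only [mul_ne_zero_iff] at hz
    have := nonneg_of_qInv_ne_zero hz.1.2
    omega)]
  have h := saalschutz hq (f - a + 1) (g - a + 1) (b - a + 1) n
  rw [Nat.sum_antidiagonal_eq_sum_range_succ (fun i j => qInv q i * qInv q j *
    qRise q (f - a + 1) i * qRise q (g - a + 1) i * qRise q (b - a + 1 + i) j *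
    qRise q (b - a + 1 - (f - a + 1) - (g - a + 1)) j)] at h
  have e : ∀ k ∈ range n.succ, qInv q k * qInv q ((n - k : ℕ) : ℤ) * qRise q (f - a + 1) k *
      qRise q (g - a + 1) k * qRise q (b - a + 1 + k) (n - k) *
      qRise q (b - a + 1 - (f - a + 1) - (g - a + 1)) (n - k) =
      (qInv q (f - a) * qInv q (g - a) * qFac q (t - a) * qFac q (f + g - a - b + 1)) * (-1) ^ t *
      ((-1 : ℝ) ^ (b + k) * qFac q (k + f - a) * qFac q (k + g - a) *
      qInv q (b + k - a) * qInv q k * qInv q (t - b - k) * qInv q (f + g - a + 1 - t + k)) := by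
    intro k hk
    rw [mem_range] at hk
    have hk' : ((n - k : ℕ) : ℤ) = t - b - k := by omega
    rw [show b - a + 1 - (f - a + 1) - (g - a + 1) = -(f + g - a - b + 1) by ring,
      qRise_neg_eq_fac hq _ _ (by omega), qRise_eq_fac hq _ _ (by omega),
      qRise_eq_fac hq _ _ (by omega), qRise_eq_fac hq _ _ (by omega), hk',
      show f - a + 1 + (k : ℤ) - 1 = k + f - a by ring, show f - a + 1 - 1 = f - a by ring,
      show g - a + 1 + (k : ℤ) - 1 = k + g - a by ring, show g - a + 1 - 1 = g - a by ring,
      show b - a + 1 + (k : ℤ) + (t - b - k) - 1 = t - a by ring,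
      show b - a + 1 + (k : ℤ) - 1 = b + k - a by ring,
      show f + g - a - b + 1 - (t - b - (k : ℤ)) = f + g - a + 1 - t + k by ring,
      ← zpow_natCast, hk', show t - b - (k : ℤ) = t - (b + k) by ring,
      zpow_sub₀ (by norm_num : (-1 : ℝ) ≠ 0), div_eq_mul_inv, ← inv_zpow, inv_neg_one]
    ring
  have hn' : t - b = n := by simpa using hn
  rw [sum_congr rfl e, ← mul_sum, Nat.succ_eq_add_one,
    show b - a + 1 -
        (f - a + 1) = -(f - b) by ring, show b - a + 1 - (g - a + 1) = -(g - b) by ring,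
    qRise_neg_eq_fac hq _ _ (by omega), qRise_neg_eq_fac hq _ _ (by omega), ← hn',
    show f - b - (t - b) = f - t by ring, show g - b - (t - b) = g - t by ring] at h
  have s1 : ((-1 : ℝ) ^ n) * (-1) ^ n = 1 := by rw [← mul_pow]; simp
  have s2 := neg_one_zpow_mul_self t
  have f1 := qFac_mul_qInv hq (n := f - a) (by omega)
  have f2 := qFac_mul_qInv hq (n := g - a) (by omega)
  have f3 := qFac_mul_qInv hq (n := t - a) (by omega)
  have f4 := qFac_mul_qInv hq (n := f + g - a - b + 1) (by omega)
  generalize ∑ k ∈ range (n + 1), (-1 : ℝ) ^ (b + (k : ℤ)) * qFac q (k + f - a) *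
    qFac q (k + g - a) * qInv q (b + k - a) * qInv q k * qInv q (t - b - k) *
    qInv q (f + g - a + 1 - t + k) = S at h ⊢
  calc S = (qFac q (f - a) * qInv q (f - a)) * (qFac q (g - a) * qInv q (g - a)) *
        (qFac q (t - a) * qInv q (t - a)) * (qFac q (f + g - a - b + 1) *
        qInv q (f + g - a - b + 1)) * ((-1 : ℝ) ^ t * (-1) ^ t) * S := by
        rw [f1, f2, f3, f4, s2]; ring
    _ = (-1) ^ t * qFac q (f - a) * qFac q (g - a) * qInv q (t - a) *
        qInv q (f + g - a - b + 1) * (qInv q (f - a) * qInv q (g - a) * qFac q (t - a) *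
        qFac q (f + g - a - b + 1) * (-1) ^ t * S) := by ring
    _ = _ := by
        rw [h]
        linear_combination ((-1) ^ t * (qFac q (f - a) * qFac q (f - b) * qFac q (g - a) *
          qFac q (g - b) * qInv q (f + g - a - b + 1)) *
          (qInv q (t - a) * qInv q (t - b) * qInv q (f - t) * qInv q (g - t))) * s1

/-- Saalschütz with `n = t - a`, read from right to left. It trades `[t+1]!/([t-a]![t-b]![f-t]!)`
for terms in which `t` occurs only in `[t+b-f-z]!/[t-a-z]!`. -/
lemma fac_expand_alternating (hq : 0 < q) (a b f t : ℤ) (N : ℕ) (hb : 0 ≤ b) (haf : a ≤ f)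
    (hbf : b ≤ f) (hf : f ≤ a + b) (ha : 0 ≤ a) (hN : t - a < N) :
    ∑ z ∈ range N, (-1 : ℝ) ^ z * qFac q (f - b + z) * qFac q (t + b - f - z) * qInv q z *
      qInv q (t - a - z) * qInv q (b + 1 - z) * qInv q (a - b + z) =
    (-1) ^ (t - a) * (qFac q (f - a) * qFac q (f - b) * qFac q (a + b - f) * qInv q (a + 1) *
      qInv q (b + 1)) * (qFac q (t + 1) * qInv q (t - a) * qInv q (t - b) * qInv q (f - t)) := by
  rcases lt_or_ge t a with hta | hta
  · rw [qInv_of_neg (n := t - a) (by omega), sum_eq_zero]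
    · ring
    · intro k _; rw [qInv_of_neg (n := t - a - k) (by omega)]; ring
  rcases lt_or_ge t b with htb | htb
  · rw [qInv_of_neg (n := t - b) (by omega), sum_eq_zero]
    · ring
    · intro k _
      rcases lt_or_ge (t - a - k) 0 with h | h
      · rw [qInv_of_neg h]; ring
      · rw [qInv_of_neg (n := a - b + k) (by omega)]; ring
  obtain ⟨n, hn⟩ := Int.eq_ofNat_of_zero_le (sub_nonneg.2 hta)
  have hn' : t - a = n := by simpa using hn
  rw [sum_range_eq_of_support _ N (n + 1) (by
    intro z hz
    simp only [mul_ne_zero_iff] at hz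
    have := nonneg_of_qInv_ne_zero hz.1.1.2
    omega)]
  have h := saalschutz hq (-(b + 1)) (f - b + 1) (a - b + 1) n
  rw [Nat.sum_antidiagonal_eq_sum_range_succ (fun i j => qInv q i * qInv q j *
    qRise q (-(b + 1)) i * qRise q (f - b + 1) i * qRise q (a - b + 1 + i) j *
    qRise q (a - b + 1 - -(b + 1) - (f - b + 1)) j)] at h
  have e : ∀ k ∈ range n.succ, qInv q k * qInv q ((n - k : ℕ) : ℤ) * qRise q (-(b + 1)) k *
      qRise q (f - b + 1) k * qRise q (a - b + 1 + k) (n - k) *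
      qRise q (a - b + 1 - -(b + 1) - (f - b + 1)) (n - k) =
      (qInv q (f - b) * qInv q (a + b - f) * qFac q (t - b) * qFac q (b + 1)) *
      ((-1 : ℝ) ^ k * qFac q (f - b + k) * qFac q (t + b - f - k) * qInv q k *
      qInv q (t - a - k) * qInv q (b + 1 - k) * qInv q (a - b + k)) := by
    intro k hk
    rw [mem_range] at hk
    have hk' : ((n - k : ℕ) : ℤ) = t - a - k := by omega
    rw [qRise_neg_eq_fac hq _ _ (by omega), qRise_eq_fac hq _ _ (by omega),
      qRise_eq_fac hq _ _ (by omega), qRise_eq_fac hq _ _ (by omega), hk',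
      show f - b + 1 + (k : ℤ) - 1 = f - b + k by ring, show f - b + 1 - 1 = f - b by ring,
      show a - b + 1 + (k : ℤ) + (t - a - k) - 1 = t - b by ring,
      show a - b + 1 + (k : ℤ) - 1 = a - b + k by ring,
      show a - b + 1 - -(b + 1) - (f - b + 1) + (t - a - (k : ℤ)) - 1 = t + b - f - k by ring,
      show a - b + 1 - -(b + 1) - (f - b + 1) - 1 = a + b - f by ring]
    ring
  rw [sum_congr rfl e, ← mul_sum, Nat.succ_eq_add_one,
    show a - b + 1 - -(b + 1) = a + 2 by ring, show a - b + 1 - (f - b + 1) = -(f - a) by ring,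
    qRise_neg_eq_fac hq _ _ (by omega), qRise_eq_fac hq _ _ (by omega), ← hn',
    show a + 2 + (t - a) - 1 = t + 1 by ring, show a + 2 - 1 = a + 1 by ring,
    show f - a - (t - a) = f - t by ring, ← zpow_natCast, ← hn'] at h
  have f1 := qFac_mul_qInv hq (n := f - b) (by omega)
  have f2 := qFac_mul_qInv hq (n := a + b - f) (by omega)
  have f3 := qFac_mul_qInv hq (n := t - b) (by omega)
  have f4 := qFac_mul_qInv hq (n := b + 1) (by omega)
  generalize ∑ z ∈ range (n + 1), (-1 : ℝ) ^ z * qFac q (f - b + z) * qFac q (t + b - f - z) *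
    qInv q z * qInv q (t - a - z) * qInv q (b + 1 - z) * qInv q (a - b + z) = S at h ⊢
  calc S = (qFac q (f - b) * qInv q (f - b)) * (qFac q (a + b - f) * qInv q (a + b - f)) *
        (qFac q (t - b) * qInv q (t - b)) * (qFac q (b + 1) * qInv q (b + 1)) * S := by
        rw [f1, f2, f3, f4]; ring
    _ = qFac q (f - b) * qFac q (a + b - f) * qInv q (t - b) *
        qInv q (b + 1) * (qInv q (f - b) * qInv q (a + b - f) * qFac q (t - b) *
        qFac q (b + 1) * S) := by ring
    _ = _ := by rw [h]; ring

/-! ### Transformations of Racah's sum. -/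

/-- Racah's sum, as a function of the four triad sums `a, b, c, d` and the three sums
`e, f, g` over four spins. -/
noncomputable def racahSum (q : ℝ) (a b c d e f g : ℤ) (T : ℕ) : ℝ :=
  ∑ t ∈ range T, (-1 : ℝ) ^ (t : ℤ) * qFac q (t + 1) * qInv q (t - a) * qInv q (t - b) *
    qInv q (t - c) * qInv q (t - d) * qInv q (e - t) * qInv q (f - t) * qInv q (g - t)

/-- The inequalities between the triad sums and the sums over four spins of a `6j` coefficient. -/
structure RacahData (a b c d e f g : ℤ) : Prop where
  sum_eq : a + b + c + d = e + f + g
  a_nonneg : 0 ≤ a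
  b_nonneg : 0 ≤ b
  c_nonneg : 0 ≤ c
  d_nonneg : 0 ≤ d
  ae : a ≤ e
  af : a ≤ f
  ag : a ≤ g
  be : b ≤ e
  bf : b ≤ f
  bg : b ≤ g
  ce : c ≤ e
  cf : c ≤ f
  cg : c ≤ g
  de : d ≤ e
  df : d ≤ f
  dg : d ≤ g

/-- The factors `1/([t-a]![t-b]![e-t]![f-t]!)` are expanded by `inv_expand_alternating`. After the
sums are exchanged, the sum over `t` has lower limits `c`, `d`, `a+b-e-1-z` and upper limits `g`,
`f-z`, and is done by `saalschutz_symm`. -/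
theorem racahSum_eq_two (hq : 0 < q) {a b c d e f g : ℤ} (h : RacahData a b c d e f g) (T N : ℕ)
    (hT : g < T) (hN : min (f - c) (f - d) < N) :
    racahSum q a b c d e f g T = (-1) ^ f * (qFac q (c + 1) * qFac q (d + 1) *
      (qInv q (e - a) * qInv q (e - b) * qInv q (f - a) * qInv q (f - b) * qInv q (g - c) *
      qInv q (g - d))) *
    ∑ z ∈ range N, (-1 : ℝ) ^ (z : ℤ) * qFac q (e - a + z) * qFac q (e - b + z) *
      qFac q (a + b - e - z) * qInv q z * qInv q (f - c - z) * qInv q (f - d - z) *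
      qInv q (e - f + z) * qInv q (e + g - a - b + 1 + z) := by
  obtain ⟨hs, ha, hb, hc, hd, ae, af, ag, be, bf, bg, ce, cf, cg, de, df, dg⟩ := h
  have hfn : f < (f.toNat + 1 : ℕ) := by omega
  rw [sum_range_eq_of_support _ N (f.toNat + 1) (by
    intro z hz
    simp only [mul_ne_zero_iff] at hz
    have := nonneg_of_qInv_ne_zero hz.1.1.2
    have := nonneg_of_qInv_ne_zero hz.1.1.1.2
    omega)]
  set X := qInv q (e - a) * qInv q (e - b) * qInv q (f - a) * qInv q (f - b) *
    qFac q (e + f - a - b + 1) with hX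
  have fM := qFac_mul_qInv hq (n := e + f - a - b + 1) (by omega)
  have f1 := qFac_mul_qInv hq (n := e - a) (by omega)
  have f2 := qFac_mul_qInv hq (n := e - b) (by omega)
  have f3 := qFac_mul_qInv hq (n := f - a) (by omega)
  have f4 := qFac_mul_qInv hq (n := f - b) (by omega)
  have key : ∀ t ∈ range T, (-1 : ℝ) ^ (t : ℤ) * qFac q (t + 1) * qInv q (t - a) * qInv q (t - b) *
      qInv q (t - c) * qInv q (t - d) * qInv q (e - t) * qInv q (f - t) * qInv q (g - t) =
      ∑ z ∈ range (f.toNat + 1), X * ((-1 : ℝ) ^ (-f + z) * qFac q (e - a + z) *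
        qFac q (e - b + z) * qInv q (e - f + z) * qInv q z) *
        (qFac q (t - (c + d + (a + b - e - 1 - z) - g - (f - z))) * qInv q (t - c) * qInv q
            (t - d) *
        qInv q (t - (a + b - e - 1 - z)) * qInv q (g - t) * qInv q (f - z - t)) := by
    intro t _
    -- The reflection `t ↦ -t` turns upper limits into lower ones, so the expansion index is
    -- subtracted from the upper limit `f`.
    have h := inv_expand_alternating hq (-e) (-f) (-a) (-b) (-t) (f.toNat + 1) (by omega) (by omega)
      (by omega) (by omega) (by omega)
    have h' : ∑ z ∈ range (f.toNat + 1), (-1 : ℝ) ^ (-f + z) * qFac q (e - a + z) *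
        qFac q (e - b + z) * qInv q (e - f + z) * qInv q z * qInv q (f - z - t) *
        qInv q (t - (a + b - e - 1 - z)) = (-1) ^ (-t : ℤ) * (qFac q (e - a) * qFac q (f - a) *
        qFac q (e - b) * qFac q (f - b) * qInv q (e + f - a - b + 1)) *
        (qInv q (e - t) * qInv q (f - t) * qInv q (t - a) * qInv q (t - b)) := by
      convert h using 1
      · exact sum_congr rfl fun z _ => by ring_nf
      · ring_nf
    -- The relation `a + b + c + d = e + f + g` is exactly the balancing condition: the numerator
    -- factorial required by `saalschutz_symm` is Racah's `[t+1]!`, for every `z`.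
    have hz : ∀ z : ℤ, t - (c + d + (a + b - e - 1 - z) - g - (f - z)) = t + 1 := by
      intro z; omega
    simp only [hz]
    rw [zpow_neg, ← inv_zpow, inv_neg_one] at h'
    calc _ = X * (qFac q (e - a) * qFac q (f - a) * qFac q (e - b) * qFac q (f - b) *
        qInv q (e + f - a - b + 1)) * ((-1 : ℝ) ^ (t : ℤ) * qFac q (t + 1) * qInv q (t - a) *
        qInv q (t - b) * qInv q (t - c) * qInv q (t - d) * qInv q (e - t) * qInv q (f - t) *
        qInv q (g - t)) := by
          have : X * (qFac q (e - a) * qFac q (f - a) * qFac q (e - b) * qFac q (f - b) *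
              qInv q (e + f - a - b + 1)) = 1 := by
            calc _ = (qFac q (e - a) * qInv q (e - a)) * (qFac q (e - b) * qInv q (e - b)) *
                (qFac q (f - a) * qInv q (f - a)) * (qFac q (f - b) * qInv q (f - b)) *
                (qFac q (e + f - a - b + 1) * qInv q (e + f - a - b + 1)) := by rw [hX]; ring
              _ = 1 := by rw [fM, f1, f2, f3, f4]; ring
          rw [this, one_mul]
      _ = X * (qFac q (t + 1) * qInv q (t - c) * qInv q (t - d) * qInv q (g - t)) *
        ((-1) ^ (t : ℤ) * (qFac q (e - a) * qFac q (f - a) *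
        qFac q (e - b) * qFac q (f - b) * qInv q (e + f - a - b + 1)) *
        (qInv q (e - t) * qInv q (f - t) * qInv q (t - a) * qInv q (t - b))) := by ring
      _ = _ := by
        rw [← h', mul_sum]
        exact sum_congr rfl fun z _ => by ring
  rw [racahSum, sum_congr rfl key, sum_comm, mul_sum]
  refine sum_congr rfl fun z hz => ?_
  rw [← mul_sum]
  -- For larger `z` the summation interval for `t` is empty, and the corresponding term on the right
  -- contains the reciprocal factorial of a negative integer.
  by_cases hzc : z ≤ f - c ∧ z ≤ f - d
  · rw [saalschutz_symm hq c d (a + b - e - 1 - z) g (f - z) T hc hT cg (by omega) dg (by omega)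
      (by omega) (by omega), show g + (f - z) - c - d = a + b - e - z by omega,
      show g + (f - z) - c - (a + b - e - 1 - z) = d + 1 by omega,
      show g + (f - z) - d - (a + b - e - 1 - z) = c + 1 by omega,
      show g - (a + b - e - 1 - z) = e + g - a - b + 1 + z by ring,
      show f - z - (a + b - e - 1 - z) = e + f - a - b + 1 by ring,
      show f - z - c = f - c - z by ring, show f - z - d = f - d - z by ring,
      zpow_add₀ (by norm_num), zpow_neg, ← inv_zpow, inv_neg_one, hX]
    linear_combination ((-1) ^ f * (-1) ^ (z : ℤ) * qInv q (e - a) * qInv q (e - b) *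
      qInv q (f - a) * qInv q (f - b) * qInv q (g - c) * qInv q (g - d) * qFac q (c + 1) *
      qFac q (d + 1) * qFac q (e - a + z) * qFac q (e - b + z) *
      qFac q (a + b - e - z) * qInv q z * qInv q (f - c - z) * qInv q (f - d - z) *
      qInv q (e - f + z) * qInv q (e + g - a - b + 1 + z)) * fM
  · have h0 : qInv q (f - c - z) * qInv q (f - d - z) = 0 := by
      rcases not_and_or.1 hzc with h | h
      · rw [qInv_of_neg (n := f - c - z) (by omega), zero_mul]
      · rw [qInv_of_neg (n := f - d - z) (by omega), mul_zero]
    rw [sum_eq_zero, mul_zero]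
    · linear_combination (-((-1) ^ f * (qFac q (c + 1) * qFac q (d + 1) *
        (qInv q (e - a) * qInv q (e - b) * qInv q (f - a) * qInv q (f - b) * qInv q (g - c) *
        qInv q (g - d))) * ((-1 : ℝ) ^ (z : ℤ) * qFac q (e - a + z) * qFac q (e - b + z) *
        qFac q (a + b - e - z) * qInv q z * qInv q (e - f + z) *
        qInv q (e + g - a - b + 1 + z)))) * h0
    · intro t _
      have : qInv q (t - c) * qInv q (t - d) * qInv q (f - z - t) = 0 := by
        rcases lt_or_ge (f - z - t) 0 with h1 | h1
        · rw [qInv_of_neg h1, mul_zero]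
        rcases not_and_or.1 hzc with h | h
        · rw [qInv_of_neg (n := t - c) (by omega)]; ring
        · rw [qInv_of_neg (n := t - d) (by omega)]; ring
      linear_combination (qFac q (t - (c + d + (a + b - e - 1 - z) - g - (f - z))) *
        qInv q (t - (a + b - e - 1 - z)) * qInv q (g - t)) * this

/-- The factors `[t+1]!/([t-a]![t-b]![f-t]!)` are expanded by `fac_expand_alternating`; the sum over
`t` with lower limits `c`, `d`, `a+z` and upper limits `e`, `g` is then balanced. -/
theorem racahSum_eq_three (hq : 0 < q) {a b c d e f g : ℤ} (h : RacahData a b c d e f g)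
    (T N : ℕ) (hT : e < T) (hN : min (e - a) (g - a) < N) :
    racahSum q a b c d e f g T = (-1) ^ a * (qFac q (a + 1) * qFac q (b + 1) *
      (qInv q (f - a) * qInv q (f - b) * qInv q (e - c) * qInv q (e - d) * qInv q (g - c) *
      qInv q (g - d))) *
    ∑ z ∈ range N, (-1 : ℝ) ^ (z : ℤ) * qFac q (f - b + z) * qFac q (e + g - a - c - z) *
      qFac q (e + g - a - d - z) * qInv q z * qInv q (e - a - z) * qInv q (g - a - z) *
      qInv q (b + 1 - z) * qInv q (a - b + z) := by
  obtain ⟨hs, ha, hb, hc, hd, ae, af, ag, be, bf, bg, ce, cf, cg, de, df, dg⟩ := h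
  rw [sum_range_eq_of_support _ N T (by
    intro z hz
    simp only [mul_ne_zero_iff] at hz
    have := nonneg_of_qInv_ne_zero hz.1.1.2
    have := nonneg_of_qInv_ne_zero hz.1.1.1.2
    omega)]
  set X := qInv q (f - a) * qInv q (f - b) * qInv q (a + b - f) * qFac q (a + 1) *
    qFac q (b + 1) with hX
  have fM := qFac_mul_qInv hq (n := a + b - f) (by omega)
  have f1 := qFac_mul_qInv hq (n := f - a) (by omega)
  have f2 := qFac_mul_qInv hq (n := f - b) (by omega)
  have f3 := qFac_mul_qInv hq (n := a + 1) (by omega)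
  have f4 := qFac_mul_qInv hq (n := b + 1) (by omega)
  have key : ∀ t ∈ range T, (-1 : ℝ) ^ (t : ℤ) * qFac q (t + 1) * qInv q (t - a) * qInv q (t - b) *
      qInv q (t - c) * qInv q (t - d) * qInv q (e - t) * qInv q (f - t) * qInv q (g - t) =
      ∑ z ∈ range T, (-1) ^ a * X * ((-1 : ℝ) ^ (z : ℤ) * qFac q (f - b + z) * qInv q z *
        qInv q (b + 1 - z) * qInv q (a - b + z)) *
        (qFac q (t - (c + d + (a + z) - e - g)) * qInv q (t - c) * qInv q (t - d) *
        qInv q (t - (a + z)) * qInv q (e - t) * qInv q (g - t)) := by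
    intro t ht
    rw [mem_range] at ht
    have h' := fac_expand_alternating hq a b f t T hb af bf (by omega) ha (by omega)
    have hz : ∀ z : ℤ, t - (c + d + (a + z) - e - g) = t + b - f - z := by
      intro z; omega
    have hz' : ∀ z : ℤ, t - (a + z) = t - a - z := by intro z; omega
    simp only [hz, hz']
    rw [zpow_sub₀ (by norm_num), div_eq_mul_inv, ← inv_zpow, inv_neg_one] at h'
    calc _ = X * (qFac q (f - a) * qFac q (f - b) * qFac q (a + b - f) * qInv q (a + 1) *
        qInv q (b + 1)) * ((-1 : ℝ) ^ a * (-1) ^ a) * ((-1 : ℝ) ^ (t : ℤ) * qFac q (t + 1) *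
        qInv q (t - a) *
        qInv q (t - b) * qInv q (t - c) * qInv q (t - d) * qInv q (e - t) * qInv q (f - t) *
        qInv q (g - t)) := by
          have : X * (qFac q (f - a) * qFac q (f - b) * qFac q (a + b - f) * qInv q (a + 1) *
              qInv q (b + 1)) = 1 := by
            calc _ = (qFac q (f - a) * qInv q (f - a)) * (qFac q (f - b) * qInv q (f - b)) *
                (qFac q (a + b - f) * qInv q (a + b - f)) * (qFac q (a + 1) * qInv q (a + 1)) *
                (qFac q (b + 1) * qInv q (b + 1)) := by rw [hX]; ring
              _ = 1 := by rw [fM, f1, f2, f3, f4]; ring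
          rw [this, neg_one_zpow_mul_self, one_mul, one_mul]
      _ = (-1) ^ a * X * (qInv q (t - c) * qInv q (t - d) * qInv q (e - t) * qInv q (g - t)) *
        ((-1 : ℝ) ^ (t : ℤ) * (-1) ^ a * (qFac q (f - a) * qFac q (f - b) * qFac q (a + b - f) *
        qInv q (a + 1) * qInv q (b + 1)) * (qFac q (t + 1) * qInv q (t - a) * qInv q (t - b) *
        qInv q (f - t))) := by ring
      _ = _ := by
        rw [← h', mul_sum]
        exact sum_congr rfl fun z _ => by simp only [zpow_natCast]; ring
  rw [racahSum, sum_congr rfl key, sum_comm, mul_sum]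
  refine sum_congr rfl fun z hz => ?_
  rw [← mul_sum]
  by_cases hzc : z ≤ e - a ∧ z ≤ g - a
  · rw [saalschutz_symm hq c d (a + z) e g T hc hT ce cg de dg (by omega) (by omega),
      show e + g - c - d = a + b - f by omega,
      show e + g - c - (a + z) = e + g - a - c - z by omega,
      show e + g - d - (a + z) = e + g - a - d - z by omega,
      show e - (a + z) = e - a - z by ring,
      show g - (a + z) = g - a - z by ring, hX]
    linear_combination ((-1) ^ a * (-1) ^ (z : ℤ) * qInv q (f - a) * qInv q (f - b) *
      qInv q (e - c) * qInv q (e - d) * qInv q (g - c) * qInv q (g - d) * qFac q (a + 1) *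
      qFac q (b + 1) * qFac q (f - b + z) * qFac q (e + g - a - c - z) *
      qFac q (e + g - a - d - z) * qInv q z * qInv q (e - a - z) * qInv q (g - a - z) *
      qInv q (b + 1 - z) * qInv q (a - b + z)) * fM
  · have h0 : qInv q (e - a - z) * qInv q (g - a - z) = 0 := by
      rcases not_and_or.1 hzc with h | h
      · rw [qInv_of_neg (n := e - a - z) (by omega), zero_mul]
      · rw [qInv_of_neg (n := g - a - z) (by omega), mul_zero]
    rw [sum_eq_zero, mul_zero]
    · linear_combination (-((-1) ^ a * (qFac q (a + 1) * qFac q (b + 1) *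
        (qInv q (f - a) * qInv q (f - b) * qInv q (e - c) * qInv q (e - d) * qInv q (g - c) *
        qInv q (g - d))) * ((-1 : ℝ) ^ (z : ℤ) * qFac q (f - b + z) * qFac q (e + g - a - c - z) *
        qFac q (e + g - a - d - z) * qInv q z *
        qInv q (b + 1 - z) * qInv q (a - b + z)))) * h0
    · intro t _
      have : qInv q (t - (a + z)) * qInv q (e - t) * qInv q (g - t) = 0 := by
        rcases lt_or_ge (t - (a + z)) 0 with h1 | h1
        · rw [qInv_of_neg h1]; ring
        rcases not_and_or.1 hzc with h | h
        · rw [qInv_of_neg (n := e - t) (by omega)]; ring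
        · rw [qInv_of_neg (n := g - t) (by omega)]; ring
      linear_combination (qFac q (t - (c + d + (a + z) - e - g)) *
        qInv q (t - c) * qInv q (t - d)) * this

/-- Here `1/([t-a]![t-b]![f-t]![g-t]!)` is expanded, with the expansion index counted downwards from
`e`. The sum over `t` has lower limits `c`, `d`, `e-z` and upper limits `e` and `f+g-a-b+1+e-z`. -/
theorem racahSum_eq_four (hq : 0 < q) {a b c d e f g : ℤ} (h : RacahData a b c d e f g)
    (T N : ℕ) (hT : e < T) (hN : min (e - a) (e - b) < N) :
    racahSum q a b c d e f g T = (-1) ^ e * (qFac q (c + 1) * qFac q (d + 1) *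
      (qInv q (f - a) * qInv q (f - b) * qInv q (g - a) * qInv q (g - b) * qInv q (e - c) *
      qInv q (e - d))) *
    ∑ z ∈ range N, (-1 : ℝ) ^ (z : ℤ) * qFac q (e + 1 - z) * qFac q (e + f - a - b - z) *
      qFac q (e + g - a - b - z) * qInv q z * qInv q (e - a - z) * qInv q (e - b - z) *
      qInv q (d + 1 - z) * qInv q (c + 1 - z) := by
  obtain ⟨hs, ha, hb, hc, hd, ae, af, ag, be, bf, bg, ce, cf, cg, de, df, dg⟩ := h
  have hen : e < (e.toNat + 1 : ℕ) := by omega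
  rw [sum_range_eq_of_support _ N (e.toNat + 1) (by
    intro z hz
    simp only [mul_ne_zero_iff] at hz
    have := nonneg_of_qInv_ne_zero hz.1.1.2
    have := nonneg_of_qInv_ne_zero hz.1.1.1.2
    omega)]
  set X := qInv q (f - a) * qInv q (f - b) * qInv q (g - a) * qInv q (g - b) *
    qFac q (f + g - a - b + 1) with hX
  have fM := qFac_mul_qInv hq (n := f + g - a - b + 1) (by omega)
  have f1 := qFac_mul_qInv hq (n := f - a) (by omega)
  have f2 := qFac_mul_qInv hq (n := f - b) (by omega)
  have f3 := qFac_mul_qInv hq (n := g - a) (by omega)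
  have f4 := qFac_mul_qInv hq (n := g - b) (by omega)
  have key : ∀ t ∈ range T, (-1 : ℝ) ^ (t : ℤ) * qFac q (t + 1) * qInv q (t - a) * qInv q (t - b) *
      qInv q (t - c) * qInv q (t - d) * qInv q (e - t) * qInv q (f - t) * qInv q (g - t) =
      ∑ z ∈ range (e.toNat + 1), X * ((-1 : ℝ) ^ (e - z) * qFac q (e + f - a - b - z) *
        qFac q (e + g - a - b - z) * qInv q (e - a - z) * qInv q (e - b - z)) *
        (qFac q (t - (c + d + (e - z) - e - (f + g - a - b + 1 + (e - z)))) * qInv q (t - c) *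
        qInv q (t - d) *
        qInv q (t - (e - z)) * qInv q (e - t) * qInv q (f + g - a - b + 1 + (e - z) - t)) := by
    intro t _
    rcases lt_or_ge (e - t) 0 with het | het
    · rw [qInv_of_neg het]; simp
    have h := inv_expand_alternating hq a b f g t (t + 1) (by omega) (by omega)
      (by omega) (by omega) (by omega)
    -- The index `b + k` of the expansion becomes `w = e - z`. The terms with `b ≤ w ≤ t` lie in
    -- `[0, e]` because `t ≤ e` here.
    have r := sum_range_reindex (fun w : ℤ => (-1 : ℝ) ^ w *
        qFac q (w + f - a - b) * qFac q (w + g - a - b) * qInv q (w - a) * qInv q (w - b) *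
        qInv q (t - w) * qInv q (f + g - a - b + 1 + w - t)) b e (e.toNat + 1) (t + 1) (by
        intro w hw
        simp only [mul_ne_zero_iff] at hw
        have := nonneg_of_qInv_ne_zero hw.1.2
        have := nonneg_of_qInv_ne_zero hw.1.1.2
        omega)
    rw [← (r.trans (sum_congr rfl fun k _ => by ring_nf) : _ = ∑ k ∈ range (t + 1),
      (-1 : ℝ) ^ (b + (k : ℤ)) * qFac q (k + f - a) *
      qFac q (k + g - a) * qInv q (b + k - a) * qInv q k * qInv q (t - b - k) *
      qInv q (f + g - a + 1 - t + k))] at h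
    have hz : ∀ z : ℤ, t - (c + d + (e - z) - e - (f + g - a - b + 1 + (e - z))) = t + 1 := by
      intro z; omega
    simp only [hz]
    calc _ = X * (qFac q (f - a) * qFac q (f - b) * qFac q (g - a) * qFac q (g - b) *
        qInv q (f + g - a - b + 1)) * ((-1 : ℝ) ^ (t : ℤ) * qFac q (t + 1) * qInv q (t - a) *
        qInv q (t - b) * qInv q (t - c) * qInv q (t - d) * qInv q (e - t) * qInv q (f - t) *
        qInv q (g - t)) := by
          have : X * (qFac q (f - a) * qFac q (f - b) * qFac q (g - a) * qFac q (g - b) *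
              qInv q (f + g - a - b + 1)) = 1 := by
            calc _ = (qFac q (f - a) * qInv q (f - a)) * (qFac q (f - b) * qInv q (f - b)) *
                (qFac q (g - a) * qInv q (g - a)) * (qFac q (g - b) * qInv q (g - b)) *
                (qFac q (f + g - a - b + 1) * qInv q (f + g - a - b + 1)) := by rw [hX]; ring
              _ = 1 := by rw [fM, f1, f2, f3, f4]; ring
          rw [this, one_mul]
      _ = X * (qFac q (t + 1) * qInv q (t - c) * qInv q (t - d) * qInv q (e - t)) *
        ((-1) ^ (t : ℤ) * (qFac q (f - a) * qFac q (f - b) *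
        qFac q (g - a) * qFac q (g - b) * qInv q (f + g - a - b + 1)) *
        (qInv q (t - a) * qInv q (t - b) * qInv q (f - t) * qInv q (g - t))) := by ring
      _ = _ := by
        rw [← h, mul_sum]
        refine sum_congr rfl fun z _ => ?_
        simp only [show e - z + f - a - b = e + f - a - b - z by ring,
          show e - z + g - a - b = e + g - a - b - z by ring,
          show e - z - a = e - a - z by ring, show e - z - b = e - b - z by ring]
        ring
  rw [racahSum, sum_congr rfl key, sum_comm, mul_sum]
  refine sum_congr rfl fun z hz => ?_
  rw [← mul_sum]
  by_cases hzc : z ≤ e - a ∧ z ≤ e - b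
  · rw [saalschutz_symm hq c d (e - z) e (f + g - a - b + 1 + (e - z)) T hc hT ce (by omega) de
      (by omega) (by omega) (by omega),
      show e + (f + g - a - b + 1 + (e - z)) - c - d = e + 1 - z by omega,
      show e + (f + g - a - b + 1 + (e - z)) - c - (e - z) = d + 1 by omega,
      show e + (f + g - a - b + 1 + (e - z)) - d - (e - z) = c + 1 by omega,
      show f + g - a - b + 1 + (e - z) - (e - z) = f + g - a - b + 1 by ring,
      show e - (e - z) = (z : ℤ) by ring,
      show f + g - a - b + 1 + (e - z) - c = d + 1 - z by omega,
      show f + g - a - b + 1 + (e - z) - d = c + 1 - z by omega,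
      zpow_sub₀ (by norm_num), div_eq_mul_inv, ← inv_zpow, inv_neg_one, hX]
    linear_combination ((-1) ^ e * (-1) ^ (z : ℤ) * qInv q (f - a) * qInv q (f - b) *
      qInv q (g - a) * qInv q (g - b) * qInv q (e - c) * qInv q (e - d) * qFac q (c + 1) *
      qFac q (d + 1) * qFac q (e + 1 - z) * qFac q (e + f - a - b - z) *
      qFac q (e + g - a - b - z) * qInv q z * qInv q (e - a - z) * qInv q (e - b - z) *
      qInv q (d + 1 - z) * qInv q (c + 1 - z)) * fM
  · have h0 : qInv q (e - a - z) * qInv q (e - b - z) = 0 := by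
      rcases not_and_or.1 hzc with h | h
      · rw [qInv_of_neg (n := e - a - z) (by omega), zero_mul]
      · rw [qInv_of_neg (n := e - b - z) (by omega), mul_zero]
    generalize ∑ t ∈ range T, (_ : ℝ) = S
    linear_combination (X * ((-1 : ℝ) ^ (e - z) * qFac q (e + f - a - b - z) *
        qFac q (e + g - a - b - z)) * S - (-1) ^ e * (qFac q (c + 1) * qFac q (d + 1) *
        (qInv q (f - a) * qInv q (f - b) * qInv q (g - a) * qInv q (g - b) * qInv q (e - c) *
        qInv q (e - d))) * ((-1 : ℝ) ^ (z : ℤ) * qFac q (e + 1 - z) *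
        qFac q (e + f - a - b - z) * qFac q (e + g - a - b - z) * qInv q z *
        qInv q (d + 1 - z) * qInv q (c + 1 - z))) * h0

/-! ### Factorials of rationals, triangle coefficients and the symmetries of the `6j` coefficient.
-/

/-- Because of the natural floor this holds at every rational, so `∇` is positive without a triangle
condition. -/
lemma qF_pos (hq : 0 < q) (x : ℚ) : 0 < qF q x := by
  have h : qF q x = qFac q ⌊x⌋₊ := by
    rw [qFac_eq_prod, qF, Int.toNat_natCast]
    exact prod_congr rfl fun i _ => by rw [qInt]; push_cast; rfl
  rw [h]; exact qFac_pos hq _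

lemma qR_of_neg {x : ℚ} (h : x < 0) : qR q x = 0 := by rw [qR, if_neg (not_le.2 h)]

lemma nonneg_of_qR_ne_zero {x : ℚ} (h : qR q x ≠ 0) : 0 ≤ x := by
  by_contra hx; exact h (qR_of_neg (not_le.1 hx))

lemma qF_eq_qFac {x : ℚ} (n : ℤ) (h : x = n) : qF q x = qFac q n := by rw [h]; rfl

lemma qR_eq_qInv {x : ℚ} (n : ℤ) (h : x = n) : qR q x = qInv q n := by rw [h]; rfl

lemma nabla_pos (hq : 0 < q) (a b c : ℚ) : 0 < nabla q a b c := by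
  have := qF_pos hq
  exact Real.sqrt_pos.2 (div_pos (mul_pos (mul_pos (this _) (this _)) (this _)) (this _))

/-- Together with `delta_eq_div_nabla` this lets each `Δ` of a `6j` coefficient be written with `∇`
in the numerator or in the denominator, whichever makes the remaining factorials cancel those in
front of the transformed Racah sum. -/
lemma delta_eq_nabla_mul (hq : 0 < q) (a b c : ℚ) :
    delta q a b c = nabla q a b c * qF q (b + c - a) / qF q (a + b + c + 1) := by
  have h1 := qF_pos hq (a + b - c)
  have h2 := qF_pos hq (a - b + c)
  have h3 := qF_pos hq (b + c - a)
  have h4 := qF_pos hq (a + b + c + 1)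
  rw [delta, nabla, mul_div_assoc (Real.sqrt _), ← Real.sqrt_sq (by positivity :
    0 ≤ qF q (b + c - a) / qF q (a + b + c + 1)), ← Real.sqrt_mul (by positivity)]
  congr 1
  field_simp

lemma delta_eq_div_nabla (hq : 0 < q) (a b c : ℚ) :
    delta q a b c = qF q (a + b - c) * qF q (a - b + c) / nabla q a b c := by
  have h1 := qF_pos hq (a + b - c)
  have h2 := qF_pos hq (a - b + c)
  have h3 := qF_pos hq (b + c - a)
  have h4 := qF_pos hq (a + b + c + 1)
  rw [eq_div_iff (nabla_pos hq a b c).ne', delta, nabla, ← Real.sqrt_mul (by positivity),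
    Real.sqrt_eq_iff_mul_self_eq (by positivity) (by positivity)]
  field_simp

lemma delta_comm_left (a b c : ℚ) : delta q a b c = delta q b a c := by
  rw [delta, delta, show b - a + c = b + c - a by ring, show a + c - b = a - b + c by ring,
    show b + a - c = a + b - c by ring, show b + a + c + 1 = a + b + c + 1 by ring]
  ring_nf

lemma delta_comm_right (a b c : ℚ) : delta q a b c = delta q a c b := by
  rw [delta, delta, show a + c - b = a - b + c by ring, show a - c + b = a + b - c by ring,
    show c + b - a = b + c - a by ring, show a + c + b + 1 = a + b + c + 1 by ring]
  ring_nf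

lemma Triangle.comm_left {a b c : ℚ} (h : Triangle a b c) : Triangle b a c := by
  obtain ⟨⟨x, hx⟩, ⟨y, hy⟩, ⟨z, hz⟩⟩ := h
  exact ⟨⟨x, by linarith⟩, ⟨z, by linarith⟩, ⟨y, by linarith⟩⟩

lemma Triangle.comm_right {a b c : ℚ} (h : Triangle a b c) : Triangle a c b := by
  obtain ⟨⟨x, hx⟩, ⟨y, hy⟩, ⟨z, hz⟩⟩ := h
  exact ⟨⟨y, by linarith⟩, ⟨x, by linarith⟩, ⟨z, by linarith⟩⟩

lemma triangle_comm_left {a b c : ℚ} : Triangle a b c ↔ Triangle b a c :=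
  ⟨Triangle.comm_left, Triangle.comm_left⟩

lemma triangle_comm_right {a b c : ℚ} : Triangle a b c ↔ Triangle a c b :=
  ⟨Triangle.comm_right, Triangle.comm_right⟩

open Classical in
-- Each of the three upper limits of Racah's sum may serve as cut-off. This freedom is needed for
-- the symmetries, which permute the three limits.
lemma sixj_eq_sum (a b e d c f : ℚ) (T : ℕ)
    (hT : a + b + c + d < T ∨ a + d + e + f < T ∨ b + c + e + f < T) :
    sixj q a b e d c f =
    if Triangle a b e ∧ Triangle a c f ∧ Triangle d b f ∧ Triangle d c e then
      delta q a b e * delta q a c f * delta q d b f * delta q d c e *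
        ∑ t ∈ range T, (-1) ^ t * qF q ((t : ℚ) + 1) *
          (qR q (t - a - b - e) * qR q (t - a - c - f) * qR q (t - d - b - f) *
            qR q (t - d - c - e)) *
          (qR q (a + b + c + d - t) * qR q (a + d + e + f - t) * qR q (b + c + e + f - t))
    else 0 := by
  rw [sixj]
  congr 2
  refine sum_range_eq_of_support _ _ _ fun t ht => ?_
  simp only [mul_ne_zero_iff] at ht
  have h1 := nonneg_of_qR_ne_zero ht.2.1.1
  have h2 := nonneg_of_qR_ne_zero ht.2.1.2
  have h3 := nonneg_of_qR_ne_zero ht.2.2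
  refine ⟨Nat.lt_succ_of_le (Nat.le_floor (by linarith)), ?_⟩
  have : (t : ℚ) < T := by rcases hT with h | h | h <;> linarith
  exact_mod_cast this

lemma sixj_swap_columns_left (a b e d c f : ℚ) : sixj q a b e d c f = sixj q b a e c d f := by
  classical
  obtain ⟨T, hT⟩ := exists_nat_gt (a + b + c + d)
  rw [sixj_eq_sum a b e d c f T (Or.inl hT),
    sixj_eq_sum b a e c d f T (Or.inl (by linarith)), delta_comm_left b a e, delta_comm_left b d f,
    delta_comm_left c a f, delta_comm_left c d e]
  refine if_congr ?_ ?_ rfl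
  · rw [triangle_comm_left (a := b) (b := a), triangle_comm_left (a := b) (b := d),
      triangle_comm_left (a := c) (b := a), triangle_comm_left (a := c) (b := d)]
    tauto
  · rw [mul_right_comm (delta q a b e) (delta q a c f)]
    congr 1
    refine sum_congr rfl fun t _ => ?_
    rw [show (t : ℚ) - b - a - e = t - a - b - e by ring,
      show (t : ℚ) - c - d - e = t - d - c - e by ring,
      show (t : ℚ) - b - d - f = t - d - b - f by ring,
      show (t : ℚ) - c - a - f = t - a - c - f by ring,
      show b + a + d + c - (t : ℚ) = a + b + c + d - t by ring]
    ring

lemma sixj_swap_columns_right (a b e d c f : ℚ) : sixj q a b e d c f = sixj q a e b d f c := by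
  classical
  obtain ⟨T, hT⟩ := exists_nat_gt (a + b + c + d)
  rw [sixj_eq_sum a b e d c f T (Or.inl hT),
    sixj_eq_sum a e b d f c T (Or.inr (Or.inl (by linarith))), delta_comm_right a e b,
    delta_comm_right a f c, delta_comm_right d e c, delta_comm_right d f b]
  refine if_congr ?_ ?_ rfl
  · rw [triangle_comm_right (b := e) (c := b), triangle_comm_right (b := f) (c := c),
      triangle_comm_right (b := e) (c := c), triangle_comm_right (b := f) (c := b)]
    tauto
  · rw [mul_right_comm (delta q a b e * delta q a c f)]
    congr 1
    refine sum_congr rfl fun t _ => ?_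
    rw [show (t : ℚ) - a - e - b = t - a - b - e by ring,
      show (t : ℚ) - a - f - c = t - a - c - f by ring,
      show (t : ℚ) - d - e - c = t - d - c - e by ring,
      show (t : ℚ) - d - f - b = t - d - b - f by ring,
      show a + e + f + d - (t : ℚ) = a + d + e + f - t by ring,
      show a + d + b + c - (t : ℚ) = a + b + c + d - t by ring,
      show e + f + b + c - (t : ℚ) = b + c + e + f - t by ring]
    ring

lemma sixj_swap_rows (a b e d c f : ℚ) : sixj q a b e d c f = sixj q d c e a b f := by
  classical
  obtain ⟨T, hT⟩ := exists_nat_gt (a + b + c + d)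
  rw [sixj_eq_sum a b e d c f T (Or.inl hT), sixj_eq_sum d c e a b f T (Or.inl (by linarith))]
  refine if_congr (by tauto) ?_ rfl
  have : ∀ w x y z s : ℝ, w * x * y * z * s = z * y * x * w * s := by intros; ring
  rw [this]
  congr 1
  refine sum_congr rfl fun t _ => ?_
  rw [show d + c + b + a - (t : ℚ) = a + b + c + d - t by ring,
    show d + a + e + f - (t : ℚ) = a + d + e + f - t by ring,
    show c + b + e + f - (t : ℚ) = b + c + e + f - t by ring]
  ring

lemma sixj_eq_zero (a b e d c f : ℚ)
    (h : ¬(Triangle a b e ∧ Triangle a c f ∧ Triangle d b f ∧ Triangle d c e)) :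
    sixj q a b e d c f = 0 := by rw [sixj, if_neg h]

/-- The integers parametrizing the admissible arguments of a `6j` coefficient. -/
lemma exists_racahData {a b l d c x : ℚ} (h1 : Triangle a b l) (h2 : Triangle a c x)
    (h3 : Triangle d b x) (h4 : Triangle d c l) : ∃ α₁ α₂ α₃ α₄ β₁ β₂ β₃ : ℤ,
    RacahData α₁ α₂ α₃ α₄ β₁ β₂ β₃ ∧ a + b + l = α₁ ∧ a + c + x = α₂ ∧ d + b + x = α₃ ∧
    d + c + l = α₄ ∧ a + b + c + d = β₁ ∧ a + d + l + x = β₂ ∧ b + c + l + x = β₃ := by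
  obtain ⟨⟨n1, hn1⟩, ⟨n2, hn2⟩, ⟨n3, hn3⟩⟩ := h1
  obtain ⟨⟨n4, hn4⟩, ⟨n5, hn5⟩, ⟨n6, hn6⟩⟩ := h2
  obtain ⟨⟨n7, hn7⟩, ⟨n8, hn8⟩, ⟨n9, hn9⟩⟩ := h3
  obtain ⟨⟨m1, hm1⟩, ⟨m2, hm2⟩, ⟨m3, hm3⟩⟩ := h4
  have p1 : ∀ n : ℕ, (0 : ℚ) ≤ n := fun n => Nat.cast_nonneg n
  have := p1 n1; have := p1 n2; have := p1 n3; have := p1 n4; have := p1 n5; have := p1 n6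
  have := p1 n7; have := p1 n8; have := p1 n9; have := p1 m1; have := p1 m2; have := p1 m3
  clear p1
  -- The three combinations of a triangle add up to its perimeter. A sum over four spins is the
  -- perimeter of one triangle plus one combination of another.
  refine ⟨n1 + n2 + n3, n4 + n5 + n6, n7 + n8 + n9, m1 + m2 + m3, n1 + m1 + m2 + m3,
    n2 + n7 + n8 + n9, n3 + n4 + n5 + n6, ⟨?_, by omega, by omega, by omega, by omega, ?_, ?_, ?_,
      ?_, ?_, ?_, ?_, ?_, ?_, ?_, ?_, ?_⟩, ?_, ?_, ?_, ?_, ?_, ?_, ?_⟩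
  · rw [← @Int.cast_inj ℚ]; push_cast; linarith
  all_goals first
    | (push_cast; linarith)
    | (rw [← @Int.cast_le ℚ]; push_cast; linarith)

/-! ### Expansions of the `6j` coefficient that separate the dependence on `x`. -/

/-- The dependence on `x` of the terms of expansions of `6j` coefficients that are cut off at
`x ≤ p`. -/
noncomputable def cutAbove (q : ℝ) (p x : ℚ) : ℝ := qR q (p - x) * qR q (p + x + 1)

/-- The dependence on `x` of the terms of expansions of `6j` coefficients that are cut off at
`v ≤ x`. -/
noncomputable def cutBelow (q : ℝ) (v x : ℚ) : ℝ := qF q (x + v) * qR q (x - v)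

/-- The expansion of the `6j` coefficient `{a b l; d c x}` in the functions
`cutAbove q (a + d - l + z) x`, up to a factor. -/
noncomputable def coefOne (q : ℝ) (a b l d c : ℚ) (z : ℕ) : ℝ :=
  (-1) ^ z * (qF q (c + d - l + z) * qF q (a + b - l + z) * qF q (2 * l - z)) *
    (qR q z * qR q (c + l - d - z) * qR q (b + l - a - z))

/-- The coefficients of the expansion in the functions `cutBelow q (a + d - l - z) x`. -/
noncomputable def coefTwo (q : ℝ) (a b l d c : ℚ) (z : ℕ) : ℝ :=
  (-1) ^ z * (qF q (b + l - a + z) * qF q (c + l - d + z)) *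
    (qR q z * qR q (a + b - l - z) * qR q (c + d - l - z) * qR q (2 * l + 1 + z))

/-- The coefficients of the expansion in the functions `cutBelow q (d - a + l - z) x`. -/
noncomputable def coefThree (q : ℝ) (a b l d c : ℚ) (z : ℕ) : ℝ :=
  (-1) ^ z * (qF q (2 * l - z) * qF q (a + b - l + z)) *
    (qR q z * qR q (l + d - c - z) * qR q (b + l - a - z) * qR q (l + d + c + 1 - z))

/-- The coefficients of the expansion in the functions `cutAbove q (b + d - z) x`. -/
noncomputable def coefFour (q : ℝ) (a b l d c : ℚ) (z : ℕ) : ℝ :=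
  (-1) ^ z * (qF q (2 * b - z) * qF q (b + d + a - c - z) * qF q (b + d + a + c + 1 - z)) *
    (qR q z * qR q (a + b - l - z) * qR q (a + b + l + 1 - z))

lemma sixj_eq_racahSum {a b l d c x : ℚ} (h1 : Triangle a b l) (h2 : Triangle a c x)
    (h3 : Triangle d b x) (h4 : Triangle d c l) {α₁ α₂ α₃ α₄ β₁ β₂ β₃ : ℤ}
    (e1 : a + b + l = α₁) (e2 : a + c + x = α₂) (e3 : d + b + x = α₃) (e4 : d + c + l = α₄)
    (f1 : a + b + c + d = β₁) (f2 : a + d + l + x = β₂) (f3 : b + c + l + x = β₃) (T : ℕ)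
    (hT : β₁ < T) :
    sixj q a b l d c x = delta q a b l * delta q a c x * delta q d b x * delta q d c l *
      racahSum q α₁ α₂ α₃ α₄ β₁ β₂ β₃ T := by
  have hT' : (β₁ : ℚ) < T := by exact_mod_cast hT
  rw [sixj_eq_sum a b l d c x T (Or.inl (by rw [f1]; exact hT')), if_pos ⟨h1, h2, h3, h4⟩, racahSum]
  congr 1
  refine sum_congr rfl fun t _ => ?_
  rw [qF_eq_qFac (t + 1) (by push_cast; ring), qR_eq_qInv (t - α₁) (by push_cast; linarith),
    qR_eq_qInv (t - α₂) (by push_cast; linarith), qR_eq_qInv (t - α₃) (by push_cast; linarith),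
    qR_eq_qInv (t - α₄) (by push_cast; linarith), qR_eq_qInv (β₁ - t) (by push_cast; linarith),
    qR_eq_qInv (β₂ - t) (by push_cast; linarith), qR_eq_qInv (β₃ - t) (by push_cast; linarith),
    zpow_natCast]
  ring

lemma sgn_intCast (n : ℤ) : sgn n = (-1) ^ n := by rw [sgn, Int.floor_intCast]

lemma sgn_eq {x : ℚ} (n : ℤ) (h : x = n) : sgn x = (-1) ^ n := by rw [h, sgn_intCast]

/-- `racahSum_eq_two` with the triads free of `x` in its first two places. Then `x` drops out of all
factors under the sum except the two that form `cutAbove`, and the factorials in front cancel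
against those from the four `Δ`. -/
theorem sixj_eq_coefOne (hq : 0 < q) {a b l d c x : ℚ} (h1 : Triangle a b l) (h2 : Triangle a c x)
    (h3 : Triangle d b x) (h4 : Triangle d c l) (N : ℕ) (hN : min (c + l - d) (b + l - a) < N) :
    sixj q a b l d c x = sgn (b + c + l + x) * (nabla q a c x * nabla q d b x /
      (nabla q a b l * nabla q d c l)) *
      ∑ z ∈ range N, coefOne q a b l d c z * cutAbove q (a + d - l + z) x := by
  obtain ⟨α₁, α₂, α₃, α₄, β₁, β₂, β₃, hd, e1, e2, e3, e4, f1, f2, f3⟩ :=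
    exists_racahData h1 h2 h3 h4
  obtain ⟨T, hT⟩ := exists_nat_gt (β₁ + β₂ + β₃)
  obtain ⟨hs, ha, hb, hc, hd, ae, af, ag, be, bf, bg, ce, cf, cg, de, df, dg⟩ := id hd
  have hs' : (α₁ + α₂ + α₃ + α₄ : ℚ) = β₁ + β₂ + β₃ := by exact_mod_cast hs
  have hp : RacahData α₁ α₄ α₂ α₃ β₁ β₃ β₂ := by constructor <;> omega
  rw [sixj_eq_racahSum h1 h2 h3 h4 e1 e2 e3 e4 f1 f2 f3 T (by omega),
    show racahSum q α₁ α₂ α₃ α₄ β₁ β₂ β₃ T = racahSum q α₁ α₄ α₂ α₃ β₁ β₃ β₂ T from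
      sum_congr rfl fun t _ => by ring,
    racahSum_eq_two hq hp T N (by omega) (by
      rw [min_lt_iff] at hN ⊢
      rcases hN with h | h
      · right; rw [← @Int.cast_lt ℚ]; push_cast; linarith
      · left; rw [← @Int.cast_lt ℚ]; push_cast; linarith),
    sgn_eq β₃ f3, delta_eq_div_nabla hq a b l, delta_eq_div_nabla hq d c l,
    delta_eq_nabla_mul hq a c x, delta_eq_nabla_mul hq d b x]
  have hsum : ∑ z ∈ range N, coefOne q a b l d c z * cutAbove q (a + d - l + z) x =
    ∑ z ∈ range N, (-1 : ℝ) ^ (z : ℤ) * qFac q (β₁ - α₁ + z) * qFac q (β₁ - α₄ + z) *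
      qFac q (α₁ + α₄ - β₁ - z) * qInv q z * qInv q (β₃ - α₂ - z) * qInv q (β₃ - α₃ - z) *
      qInv q (β₁ - β₃ + z) * qInv q (β₁ + β₂ - α₁ - α₄ + 1 + z) := by
    refine sum_congr rfl fun z _ => ?_
    rw [coefOne, cutAbove, qF_eq_qFac (β₁ - α₁ + z) (by push_cast; linarith),
      qF_eq_qFac (β₁ - α₄ + z) (by push_cast; linarith),
      qF_eq_qFac (α₁ + α₄ - β₁ - z) (by push_cast; linarith),
      qR_eq_qInv (z : ℤ) (by push_cast; linarith),
      qR_eq_qInv (β₃ - α₃ - z) (by push_cast; linarith),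
      qR_eq_qInv (β₃ - α₂ - z) (by push_cast; linarith),
      qR_eq_qInv (β₁ - β₃ + z) (by push_cast; linarith),
      qR_eq_qInv (β₁ + β₂ - α₁ - α₄ + 1 + z) (by push_cast; linarith), zpow_natCast]
    ring
  rw [← hsum, qInv_of_nonneg (n := β₁ - α₁) (by omega), qInv_of_nonneg (n := β₁ - α₄) (by omega),
    qInv_of_nonneg (n := β₃ - α₁) (by omega), qInv_of_nonneg (n := β₃ - α₄) (by omega),
    qInv_of_nonneg (n := β₂ - α₂) (by omega), qInv_of_nonneg (n := β₂ - α₃) (by omega),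
    qF_eq_qFac (β₁ - α₄) (by push_cast; linarith : a + b - l = _),
    qF_eq_qFac (β₂ - α₃) (by push_cast; linarith : a - b + l = _),
    qF_eq_qFac (β₁ - α₁) (by push_cast; linarith : d + c - l = _),
    qF_eq_qFac (β₂ - α₂) (by push_cast; linarith : d - c + l = _),
    qF_eq_qFac (β₃ - α₁) (by push_cast; linarith : c + x - a = _),
    qF_eq_qFac (β₃ - α₄) (by push_cast; linarith : b + x - d = _),
    qF_eq_qFac (α₂ + 1) (by push_cast; linarith : a + c + x + 1 = _),
    qF_eq_qFac (α₃ + 1) (by push_cast; linarith : d + b + x + 1 = _)]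
  generalize ∑ z ∈ range N, coefOne q a b l d c z * cutAbove q (a + d - l + z) x = S
  have := qFac_ne_zero hq
  have g1 := this (β₁ - α₁); have g2 := this (β₁ - α₄); have g3 := this (β₃ - α₁)
  have g4 := this (β₃ - α₄); have g5 := this (β₂ - α₂); have g6 := this (β₂ - α₃)
  have g7 := this (α₂ + 1); have g8 := this (α₃ + 1)
  have n1 := (nabla_pos hq a b l).ne'; have n2 := (nabla_pos hq d c l).ne'
  field_simp

/-- `racahSum_eq_two` with the two triads containing `x` in its first two places. In contrast to
`sixj_eq_coefOne`, the `∇` factors with `x` are in the denominator and the sign is free of `x`. -/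
theorem sixj_eq_coefTwo (hq : 0 < q) {a b l d c x : ℚ} (h1 : Triangle a b l) (h2 : Triangle a c x)
    (h3 : Triangle d b x) (h4 : Triangle d c l) (N : ℕ) (hN : min (a + b - l) (c + d - l) < N) :
    sixj q a b l d c x = sgn (a + b + c + d) * (nabla q a b l * nabla q d c l /
      (nabla q a c x * nabla q d b x)) *
      ∑ z ∈ range N, coefTwo q a b l d c z * cutBelow q (a + d - l - z) x := by
  obtain ⟨α₁, α₂, α₃, α₄, β₁, β₂, β₃, hd, e1, e2, e3, e4, f1, f2, f3⟩ :=
    exists_racahData h1 h2 h3 h4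
  obtain ⟨T, hT⟩ := exists_nat_gt (β₁ + β₂ + β₃)
  obtain ⟨hs, ha, hb, hc, hd, ae, af, ag, be, bf, bg, ce, cf, cg, de, df, dg⟩ := id hd
  have hs' : (α₁ + α₂ + α₃ + α₄ : ℚ) = β₁ + β₂ + β₃ := by exact_mod_cast hs
  have hp : RacahData α₂ α₃ α₁ α₄ β₃ β₁ β₂ := by constructor <;> omega
  rw [sixj_eq_racahSum h1 h2 h3 h4 e1 e2 e3 e4 f1 f2 f3 T (by omega),
    show racahSum q α₁ α₂ α₃ α₄ β₁ β₂ β₃ T = racahSum q α₂ α₃ α₁ α₄ β₃ β₁ β₂ T from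
      sum_congr rfl fun t _ => by ring,
    racahSum_eq_two hq hp T N (by omega) (by
      rw [min_lt_iff] at hN ⊢
      rcases hN with h | h
      · right; rw [← @Int.cast_lt ℚ]; push_cast; linarith
      · left; rw [← @Int.cast_lt ℚ]; push_cast; linarith),
    sgn_eq β₁ f1, delta_eq_div_nabla hq a c x, delta_eq_div_nabla hq d b x,
    delta_eq_nabla_mul hq a b l, delta_eq_nabla_mul hq d c l]
  have hsum : ∑ z ∈ range N, coefTwo q a b l d c z * cutBelow q (a + d - l - z) x =
    ∑ z ∈ range N, (-1 : ℝ) ^ (z : ℤ) * qFac q (β₃ - α₂ + z) * qFac q (β₃ - α₃ + z) *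
      qFac q (α₂ + α₃ - β₃ - z) * qInv q z * qInv q (β₁ - α₁ - z) * qInv q (β₁ - α₄ - z) *
      qInv q (β₃ - β₁ + z) * qInv q (β₃ + β₂ - α₂ - α₃ + 1 + z) := by
    refine sum_congr rfl fun z _ => ?_
    rw [coefTwo, cutBelow, qF_eq_qFac (β₃ - α₂ + z) (by push_cast; linarith), qF_eq_qFac
        (β₃ - α₃ + z) (by push_cast; linarith), qR_eq_qInv ((z : ℤ)) (by push_cast; linarith),
        qR_eq_qInv (β₁ - α₄ - z) (by push_cast; linarith), qR_eq_qInv (β₁ - α₁ - z)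
        (by push_cast; linarith), qR_eq_qInv (β₃ + β₂ - α₂ - α₃ + 1 + z) (by push_cast; linarith),
        qF_eq_qFac (α₂ + α₃ - β₃ - z) (by push_cast; linarith), qR_eq_qInv (β₃ - β₁ + z)
        (by push_cast; linarith),
      zpow_natCast]
    ring
  rw [← hsum, qInv_of_nonneg (n := β₃ - α₂) (by omega), qInv_of_nonneg (n := β₃ - α₃) (by omega),
      qInv_of_nonneg (n := β₁ - α₂) (by omega), qInv_of_nonneg (n := β₁ - α₃) (by omega),
      qInv_of_nonneg (n := β₂ - α₁) (by omega), qInv_of_nonneg (n := β₂ - α₄) (by omega),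
    qF_eq_qFac (β₃ - α₂) (by push_cast; linarith : b + l - a = _), qF_eq_qFac (β₃ - α₃)
        (by push_cast; linarith : c + l - d = _), qF_eq_qFac (α₁ + 1)
        (by push_cast; linarith : a + b + l + 1 = _), qF_eq_qFac (α₄ + 1)
        (by push_cast; linarith : d + c + l + 1 = _), qF_eq_qFac (β₁ - α₃)
        (by push_cast; linarith : a + c - x = _), qF_eq_qFac (β₂ - α₄)
        (by push_cast; linarith : a - c + x = _), qF_eq_qFac (β₁ - α₂)
        (by push_cast; linarith : d + b - x = _), qF_eq_qFac (β₂ - α₁)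
        (by push_cast; linarith : d - b + x = _)]
  generalize ∑ z ∈ range N, coefTwo q a b l d c z * cutBelow q (a + d - l - z) x = S
  have := qFac_ne_zero hq
  have g0 := this (β₃ - α₂); have g1 := this (β₃ - α₃); have g2 := this (β₁ - α₂); have g3 := this
      (β₁ - α₃); have g4 := this (β₂ - α₁); have g5 := this (β₂ - α₄); have g6 := this
      (α₁ + 1); have g7 := this (α₄ + 1)
  have n0 := (nabla_pos hq a c x).ne'; have n1 := (nabla_pos hq d b x).ne'
  field_simp

/-- From `racahSum_eq_three`. One `∇` with `x` is in the numerator and one in the denominator, and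
the sign depends on `x`; exchanging the rows of the `6j` symbol exchanges the two `∇`. -/
theorem sixj_eq_coefThree (hq : 0 < q) {a b l d c x : ℚ} (h1 : Triangle a b l) (h2 : Triangle a c x)
    (h3 : Triangle d b x) (h4 : Triangle d c l) (N : ℕ) (hN : min (l + d - c) (b + l - a) < N) :
    sixj q a b l d c x = sgn (a + c + x) * (nabla q a c x * nabla q d c l /
      (nabla q d b x * nabla q a b l)) *
      ∑ z ∈ range N, coefThree q a b l d c z * cutBelow q (d - a + l - z) x := by
  obtain ⟨α₁, α₂, α₃, α₄, β₁, β₂, β₃, hd, e1, e2, e3, e4, f1, f2, f3⟩ :=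
    exists_racahData h1 h2 h3 h4
  obtain ⟨T, hT⟩ := exists_nat_gt (β₁ + β₂ + β₃)
  obtain ⟨hs, ha, hb, hc, hd, ae, af, ag, be, bf, bg, ce, cf, cg, de, df, dg⟩ := id hd
  have hs' : (α₁ + α₂ + α₃ + α₄ : ℚ) = β₁ + β₂ + β₃ := by exact_mod_cast hs
  have hp : RacahData α₂ α₄ α₁ α₃ β₂ β₁ β₃ := by constructor <;> omega
  rw [sixj_eq_racahSum h1 h2 h3 h4 e1 e2 e3 e4 f1 f2 f3 T (by omega),
    show racahSum q α₁ α₂ α₃ α₄ β₁ β₂ β₃ T = racahSum q α₂ α₄ α₁ α₃ β₂ β₁ β₃ T from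
      sum_congr rfl fun t _ => by ring,
    racahSum_eq_three hq hp T N (by omega) (by
      rw [min_lt_iff] at hN ⊢
      rcases hN with h | h
      · left; rw [← @Int.cast_lt ℚ]; push_cast; linarith
      · right; rw [← @Int.cast_lt ℚ]; push_cast; linarith),
    sgn_eq α₂ e2, delta_eq_div_nabla hq a b l, delta_eq_div_nabla hq d b x,
    delta_eq_nabla_mul hq d c l, delta_eq_nabla_mul hq a c x]
  have hsum : ∑ z ∈ range N, coefThree q a b l d c z * cutBelow q (d - a + l - z) x =
    ∑ z ∈ range N, (-1 : ℝ) ^ (z : ℤ) * qFac q (β₁ - α₄ + z) * qFac q (β₂ + β₃ - α₂ - α₁ - z) *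
      qFac q (β₂ + β₃ - α₂ - α₃ - z) * qInv q z * qInv q (β₂ - α₂ - z) * qInv q (β₃ - α₂ - z) *
      qInv q (α₄ + 1 - z) * qInv q (α₂ - α₄ + z) := by
    refine sum_congr rfl fun z _ => ?_
    rw [coefThree, cutBelow, qF_eq_qFac (β₂ + β₃ - α₂ - α₃ - z) (by push_cast; linarith), qF_eq_qFac
        (β₁ - α₄ + z) (by push_cast; linarith), qR_eq_qInv ((z : ℤ)) (by push_cast; linarith),
        qR_eq_qInv (β₂ - α₂ - z) (by push_cast; linarith), qR_eq_qInv (β₃ - α₂ - z)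
        (by push_cast; linarith), qR_eq_qInv (α₄ + 1 - z) (by push_cast; linarith), qF_eq_qFac
        (β₂ + β₃ - α₂ - α₁ - z) (by push_cast; linarith), qR_eq_qInv (α₂ - α₄ + z)
        (by push_cast; linarith),
      zpow_natCast]
    ring
  rw [← hsum, qInv_of_nonneg (n := β₁ - α₂) (by omega), qInv_of_nonneg (n := β₁ - α₄) (by omega),
      qInv_of_nonneg (n := β₂ - α₁) (by omega), qInv_of_nonneg (n := β₂ - α₃) (by omega),
      qInv_of_nonneg (n := β₃ - α₁) (by omega), qInv_of_nonneg (n := β₃ - α₃) (by omega),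
    qF_eq_qFac (β₁ - α₄) (by push_cast; linarith : a + b - l = _), qF_eq_qFac (β₂ - α₃)
        (by push_cast; linarith : a - b + l = _), qF_eq_qFac (β₃ - α₃)
        (by push_cast; linarith : c + l - d = _), qF_eq_qFac (α₄ + 1)
        (by push_cast; linarith : d + c + l + 1 = _), qF_eq_qFac (β₃ - α₁)
        (by push_cast; linarith : c + x - a = _), qF_eq_qFac (α₂ + 1)
        (by push_cast; linarith : a + c + x + 1 = _), qF_eq_qFac (β₁ - α₂)
        (by push_cast; linarith : d + b - x = _), qF_eq_qFac (β₂ - α₁)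
        (by push_cast; linarith : d - b + x = _)]
  generalize ∑ z ∈ range N, coefThree q a b l d c z * cutBelow q (d - a + l - z) x = S
  have := qFac_ne_zero hq
  have g0 := this (β₁ - α₂); have g1 := this (β₁ - α₄); have g2 := this (β₂ - α₁); have g3 := this
      (β₂ - α₃); have g4 := this (β₃ - α₁); have g5 := this (β₃ - α₃); have g6 := this
      (α₂ + 1); have g7 := this (α₄ + 1)
  have n0 := (nabla_pos hq a b l).ne'; have n1 := (nabla_pos hq d b x).ne'
  field_simp

/-- From `racahSum_eq_four`. As in `sixj_eq_coefThree` one `∇` with `x` is above and one below, but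
now with a `cutAbove` factor and a sign free of `x`. -/
theorem sixj_eq_coefFour (hq : 0 < q) {a b l d c x : ℚ} (h1 : Triangle a b l) (h2 : Triangle a c x)
    (h3 : Triangle d b x) (h4 : Triangle d c l) (N : ℕ) (hN : a + b - l < N) :
    sixj q a b l d c x = sgn (a + b + c + d) * (nabla q a b l * nabla q d b x /
      (nabla q d c l * nabla q a c x)) *
      ∑ z ∈ range N, coefFour q a b l d c z * cutAbove q (b + d - z) x := by
  obtain ⟨α₁, α₂, α₃, α₄, β₁, β₂, β₃, hd, e1, e2, e3, e4, f1, f2, f3⟩ :=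
    exists_racahData h1 h2 h3 h4
  obtain ⟨T, hT⟩ := exists_nat_gt (β₁ + β₂ + β₃)
  obtain ⟨hs, ha, hb, hc, hd, ae, af, ag, be, bf, bg, ce, cf, cg, de, df, dg⟩ := id hd
  have hs' : (α₁ + α₂ + α₃ + α₄ : ℚ) = β₁ + β₂ + β₃ := by exact_mod_cast hs
  have hp : RacahData α₂ α₄ α₁ α₃ β₁ β₂ β₃ := by constructor <;> omega
  rw [sixj_eq_racahSum h1 h2 h3 h4 e1 e2 e3 e4 f1 f2 f3 T (by omega),
    show racahSum q α₁ α₂ α₃ α₄ β₁ β₂ β₃ T = racahSum q α₂ α₄ α₁ α₃ β₁ β₂ β₃ T from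
      sum_congr rfl fun t _ => by ring,
    racahSum_eq_four hq hp T N (by omega) (by
      rw [min_lt_iff]; right; rw [← @Int.cast_lt ℚ]; push_cast; linarith),
    sgn_eq β₁ f1, delta_eq_div_nabla hq d c l, delta_eq_div_nabla hq a c x,
    delta_eq_nabla_mul hq a b l, delta_eq_nabla_mul hq d b x]
  have hsum : ∑ z ∈ range N, coefFour q a b l d c z * cutAbove q (b + d - z) x =
    ∑ z ∈ range N, (-1 : ℝ) ^ (z : ℤ) * qFac q (β₁ + 1 - z) * qFac q (β₁ + β₂ - α₂ - α₄ - z) *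
      qFac q (β₁ + β₃ - α₂ - α₄ - z) * qInv q z * qInv q (β₁ - α₂ - z) * qInv q (β₁ - α₄ - z) *
      qInv q (α₃ + 1 - z) * qInv q (α₁ + 1 - z) := by
    refine sum_congr rfl fun z _ => ?_
    rw [coefFour, cutAbove, qF_eq_qFac (β₁ + β₃ - α₂ - α₄ - z) (by push_cast; linarith), qF_eq_qFac
        (β₁ + β₂ - α₂ - α₄ - z) (by push_cast; linarith), qF_eq_qFac (β₁ + 1 - z)
        (by push_cast; linarith), qR_eq_qInv ((z : ℤ)) (by push_cast; linarith), qR_eq_qInv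
        (β₁ - α₄ - z) (by push_cast; linarith), qR_eq_qInv (α₁ + 1 - z) (by push_cast; linarith),
        qR_eq_qInv (β₁ - α₂ - z) (by push_cast; linarith), qR_eq_qInv (α₃ + 1 - z)
        (by push_cast; linarith),
      zpow_natCast]
    ring
  rw [← hsum, qInv_of_nonneg (n := β₂ - α₂) (by omega), qInv_of_nonneg (n := β₂ - α₄) (by omega),
      qInv_of_nonneg (n := β₃ - α₂) (by omega), qInv_of_nonneg (n := β₃ - α₄) (by omega),
      qInv_of_nonneg (n := β₁ - α₁) (by omega), qInv_of_nonneg (n := β₁ - α₃) (by omega),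
    qF_eq_qFac (β₃ - α₂) (by push_cast; linarith : b + l - a = _), qF_eq_qFac (α₁ + 1)
        (by push_cast; linarith : a + b + l + 1 = _), qF_eq_qFac (β₃ - α₄)
        (by push_cast; linarith : b + x - d = _), qF_eq_qFac (α₃ + 1)
        (by push_cast; linarith : d + b + x + 1 = _), qF_eq_qFac (β₁ - α₁)
        (by push_cast; linarith : d + c - l = _), qF_eq_qFac (β₂ - α₂)
        (by push_cast; linarith : d - c + l = _), qF_eq_qFac (β₁ - α₃)
        (by push_cast; linarith : a + c - x = _), qF_eq_qFac (β₂ - α₄)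
        (by push_cast; linarith : a - c + x = _)]
  generalize ∑ z ∈ range N, coefFour q a b l d c z * cutAbove q (b + d - z) x = S
  have := qFac_ne_zero hq
  have g0 := this (β₂ - α₂); have g1 := this (β₂ - α₄); have g2 := this (β₃ - α₂); have g3 := this
      (β₃ - α₄); have g4 := this (β₁ - α₁); have g5 := this (β₁ - α₃); have g6 := this
      (α₁ + 1); have g7 := this (α₃ + 1)
  have n0 := (nabla_pos hq d c l).ne'; have n1 := (nabla_pos hq a c x).ne'
  field_simp

/-! ### Vanishing of the expansions where a triangle condition fails. -/

/-- `φ` is, on `{0, …, n}`, a multiple of a product of `k` factors `[s + z]`. -/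
def IsBracketProd (q : ℝ) (n : ℕ) (φ : ℕ → ℝ) (k : ℤ) : Prop :=
  ∃ (L : List ℤ) (ε : ℝ), (L.length : ℤ) = k ∧
    ∀ z : ℕ, z ≤ n → φ z = ε * (L.map fun s => qInt q (s + z)).prod

lemma IsBracketProd.mul {n : ℕ} {φ ψ : ℕ → ℝ} {k m : ℤ} (h : IsBracketProd q n φ k)
    (h' : IsBracketProd q n ψ m) : IsBracketProd q n (fun z => φ z * ψ z) (k + m) := by
  obtain ⟨L, ε, hL, hφ⟩ := h
  obtain ⟨L', ε', hL', hψ⟩ := h'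
  refine ⟨L ++ L', ε * ε', by simp [hL, hL'], fun z hz => ?_⟩
  simp only [hφ z hz, hψ z hz, List.map_append, List.prod_append]; ring

lemma exists_list_qRise_add (a : ℤ) (m : ℕ) : ∃ L : List ℤ, L.length = m ∧
    ∀ z : ℤ, qRise q (a + z) m = (L.map fun s => qInt q (s + z)).prod := by
  induction m generalizing a with
  | zero => exact ⟨[], rfl, by simp⟩
  | succ m ih =>
    obtain ⟨L, hL, h⟩ := ih (a + 1)
    refine ⟨a :: L, by simp [hL], fun z => ?_⟩
    rw [qRise_succ', List.map_cons, List.prod_cons, ← h, show a + z + 1 = a + 1 + z by ring]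

lemma exists_list_qRise_sub (a : ℤ) (m : ℕ) : ∃ (L : List ℤ) (ε : ℝ), L.length = m ∧
    ∀ z : ℤ, qRise q (a - z) m = ε * (L.map fun s => qInt q (s + z)).prod := by
  induction m generalizing a with
  | zero => exact ⟨[], 1, rfl, by simp⟩
  | succ m ih =>
    obtain ⟨L, ε, hL, h⟩ := ih (a + 1)
    refine ⟨-a :: L, -ε, by simp [hL], fun z => ?_⟩
    rw [qRise_succ', List.map_cons, List.prod_cons, show a - z + 1 = a + 1 - z by ring, h,
      show a - z = -(-a + z) by ring, qInt_neg]
    ring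

/-- `B` may be negative: the product contains `[0]` exactly for those `z` with `B + z < 0`. -/
lemma isBracketProd_add (hq : 0 < q) (n : ℕ) {A B : ℤ} (h : B ≤ A) (hA : 0 ≤ A) :
    IsBracketProd q n (fun z => qFac q (A + z) * qInv q (B + z)) (A - B) := by
  obtain ⟨m, hm⟩ := Int.eq_ofNat_of_zero_le (sub_nonneg.2 h)
  obtain ⟨L, hL, hz⟩ := exists_list_qRise_add (q := q) (B + 1) m
  have hm' : A - B = m := hm
  refine ⟨L, 1, by omega, fun z _ => ?_⟩
  rw [← hz, qRise_eq_fac hq _ _ (by omega), one_mul, show B + 1 + (z : ℤ) + m - 1 = A + z by omega,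
    show B + 1 + (z : ℤ) - 1 = B + z by omega]

lemma isBracketProd_sub (hq : 0 < q) (n : ℕ) {A B : ℤ} (h : B ≤ A) (hA : n ≤ A) :
    IsBracketProd q n (fun z => qFac q (A - z) * qInv q (B - z)) (A - B) := by
  obtain ⟨m, hm⟩ := Int.eq_ofNat_of_zero_le (sub_nonneg.2 h)
  obtain ⟨L, ε, hL, hz⟩ := exists_list_qRise_sub (q := q) (B + 1) m
  have hm' : A - B = m := hm
  refine ⟨L, ε, by omega, fun z _ => ?_⟩
  rw [← hz, qRise_eq_fac hq _ _ (by omega),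
    show B + 1 - (z : ℤ) + m - 1 = A - z by omega, show B + 1 - (z : ℤ) - 1 = B - z by omega]

lemma IsBracketProd.alternating_sum_eq_zero (hq : 0 < q) {n : ℕ} {φ : ℕ → ℝ} {k : ℤ}
    (h : IsBracketProd q n φ k) (hk : k + 1 = n) (N : ℕ) (f : ℕ → ℝ)
    (hf : ∀ z, f z = (-1) ^ z * qInv q z * qInv q (n - z) * φ z) (hN : ∀ z, f z ≠ 0 → z < N) :
    ∑ z ∈ range N, f z = 0 := by
  obtain ⟨L, ε, hL, hφ⟩ := h
  have h0 := sum_alternating_rise_eq_zero hq n L (by omega)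
  rw [Nat.sum_antidiagonal_eq_sum_range_succ (fun i j => (-1) ^ i * qInv q i * qInv q j *
      (L.map fun s => qInt q (s + i)).prod)] at h0
  rw [sum_range_eq_of_support f N (n + 1) (fun z hz => ⟨hN z hz, by
    rw [hf] at hz
    simp only [mul_ne_zero_iff] at hz
    have := nonneg_of_qInv_ne_zero hz.1.2
    omega⟩), ← mul_zero ε, ← h0, mul_sum]
  refine sum_congr rfl fun z hz => ?_
  rw [mem_range] at hz
  rw [hf, hφ z (by omega), show ((n - z : ℕ) : ℤ) = n - z by omega]
  ring

/-- The alternating sum has order `n3 = b + l - a`. The other factorials pair into three quotients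
with `k - n2 - m1 - 1`, `m1 + m3 - k` and `n2 + n3 - m3` brackets, in total `n3 - 1`. The
assumptions `x < b - d` and `a - c ≤ x` are what makes the first two numbers non-negative. -/
theorem sum_coefOne_eq_zero (hq : 0 < q) {a b l d c x : ℚ} (h1 : Triangle a b l)
    (h4 : Triangle d c l) (hx : ∃ k : ℤ, a + c - x = k) (hlt : x < b - d) (hge : a - c ≤ x)
    (N : ℕ) (hN : min (c + l - d) (b + l - a) < N) :
    ∑ z ∈ range N, coefOne q a b l d c z * cutAbove q (a + d - l + z) x = 0 := by
  obtain ⟨⟨n1, hn1⟩, ⟨n2, hn2⟩, ⟨n3, hn3⟩⟩ := h1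
  obtain ⟨⟨m1, hm1⟩, ⟨m2, hm2⟩, ⟨m3, hm3⟩⟩ := h4
  obtain ⟨k, hk⟩ := hx
  have hs : m2 + m3 = n2 + n3 := by
    have : (m2 + m3 : ℚ) = n2 + n3 := by linarith
    exact_mod_cast this
  have hk1 : (n2 : ℤ) + m1 < k := by
    rw [← @Int.cast_lt ℚ]; push_cast; linarith
  have hk2 : k ≤ (m1 : ℤ) + m3 := by
    rw [← @Int.cast_le ℚ]; push_cast; linarith
  have hN' : m3 < N ∨ n3 < N := by
    rw [min_lt_iff, hm3, hn3] at hN; exact_mod_cast hN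
  have P1 := isBracketProd_add hq n3 (A := n1) (B := n1 + n2 + m1 - k + 1) (by omega) (by omega)
  have P2 := isBracketProd_add hq n3 (A := m1) (B := k - m3) (by omega) (by omega)
  have P3 := isBracketProd_sub hq n3 (A := n2 + n3) (B := m3) (by omega) (by omega)
  refine ((P1.mul P2).mul P3).alternating_sum_eq_zero hq (by omega) N _ (fun z => ?_)
      (fun z hz => ?_)
  · rw [coefOne, cutAbove, qF_eq_qFac (m1 + z) (by push_cast; linarith),
      qF_eq_qFac (n1 + z) (by push_cast; linarith),
      qF_eq_qFac (n2 + n3 - z) (by push_cast; linarith), qR_eq_qInv (z : ℤ) (by push_cast; rfl),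
      qR_eq_qInv (m3 - z) (by push_cast; linarith), qR_eq_qInv (n3 - z) (by push_cast; linarith),
      qR_eq_qInv (k - m3 + z) (by push_cast; linarith),
      qR_eq_qInv (n1 + n2 + m1 - k + 1 + z) (by push_cast; linarith)]
    ring
  · rw [coefOne] at hz
    simp only [mul_ne_zero_iff] at hz
    have e1 : (z : ℚ) ≤ m3 := by linarith [nonneg_of_qR_ne_zero hz.1.2.1.2]
    have e2 : (z : ℚ) ≤ n3 := by linarith [nonneg_of_qR_ne_zero hz.1.2.2]
    norm_cast at e1 e2
    omega

lemma coefOne_swap (a b l d c : ℚ) (z : ℕ) : coefOne q a b l d c z = coefOne q d c l a b z := by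
  rw [coefOne, coefOne, show b + a - l = a + b - l by ring, show d + c - l = c + d - l by ring]
  ring

/-- The mirror image of `sum_coefOne_eq_zero` under the exchange of `(a, b)` and `(d, c)`. -/
theorem sum_coefOne_eq_zero' (hq : 0 < q) {a b l d c x : ℚ} (h1 : Triangle a b l)
    (h4 : Triangle d c l) (hx : ∃ k : ℤ, a + c - x = k) (hlt : x < c - a) (hge : d - b ≤ x)
    (N : ℕ) (hN : min (c + l - d) (b + l - a) < N) :
    ∑ z ∈ range N, coefOne q a b l d c z * cutAbove q (a + d - l + z) x = 0 := by
  obtain ⟨k, hk⟩ := hx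
  obtain ⟨⟨n1, hn1⟩, _, _⟩ := id h1
  obtain ⟨⟨m1, hm1⟩, _, _⟩ := id h4
  obtain ⟨_, ⟨m2, hm2⟩, _⟩ := id h4
  obtain ⟨_, ⟨n2, hn2⟩, _⟩ := id h1
  have := sum_coefOne_eq_zero hq (x := x) h4 h1 ⟨k + m2 - n2, by push_cast; linarith⟩ hlt hge N
    (by rwa [min_comm])
  rw [← this]
  exact sum_congr rfl fun z _ => by rw [coefOne_swap, add_comm a d]

/-- Again an alternating sum of order `n3 = b + l - a` with `n3 - 1` brackets; `a + c < x` and `x ≤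
b + d` make the first and third quotients genuine products. -/
theorem sum_coefThree_eq_zero (hq : 0 < q) {a b l d c x : ℚ} (h1 : Triangle a b l)
    (h4 : Triangle d c l) (hx : ∃ k : ℤ, a + c - x = k) (hlt : a + c < x) (hge : x ≤ b + d)
    (N : ℕ) (hN : min (l + d - c) (b + l - a) < N) :
    ∑ z ∈ range N, coefThree q a b l d c z * cutBelow q (d - a + l - z) x = 0 := by
  obtain ⟨⟨n1, hn1⟩, ⟨n2, hn2⟩, ⟨n3, hn3⟩⟩ := h1
  obtain ⟨⟨m1, hm1⟩, ⟨m2, hm2⟩, ⟨m3, hm3⟩⟩ := h4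
  obtain ⟨k, hk⟩ := hx
  have hs : m2 + m3 = n2 + n3 := by
    have : (m2 + m3 : ℚ) = n2 + n3 := by linarith
    exact_mod_cast this
  have hk1 : k < 0 := by
    rw [← @Int.cast_lt ℚ]; push_cast; linarith
  have hk2 : (n2 : ℤ) ≤ m2 + k := by
    rw [← @Int.cast_le ℚ]; push_cast; linarith
  have hN' : m2 < N ∨ n3 < N := by
    rw [min_lt_iff, show l + d - c = m2 by linarith, hn3] at hN; exact_mod_cast hN
  have P1 := isBracketProd_sub hq n3 (A := m1 + m2 + m3 - k) (B := m1 + m2 + m3 + 1) (by omega)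
    (by omega)
  have P2 := isBracketProd_sub hq n3 (A := n2 + n3) (B := m2) (by omega) (by omega)
  have P3 := isBracketProd_add hq n3 (A := n1) (B := n1 + n2 - m2 - k) (by omega) (by omega)
  refine ((P1.mul P2).mul P3).alternating_sum_eq_zero hq (by omega) N _ (fun z => ?_)
      (fun z hz => ?_)
  · rw [coefThree, cutBelow, qF_eq_qFac (n2 + n3 - z) (by push_cast; linarith),
      qF_eq_qFac (n1 + z) (by push_cast; linarith), qR_eq_qInv (z : ℤ) (by push_cast; rfl),
      qR_eq_qInv (m2 - z) (by push_cast; linarith), qR_eq_qInv (n3 - z) (by push_cast; linarith),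
      qR_eq_qInv (m1 + m2 + m3 + 1 - z) (by push_cast; linarith),
      qF_eq_qFac (m1 + m2 + m3 - k - z) (by push_cast; linarith),
      qR_eq_qInv (n1 + n2 - m2 - k + z) (by push_cast; linarith)]
    ring
  · rw [coefThree] at hz
    simp only [mul_ne_zero_iff] at hz
    have e1 : (z : ℚ) ≤ m2 := by linarith [nonneg_of_qR_ne_zero hz.1.2.1.1.2]
    have e2 : (z : ℚ) ≤ n3 := by linarith [nonneg_of_qR_ne_zero hz.1.2.1.2]
    norm_cast at e1 e2
    omega

/-- Here the order of the alternating sum is `n = b + d - x`: the factor `1/[n-z]!` comes from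
`cutAbove`, while `1/[a+b-l-z]!` goes into one of the quotients. -/
theorem sum_coefFour_eq_zero (hq : 0 < q) {a b l d c x : ℚ} (h1 : Triangle a b l)
    (h4 : Triangle d c l) (hx : ∃ k : ℤ, a + c - x = k) (hx0 : 0 ≤ x) (hlt : x < a - c)
        (hge : d - b ≤ x)
    (hle : x ≤ b + d) (N : ℕ) (hN : a + b - l < N) :
    ∑ z ∈ range N, coefFour q a b l d c z * cutAbove q (b + d - z) x = 0 := by
  obtain ⟨⟨n1, hn1⟩, ⟨n2, hn2⟩, ⟨n3, hn3⟩⟩ := h1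
  obtain ⟨⟨m1, hm1⟩, ⟨m2, hm2⟩, ⟨m3, hm3⟩⟩ := h4
  obtain ⟨k, hk⟩ := hx
  have hs : m2 + m3 = n2 + n3 := by
    have : (m2 + m3 : ℚ) = n2 + n3 := by linarith
    exact_mod_cast this
  have hk1 : (m1 : ℤ) + m3 < k := by
    rw [← @Int.cast_lt ℚ]; push_cast; linarith
  have hk2 : (n2 : ℤ) ≤ m2 + k := by
    rw [← @Int.cast_le ℚ]; push_cast; linarith
  have hk3 : (m2 : ℤ) - n2 + k ≤ n1 + n3 := by
    rw [← @Int.cast_le ℚ]; push_cast; linarith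
  have hk4 : k ≤ (n1 : ℤ) + n2 := by
    rw [← @Int.cast_le ℚ]; push_cast; linarith
  have hN' : n1 < N := by
    rw [hn1] at hN; exact_mod_cast hN
  obtain ⟨n, hn⟩ := Int.eq_ofNat_of_zero_le (sub_nonneg.2 hk2)
  have hn : (n : ℤ) = m2 - n2 + k := by
    have : m2 + k - n2 = (n : ℤ) := hn
    omega
  have P1 := isBracketProd_sub hq n (A := n1 + n3) (B := n1) (by omega) (by omega)
  have P2 := isBracketProd_sub hq n (A := m2 + n1) (B := m1 + m2 + m3 + n1 - k + 1) (by omega)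
    (by omega)
  have P3 := isBracketProd_sub hq n (A := m2 + n1 + m1 + m3 + 1) (B := n1 + n2 + n3 + 1) (by omega)
    (by omega)
  refine ((P1.mul P2).mul P3).alternating_sum_eq_zero hq (by omega) N _ (fun z => ?_)
      (fun z hz => ?_)
  · rw [coefFour, cutAbove, qF_eq_qFac (n1 + n3 - z) (by push_cast; linarith),
      qF_eq_qFac (m2 + n1 - z) (by push_cast; linarith),
      qF_eq_qFac (m2 + n1 + m1 + m3 + 1 - z) (by push_cast; linarith),
      qR_eq_qInv (z : ℤ) (by push_cast; rfl), qR_eq_qInv (n1 - z) (by push_cast; linarith),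
      qR_eq_qInv (n1 + n2 + n3 + 1 - z) (by push_cast; linarith),
      qR_eq_qInv (n - z) (by rw [hn]; push_cast; linarith),
      qR_eq_qInv (m1 + m2 + m3 + n1 - k + 1 - z) (by push_cast; linarith)]
    ring
  · rw [coefFour] at hz
    simp only [mul_ne_zero_iff] at hz
    have e1 : (z : ℚ) ≤ n1 := by linarith [nonneg_of_qR_ne_zero hz.1.2.1.2]
    norm_cast at e1
    omega

/-- In this range of `x` the roles are exchanged: the order is `n1 = a + b - l`, and `1/[b+d-x-z]!`
goes into a quotient. -/
theorem sum_coefFour_eq_zero' (hq : 0 < q) {a b l d c x : ℚ} (h1 : Triangle a b l)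
    (h4 : Triangle d c l) (hx : ∃ k : ℤ, a + c - x = k) (hlt : x < b - d) (hge : c - a ≤ x)
    (N : ℕ) (hN : a + b - l < N) :
    ∑ z ∈ range N, coefFour q a b l d c z * cutAbove q (b + d - z) x = 0 := by
  obtain ⟨⟨n1, hn1⟩, ⟨n2, hn2⟩, ⟨n3, hn3⟩⟩ := h1
  obtain ⟨⟨m1, hm1⟩, ⟨m2, hm2⟩, ⟨m3, hm3⟩⟩ := h4
  obtain ⟨k, hk⟩ := hx
  have hs : m2 + m3 = n2 + n3 := by
    have : (m2 + m3 : ℚ) = n2 + n3 := by linarith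
    exact_mod_cast this
  have hk1 : (n2 : ℤ) + m1 < k := by
    rw [← @Int.cast_lt ℚ]; push_cast; linarith
  have hk2 : k ≤ (n1 : ℤ) + n2 := by
    rw [← @Int.cast_le ℚ]; push_cast; linarith
  have hN' : n1 < N := by
    rw [hn1] at hN; exact_mod_cast hN
  have P1 := isBracketProd_sub hq n1 (A := n1 + n3) (B := m1 + m2 + m3 + n1 - k + 1) (by omega)
    (by omega)
  have P2 := isBracketProd_sub hq n1 (A := m2 + n1) (B := m2 - n2 + k) (by omega) (by omega)
  have P3 := isBracketProd_sub hq n1 (A := m2 + n1 + m1 + m3 + 1) (B := n1 + n2 + n3 + 1) (by omega)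
    (by omega)
  refine ((P1.mul P2).mul P3).alternating_sum_eq_zero hq (by omega) N _ (fun z => ?_)
      (fun z hz => ?_)
  · rw [coefFour, cutAbove, qF_eq_qFac (n1 + n3 - z) (by push_cast; linarith),
      qF_eq_qFac (m2 + n1 - z) (by push_cast; linarith),
      qF_eq_qFac (m2 + n1 + m1 + m3 + 1 - z) (by push_cast; linarith),
      qR_eq_qInv (z : ℤ) (by push_cast; rfl), qR_eq_qInv (n1 - z) (by push_cast; linarith),
      qR_eq_qInv (n1 + n2 + n3 + 1 - z) (by push_cast; linarith),
      qR_eq_qInv (m2 - n2 + k - z) (by push_cast; linarith),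
      qR_eq_qInv (m1 + m2 + m3 + n1 - k + 1 - z) (by push_cast; linarith)]
    ring
  · rw [coefFour] at hz
    simp only [mul_ne_zero_iff] at hz
    have e1 : (z : ℚ) ≤ n1 := by linarith [nonneg_of_qR_ne_zero hz.1.2.1.2]
    norm_cast at e1
    omega

/-! ### Summation over `x` of products of four cut-off factors. -/

/-- `dougall` with `a = V + 1`, `b = V + B + 1`, `c = -A`, to be used with `x = V/2 + k`, so that
`[a+2k] = [2x+1]`. The sign of `(-A|q)_k` cancels the alternating sign. -/
lemma dougall_two_two (hq : 0 < q) (V A B : ℤ) (N : ℕ) (hV : 0 ≤ V) (hVB : 0 ≤ V + B)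
    (hNB : B ≤ N) (hA : 0 ≤ A) :
    ∑ k ∈ range (N + 1), qInt q (V + 2 * k + 1) * (qInv q (N - k) * qInv q (V + N + k + 1) *
      (qFac q (V + k) * qInv q k) * (qInv q (A - k) * qInv q (V + A + k + 1)) *
      (qFac q (V + B + k) * qInv q (k - B))) =
    qFac q (V + B) * qFac q (N + A - B) * (qInv q (V + N + A + 1) * qInv q N * qInv q (N - B) *
      qInv q A * qInv q (A - B)) := by
  rcases lt_or_ge A B with hAB | hAB
  · rw [qInv_of_neg (n := A - B) (by omega), sum_eq_zero]
    · ring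
    · intro k _
      rcases lt_or_ge (A - k) 0 with h | h
      · rw [qInv_of_neg h]; ring
      · rw [qInv_of_neg (n := k - B) (by omega)]; ring
  have h := dougall hq (V + 1) (V + B + 1) (-A) N (by omega)
  rw [Nat.sum_antidiagonal_eq_sum_range_succ (fun i j => (-1) ^ i * qInv q i * qInv q j *
      qInt q (V + 1 + 2 * i) * qRise q (V + B + 1) i * qRise q (-A) i *
      qRise q (1 + (V + 1) - (V + B + 1) + i) j * qRise q (1 + (V + 1) - -A + i) j *
      (qRise q (V + 1 + i) (N + 1))⁻¹)] at h
  have e : ∀ k ∈ range N.succ, (-1) ^ k * qInv q k * qInv q ((N - k : ℕ) : ℤ) *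
      qInt q (V + 1 + 2 * k) * qRise q (V + B + 1) k * qRise q (-A) k *
      qRise q (1 + (V + 1) - (V + B + 1) + k) (N - k) * qRise q (1 + (V + 1) - -A + k) (N - k) *
      (qRise q (V + 1 + k) (N + 1))⁻¹ =
      (qInv q (V + B) * qFac q A * qFac q (N - B) * qFac q (V + N + A + 1)) *
      (qInt q (V + 2 * k + 1) * (qInv q (N - k) * qInv q (V + N + k + 1) *
      (qFac q (V + k) * qInv q k) * (qInv q (A - k) * qInv q (V + A + k + 1)) *
      (qFac q (V + B + k) * qInv q (k - B)))) := by
    intro k hk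
    rw [mem_range] at hk
    have hk' : ((N - k : ℕ) : ℤ) = N - k := by omega
    rw [qRise_neg_eq_fac hq _ _ hA, qRise_eq_fac hq _ _ (by omega), qRise_eq_fac hq _ _ (by omega),
      qRise_eq_fac hq _ _ (by omega), qRise_eq_fac hq _ _ (by omega), hk',
      show V + B + 1 + (k : ℤ) - 1 = V + B + k by ring, show V + B + 1 - 1 = V + B by ring,
      show 1 + (V + 1) - (V + B + 1) + (k : ℤ) + (N - k) - 1 = N - B by ring,
      show 1 + (V + 1) - (V + B + 1) + (k : ℤ) - 1 = k - B by ring,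
      show 1 + (V + 1) - -A + (k : ℤ) + (N - k) - 1 = V + N + A + 1 by ring,
      show 1 + (V + 1) - -A + (k : ℤ) - 1 = V + A + k + 1 by ring,
      show V + 1 + (k : ℤ) + ((N + 1 : ℕ) : ℤ) - 1 = V + N + k + 1 by push_cast; ring,
      show V + 1 + (k : ℤ) - 1 = V + k by ring, show V + 1 + 2 * (k : ℤ) = V + 2 * k + 1 by ring,
      mul_inv, ← qInv_of_nonneg (n := V + N + k + 1) (by omega),
      qInv_of_nonneg (n := V + k) (by omega), inv_inv]
    have : ((-1 : ℝ) ^ k) * (-1) ^ k = 1 := by rw [← mul_pow]; simp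
    linear_combination (qInv q (V + B) * qFac q A * qFac q (N - B) * qFac q (V + N + A + 1)) *
      (qInt q (V + 2 * k + 1) * (qInv q (N - k) * qInv q (V + N + k + 1) *
      (qFac q (V + k) * qInv q k) * (qInv q (A - k) * qInv q (V + A + k + 1)) *
      (qFac q (V + B + k) * qInv q (k - B)))) * this
  rw [sum_congr rfl e, ← mul_sum, qRise_eq_fac hq _ _ (by omega),
    show 1 + (V + 1) - (V + B + 1) - -A + (N : ℤ) - 1 = N + A - B by ring,
    show 1 + (V + 1) - (V + B + 1) - -A - 1 = A - B by ring, Nat.succ_eq_add_one] at h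
  have f1 := qFac_mul_qInv hq hVB
  have f2 := qFac_mul_qInv hq hA
  have f3 := qFac_mul_qInv hq (n := N - B) (by omega)
  have f4 := qFac_mul_qInv hq (n := V + N + A + 1) (by omega)
  generalize ∑ k ∈ range (N + 1), qInt q (V + 2 * (k : ℤ) + 1) * _ = S at h ⊢
  calc S = (qFac q (V + B) * qInv q (V + B)) * (qFac q A * qInv q A) *
        (qFac q (N - B) * qInv q (N - B)) * (qFac q (V + N + A + 1) * qInv q (V + N + A + 1)) *
            S := by
        rw [f1, f2, f3, f4]; ring
    _ = (qFac q (V + B) * qInv q A * qInv q (N - B) * qInv q (V + N + A + 1)) *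
        (qInv q (V + B) * qFac q A * qFac q (N - B) * qFac q (V + N + A + 1) * S) := by ring
    _ = _ := by rw [h]; ring

/-- `dougall` with `a = V + 1`, `b = V + A + 1`, `c = V + B + 1`. Both rising factorials are now
factorials in the numerator, so the alternating sign remains. -/
lemma dougall_one_three (hq : 0 < q) (V A B : ℤ) (N : ℕ) (hV : 0 ≤ V) (hVA : 0 ≤ V + A)
    (hVB : 0 ≤ V + B) (hVAB : 0 ≤ V + A + B) (hNA : A ≤ N) (hNB : B ≤ N) :
    ∑ k ∈ range (N + 1), (-1 : ℝ) ^ (N - k : ℤ) * qInt q (V + 2 * k + 1) *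
      (qInv q (N - k) * qInv q (V + N + k + 1) * (qFac q (V + k) * qInv q k) *
      (qFac q (V + A + k) * qInv q (k - A)) * (qFac q (V + B + k) * qInv q (k - B))) =
    qFac q (V + A) * qFac q (V + B) * qFac q (V + A + B) * (qInv q N * qInv q (N - A) *
      qInv q (N - B) * qInv q (V + A + B - N)) := by
  have h := dougall hq (V + 1) (V + A + 1) (V + B + 1) N (by omega)
  rw [Nat.sum_antidiagonal_eq_sum_range_succ (fun i j => (-1) ^ i * qInv q i * qInv q j *
      qInt q (V + 1 + 2 * i) * qRise q (V + A + 1) i * qRise q (V + B + 1) i *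
      qRise q (1 + (V + 1) - (V + A + 1) + i) j * qRise q (1 + (V + 1) - (V + B + 1) + i) j *
      (qRise q (V + 1 + i) (N + 1))⁻¹)] at h
  have e : ∀ k ∈ range N.succ, (-1) ^ k * qInv q k * qInv q ((N - k : ℕ) : ℤ) *
      qInt q (V + 1 + 2 * k) * qRise q (V + A + 1) k * qRise q (V + B + 1) k *
      qRise q (1 + (V + 1) - (V + A + 1) + k) (N - k) *
      qRise q (1 + (V + 1) - (V + B + 1) + k) (N - k) *
      (qRise q (V + 1 + k) (N + 1))⁻¹ =
      ((-1) ^ N * qInv q (V + A) * qInv q (V + B) * qFac q (N - A) * qFac q (N - B)) *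
      ((-1 : ℝ) ^ (N - k : ℤ) * qInt q (V + 2 * k + 1) *
      (qInv q (N - k) * qInv q (V + N + k + 1) * (qFac q (V + k) * qInv q k) *
      (qFac q (V + A + k) * qInv q (k - A)) * (qFac q (V + B + k) * qInv q (k - B)))) := by
    intro k hk
    rw [mem_range] at hk
    have hk' : ((N - k : ℕ) : ℤ) = N - k := by omega
    rw [qRise_eq_fac hq _ _ (by omega), qRise_eq_fac hq _ _ (by omega),
      qRise_eq_fac hq _ _ (by omega), qRise_eq_fac hq _ _ (by omega),
      qRise_eq_fac hq _ _ (by omega), hk',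
      show V + A + 1 + (k : ℤ) - 1 = V + A + k by ring, show V + A + 1 - 1 = V + A by ring,
      show V + B + 1 + (k : ℤ) - 1 = V + B + k by ring, show V + B + 1 - 1 = V + B by ring,
      show 1 + (V + 1) - (V + A + 1) + (k : ℤ) + (N - k) - 1 = N - A by ring,
      show 1 + (V + 1) - (V + A + 1) + (k : ℤ) - 1 = k - A by ring,
      show 1 + (V + 1) - (V + B + 1) + (k : ℤ) + (N - k) - 1 = N - B by ring,
      show 1 + (V + 1) - (V + B + 1) + (k : ℤ) - 1 = k - B by ring,
      show V + 1 + (k : ℤ) + ((N + 1 : ℕ) : ℤ) - 1 = V + N + k + 1 by push_cast; ring,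
      show V + 1 + (k : ℤ) - 1 = V + k by ring, show V + 1 + 2 * (k : ℤ) = V + 2 * k + 1 by ring,
      mul_inv, ← qInv_of_nonneg (n := V + N + k + 1) (by omega),
      qInv_of_nonneg (n := V + k) (by omega), inv_inv]
    have : ((-1 : ℝ) ^ k) = (-1) ^ N * (-1 : ℝ) ^ (N - k : ℤ) := by
      rw [zpow_sub₀ (by norm_num), zpow_natCast, zpow_natCast, div_eq_mul_inv, ← inv_pow,
        inv_neg_one, ← mul_assoc, ← mul_pow]; simp
    rw [this]; ring
  rw [sum_congr rfl e, ← mul_sum, show 1 + (V + 1) - (V + A + 1) -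
      (V + B + 1) = -(V + A + B) by ring,
    qRise_neg_eq_fac hq _ _ hVAB, Nat.succ_eq_add_one] at h
  have f1 := qFac_mul_qInv hq hVA
  have f2 := qFac_mul_qInv hq hVB
  have f3 := qFac_mul_qInv hq (n := N - A) (by omega)
  have f4 := qFac_mul_qInv hq (n := N - B) (by omega)
  have f5 : ((-1 : ℝ) ^ N) * (-1) ^ N = 1 := by rw [← mul_pow]; simp
  generalize ∑ k ∈ range (N + 1), (-1 : ℝ) ^ (N - k : ℤ) * _ * _ = S at h ⊢
  calc S = (qFac q (V + A) * qInv q (V + A)) * (qFac q (V + B) * qInv q (V + B)) *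
        (qFac q (N - A) * qInv q (N - A)) * (qFac q (N - B) * qInv q (N - B)) *
        ((-1) ^ N * (-1) ^ N) * S := by
        rw [f1, f2, f3, f4, f5]; ring
    _ = ((-1) ^ N * qFac q (V + A) * qFac q (V + B) * qInv q (N - A) * qInv q (N - B)) *
        ((-1) ^ N * qInv q (V + A) * qInv q (V + B) * qFac q (N - A) * qFac q
            (N - B) * S) := by ring
    _ = (-1) ^ N * (-1) ^ N * (qFac q (V + A) * qFac q (V + B) * qFac q (V + A + B) *
        (qInv q N * qInv q (N - A) * qInv q (N - B) * qInv q (V + A + B - N))) := by rw [h]; ring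
    _ = _ := by rw [f5, one_mul]

lemma sgn_congr {u v : ℚ} (n : ℤ) (h : u - v = 2 * n) : sgn u = sgn v := by
  have h' : u = v + ((2 * n : ℤ) : ℚ) := by push_cast; linarith
  rw [sgn, sgn, h', Int.floor_add_intCast, zpow_add₀ (by norm_num), zpow_mul]
  simp

/-- Integrality is essential, since `sgn` takes the floor: `sgn (1/2) * sgn (1/2) ≠ sgn 1`. -/
lemma sgn_mul_sgn {u v : ℚ} (m n : ℤ) (hu : u = m) (hv : v = n) :
    sgn u * sgn v = sgn (u + v) := by
  rw [sgn_eq m hu, sgn_eq n hv, sgn_eq (m + n) (by push_cast; rw [hu, hv]),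
    zpow_add₀ (by norm_num)]

lemma sgn_natCast (n : ℕ) : sgn n = (-1) ^ n := by
  rw [sgn_eq (n : ℤ) (by push_cast; rfl), zpow_natCast]

lemma sgn_neg_natCast (n : ℕ) : sgn (-n) = (-1) ^ n := by
  rw [← sgn_natCast]; exact sgn_congr (-n) (by push_cast; ring)

open Classical in
/-- The sum `∑ₓ [2x+1] f(x)` over the nonnegative integers and half-integers `x ≤ M / 2` that
differ from `w` by an integer. -/
noncomputable def latticeSum (q : ℝ) (w : ℚ) (M : ℕ) (f : ℚ → ℝ) : ℝ :=
  ∑ n ∈ range (M + 1), if ∃ m : ℤ, (n : ℚ) / 2 - w = m then qnum q ((n : ℚ) + 1) * f ((n : ℚ) / 2)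
    else 0

/-- In the class of `w` modulo integers, the points of `[v, v + N]` are `x = v + k`, that is `n = 2x
= V + 2k`. -/
lemma latticeSum_eq_sum {w v : ℚ} {M V N : ℕ} {f : ℚ → ℝ} (hv : 2 * v = V)
    (hw : ∃ m : ℤ, v - w = m) (hM : V + 2 * N ≤ M)
    (hf : ∀ x, f x ≠ 0 → v ≤ x ∧ x ≤ v + N) :
    latticeSum q w M f = ∑ k ∈ range (N + 1), qInt q (V + 2 * k + 1) * f (v + k) := by
  obtain ⟨m, hm⟩ := hw
  symm
  refine sum_of_injOn (fun k => V + 2 * k) (fun _ _ _ _ h => by simpa using h) (fun k hk => ?_)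
    (fun n hn hnot => ?_) (fun k hk => ?_)
  · simp only [coe_range, Set.mem_Iio] at hk ⊢; omega
  · split_ifs with h
    · obtain ⟨m', hm'⟩ := h
      by_contra h0
      obtain ⟨h1, h2⟩ := hf _ (right_ne_zero_of_mul h0)
      have e : (n : ℤ) = V + 2 * (m' - m) := by
        rw [← @Int.cast_inj ℚ]; push_cast; linarith
      have e1 : (V : ℤ) ≤ n := by rw [← @Int.cast_le ℚ]; push_cast; linarith
      have e2 : (n : ℤ) ≤ V + 2 * N := by rw [← @Int.cast_le ℚ]; push_cast; linarith
      refine hnot ⟨(m' - m).toNat, ?_, ?_⟩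
      · simp only [coe_range, Set.mem_Iio]; omega
      · simp only; omega
    · rfl
  · have e : ((V + 2 * k : ℕ) : ℚ) / 2 = v + k := by push_cast; linarith
    rw [if_pos ⟨m + k, by rw [e]; push_cast; linarith⟩, e, qInt]
    push_cast; rfl

lemma latticeSum_eq_zero {w : ℚ} {M : ℕ} {f : ℚ → ℝ} (hf : ∀ x, f x = 0) :
    latticeSum q w M f = 0 := by
  rw [latticeSum]; exact sum_eq_zero fun n _ => by simp [hf]

lemma cutAbove_ne_zero {p x : ℚ} (h : cutAbove q p x ≠ 0) : x ≤ p := by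
  have := nonneg_of_qR_ne_zero (left_ne_zero_of_mul h); linarith

lemma cutBelow_ne_zero {v x : ℚ} (h : cutBelow q v x ≠ 0) : v ≤ x := by
  have := nonneg_of_qR_ne_zero (right_ne_zero_of_mul h); linarith

lemma latticeSum_two_two_of_nonneg (hq : 0 < q) {w p₁ p₃ v₂ v₄ : ℚ} {M : ℕ} {W P₁ P₃ V₂ V₄ : ℤ}
    (hW : 2 * w = W) (hp₁ : p₁ - w = P₁) (hp₃ : p₃ - w = P₃) (hv₂ : v₂ - w = V₂)
    (hv₄ : v₄ - w = V₄) (hM : 2 * p₁ ≤ M) (h : 0 ≤ v₂ + v₄) (h0 : 0 ≤ v₂) :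
    latticeSum q w M (fun x => cutAbove q p₁ x * cutBelow q v₂ x * cutAbove q p₃ x *
      cutBelow q v₄ x) =
    qF q (v₂ + v₄) * qF q (p₁ + p₃ - v₂ - v₄) * (qR q (p₁ + p₃ + 1) * qR q (p₁ - v₂) *
      qR q (p₁ - v₄) * qR q (p₃ - v₂) * qR q (p₃ - v₄)) := by
  -- In these cases the supports do not meet and both sides are `0`. The remaining case `p₃ < v₄` is
  -- covered by `dougall_two_two`.
  by_cases hz : p₁ < v₂ ∨ p₃ < v₂ ∨ p₁ < v₄
  · rw [latticeSum_eq_zero]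
    · rcases hz with hz | hz | hz
      · rw [qR_of_neg (x := p₁ - v₂) (by linarith)]; ring
      · rw [qR_of_neg (x := p₃ - v₂) (by linarith)]; ring
      · rw [qR_of_neg (x := p₁ - v₄) (by linarith)]; ring
    · intro x
      by_contra hx
      simp only [mul_ne_zero_iff] at hx
      have a1 := cutAbove_ne_zero hx.1.1.1
      have a2 := cutBelow_ne_zero hx.1.1.2
      have a3 := cutAbove_ne_zero hx.1.2
      have a4 := cutBelow_ne_zero hx.2
      rcases hz with hz | hz | hz <;> linarith
  simp only [not_or, not_lt] at hz
  obtain ⟨z1, z2, z3⟩ := hz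
  obtain ⟨N, hN⟩ := Int.eq_ofNat_of_zero_le (a := P₁ - V₂) (by
    rw [← @Int.cast_le ℚ]; push_cast; linarith)
  obtain ⟨V, hV⟩ := Int.eq_ofNat_of_zero_le (a := 2 * V₂ + W) (by
    rw [← @Int.cast_le ℚ]; push_cast; linarith)
  have hN' : (P₁ - V₂ : ℚ) = N := by exact_mod_cast hN
  have hV' : (2 * V₂ + W : ℚ) = V := by exact_mod_cast hV
  have hA : 0 ≤ P₃ - V₂ := by rw [← @Int.cast_le ℚ]; push_cast; linarith
  have hVB : 0 ≤ (V : ℤ) + (V₄ - V₂) := by rw [← @Int.cast_le ℚ]; push_cast; linarith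
  have hNB : V₄ - V₂ ≤ N := by rw [← @Int.cast_le ℚ]; push_cast; linarith
  have hVM : V + 2 * N ≤ M := by rw [← @Nat.cast_le ℚ]; push_cast; linarith
  rw [latticeSum_eq_sum (V := V) (N := N) (v := v₂) (by linarith) ⟨V₂, hv₂⟩ hVM]
  · have := dougall_two_two hq V (P₃ - V₂) (V₄ - V₂) N (by omega) hVB hNB hA
    rw [qF_eq_qFac (V + (V₄ - V₂)) (by push_cast; linarith),
      qF_eq_qFac (N + (P₃ - V₂) - (V₄ - V₂)) (by push_cast; linarith),
      qR_eq_qInv (V + N + (P₃ - V₂) + 1) (by push_cast; linarith),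
      qR_eq_qInv (N : ℤ) (by push_cast; linarith),
      qR_eq_qInv (N - (V₄ - V₂)) (by push_cast; linarith),
      qR_eq_qInv (P₃ - V₂) (by push_cast; linarith),
      qR_eq_qInv (P₃ - V₂ - (V₄ - V₂)) (by push_cast; linarith), ← this]
    refine sum_congr rfl fun k _ => ?_
    rw [cutAbove, cutBelow, cutAbove, cutBelow,
      qR_eq_qInv (N - k) (by push_cast; linarith),
      qR_eq_qInv (V + N + k + 1) (by push_cast; linarith),
      qF_eq_qFac (V + k) (by push_cast; linarith),
      qR_eq_qInv k (by push_cast; linarith),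
      qR_eq_qInv (P₃ - V₂ - k) (by push_cast; linarith),
      qR_eq_qInv (V + (P₃ - V₂) + k + 1) (by push_cast; linarith),
      qF_eq_qFac (V + (V₄ - V₂) + k) (by push_cast; linarith),
      qR_eq_qInv (k - (V₄ - V₂)) (by push_cast; linarith)]
  · intro x hx
    simp only [mul_ne_zero_iff] at hx
    have a1 := cutAbove_ne_zero hx.1.1.1
    have a2 := cutBelow_ne_zero hx.1.1.2
    exact ⟨a2, by linarith⟩

/-- Only the sum `v₂ + v₄` is assumed non-negative. One of the two is then non-negative and can be
taken as the starting point of the sum, by symmetry of the formula. -/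
theorem latticeSum_two_two (hq : 0 < q) {w p₁ p₃ v₂ v₄ : ℚ} {M : ℕ} {W P₁ P₃ V₂ V₄ : ℤ}
    (hW : 2 * w = W) (hp₁ : p₁ - w = P₁) (hp₃ : p₃ - w = P₃) (hv₂ : v₂ - w = V₂)
    (hv₄ : v₄ - w = V₄) (hM : 2 * p₁ ≤ M) (h : 0 ≤ v₂ + v₄) :
    latticeSum q w M (fun x => cutAbove q p₁ x * cutBelow q v₂ x * cutAbove q p₃ x *
      cutBelow q v₄ x) =
    qF q (v₂ + v₄) * qF q (p₁ + p₃ - v₂ - v₄) * (qR q (p₁ + p₃ + 1) * qR q (p₁ - v₂) *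
      qR q (p₁ - v₄) * qR q (p₃ - v₂) * qR q (p₃ - v₄)) := by
  rcases le_or_gt 0 v₂ with h0 | h0
  · exact latticeSum_two_two_of_nonneg hq hW hp₁ hp₃ hv₂ hv₄ hM h h0
  · have := latticeSum_two_two_of_nonneg hq hW hp₁ hp₃ hv₄ hv₂ hM (by linarith) (by linarith)
    rw [show p₁ + p₃ - v₄ - v₂ = p₁ + p₃ - v₂ - v₄ by ring, add_comm v₄] at this
    convert this using 1
    · congr 1; ext x; ring
    · ring

lemma latticeSum_one_three_of_nonneg (hq : 0 < q) {w u p v₁ v₂ v₃ : ℚ} {M : ℕ} {W U P V₁ V₂ V₃ : ℤ}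
    (hW : 2 * w = W) (hu : u - w = U) (hp : p - w = P) (hv₁ : v₁ - w = V₁) (hv₂ : v₂ - w = V₂)
    (hv₃ : v₃ - w = V₃) (hM : 2 * p ≤ M) (h12 : 0 ≤ v₁ + v₂) (h13 : 0 ≤ v₁ + v₃)
    (h23 : 0 ≤ v₂ + v₃) (h0 : 0 ≤ v₁) :
    latticeSum q w M (fun x => sgn (u - x) * (cutAbove q p x * cutBelow q v₁ x * cutBelow q v₂ x *
      cutBelow q v₃ x)) =
    sgn (u - p) * (qF q (v₁ + v₂) * qF q (v₁ + v₃) * qF q (v₂ + v₃) * (qR q (p - v₁) *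
      qR q (p - v₂) * qR q (p - v₃) * qR q (v₁ + v₂ + v₃ - p))) := by
  by_cases hz : p < v₁ ∨ p < v₂ ∨ p < v₃
  · rw [latticeSum_eq_zero]
    · rcases hz with hz | hz | hz
      · rw [qR_of_neg (x := p - v₁) (by linarith)]; ring
      · rw [qR_of_neg (x := p - v₂) (by linarith)]; ring
      · rw [qR_of_neg (x := p - v₃) (by linarith)]; ring
    · intro x
      by_contra hx
      simp only [mul_ne_zero_iff] at hx
      have a1 := cutAbove_ne_zero hx.2.1.1.1
      have a2 := cutBelow_ne_zero hx.2.1.1.2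
      have a3 := cutBelow_ne_zero hx.2.1.2
      have a4 := cutBelow_ne_zero hx.2.2
      rcases hz with hz | hz | hz <;> linarith
  simp only [not_or, not_lt] at hz
  obtain ⟨z1, z2, z3⟩ := hz
  obtain ⟨N, hN⟩ := Int.eq_ofNat_of_zero_le (a := P - V₁) (by
    rw [← @Int.cast_le ℚ]; push_cast; linarith)
  obtain ⟨V, hV⟩ := Int.eq_ofNat_of_zero_le (a := 2 * V₁ + W) (by
    rw [← @Int.cast_le ℚ]; push_cast; linarith)
  have hN' : (P - V₁ : ℚ) = N := by exact_mod_cast hN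
  have hV' : (2 * V₁ + W : ℚ) = V := by exact_mod_cast hV
  have hVA : 0 ≤ (V : ℤ) + (V₂ - V₁) := by rw [← @Int.cast_le ℚ]; push_cast; linarith
  have hVB : 0 ≤ (V : ℤ) + (V₃ - V₁) := by rw [← @Int.cast_le ℚ]; push_cast; linarith
  have hVAB : 0 ≤ (V : ℤ) + (V₂ - V₁) + (V₃ - V₁) := by
    rw [← @Int.cast_le ℚ]; push_cast; linarith
  have hNA : V₂ - V₁ ≤ N := by rw [← @Int.cast_le ℚ]; push_cast; linarith
  have hNB : V₃ - V₁ ≤ N := by rw [← @Int.cast_le ℚ]; push_cast; linarith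
  have hVM : V + 2 * N ≤ M := by rw [← @Nat.cast_le ℚ]; push_cast; linarith
  rw [latticeSum_eq_sum (V := V) (N := N) (v := v₁) (by linarith) ⟨V₁, hv₁⟩ hVM]
  · have := dougall_one_three hq V (V₂ - V₁) (V₃ - V₁) N (by omega) hVA hVB hVAB hNA hNB
    rw [qF_eq_qFac (V + (V₂ - V₁)) (by push_cast; linarith),
      qF_eq_qFac (V + (V₃ - V₁)) (by push_cast; linarith),
      qF_eq_qFac (V + (V₂ - V₁) + (V₃ - V₁)) (by push_cast; linarith),
      qR_eq_qInv (N : ℤ) (by push_cast; linarith),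
      qR_eq_qInv (N - (V₂ - V₁)) (by push_cast; linarith),
      qR_eq_qInv (N - (V₃ - V₁)) (by push_cast; linarith),
      qR_eq_qInv (V + (V₂ - V₁) + (V₃ - V₁) - N) (by push_cast; linarith), ← this, mul_sum]
    refine sum_congr rfl fun k _ => ?_
    rw [cutAbove, cutBelow, cutBelow, cutBelow, sgn_eq (U - P + (N - k)) (by push_cast; linarith),
      sgn_eq (U - P) (by push_cast; linarith), zpow_add₀ (by norm_num),
      qR_eq_qInv (N - k) (by push_cast; linarith),
      qR_eq_qInv (V + N + k + 1) (by push_cast; linarith),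
      qF_eq_qFac (V + k) (by push_cast; linarith),
      qR_eq_qInv k (by push_cast; linarith),
      qF_eq_qFac (V + (V₂ - V₁) + k) (by push_cast; linarith),
      qR_eq_qInv (k - (V₂ - V₁)) (by push_cast; linarith),
      qF_eq_qFac (V + (V₃ - V₁) + k) (by push_cast; linarith),
      qR_eq_qInv (k - (V₃ - V₁)) (by push_cast; linarith)]
    ring
  · intro x hx
    simp only [mul_ne_zero_iff] at hx
    have a1 := cutAbove_ne_zero hx.2.1.1.1
    have a2 := cutBelow_ne_zero hx.2.1.1.2
    exact ⟨a2, by linarith⟩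

/-- If `v₁ < 0`, then `v₂ ≥ -v₁ > 0` can be the starting point instead. The pairwise sums of the
`vᵢ` are the arguments of the numerator factorials, hence the source of the conditions for (B)-(D).
-/
theorem latticeSum_one_three (hq : 0 < q) {w u p v₁ v₂ v₃ : ℚ} {M : ℕ} {W U P V₁ V₂ V₃ : ℤ}
    (hW : 2 * w = W) (hu : u - w = U) (hp : p - w = P) (hv₁ : v₁ - w = V₁) (hv₂ : v₂ - w = V₂)
    (hv₃ : v₃ - w = V₃) (hM : 2 * p ≤ M) (h12 : 0 ≤ v₁ + v₂) (h13 : 0 ≤ v₁ + v₃)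
    (h23 : 0 ≤ v₂ + v₃) :
    latticeSum q w M (fun x => sgn (u - x) * (cutAbove q p x * cutBelow q v₁ x * cutBelow q v₂ x *
      cutBelow q v₃ x)) =
    sgn (u - p) * (qF q (v₁ + v₂) * qF q (v₁ + v₃) * qF q (v₂ + v₃) * (qR q (p - v₁) *
      qR q (p - v₂) * qR q (p - v₃) * qR q (v₁ + v₂ + v₃ - p))) := by
  rcases le_or_gt 0 v₁ with h0 | h0
  · exact latticeSum_one_three_of_nonneg hq hW hu hp hv₁ hv₂ hv₃ hM h12 h13 h23 h0
  · have := latticeSum_one_three_of_nonneg hq hW hu hp hv₂ hv₁ hv₃ hM (by linarith) h23 h13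
      (by linarith)
    rw [add_comm v₂ v₁] at this
    convert this using 1
    · congr 1; ext x; ring
    · ring

/-! ### Rearrangements and symmetry of the `12j` coefficient. -/

lemma sixj_swap_rows_right (a b e d c f : ℚ) : sixj q a b e d c f = sixj q a c f d b e := by
  rw [sixj_swap_columns_left, sixj_swap_columns_right, sixj_swap_rows, sixj_swap_columns_right,
    sixj_swap_columns_left]

lemma sixj_swap_rows_outer (a b e d c f : ℚ) : sixj q a b e d c f = sixj q d b f a c e := by
  rw [sixj_swap_rows, sixj_swap_rows_right]

lemma spinSum_eq_sum_of_le {m : ℚ} {M : ℕ} {f : ℚ → ℝ} (hM : 2 * m ≤ M)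
    (hf : ∀ x, m < x → f x = 0) :
    spinSum q m f = ∑ n ∈ range (M + 1), qnum q ((n : ℚ) + 1) * f ((n : ℚ) / 2) := by
  refine sum_subset (range_subset_range.2 (Nat.succ_le_succ (Nat.floor_le_of_le hM)))
    fun n _ hn => ?_
  have := Nat.lt_of_floor_lt (not_lt.1 (fun h => hn (mem_range.2 h)) : ⌊2 * m⌋₊ < n)
  rw [hf _ (by linarith), mul_zero]

lemma Triangle.le {a b c : ℚ} (h : Triangle a b c) : c ≤ a + b := by
  obtain ⟨⟨n, hn⟩, _, _⟩ := h
  have := Nat.cast_nonneg (α := ℚ) n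
  linarith

lemma sixj_eq_zero_of_lt {a b e d c f : ℚ} (h : a + c < f ∨ d + b < f) :
    sixj q a b e d c f = 0 := by
  refine sixj_eq_zero _ _ _ _ _ _ fun ⟨_, h2, h3, _⟩ => ?_
  rcases h with h | h
  · exact absurd h2.le (not_le.2 h)
  · exact absurd h3.le (not_le.2 h)

lemma q12j_eq_spinSum (j1 j2 j3 j4 l1 l2 l3 l4 k1 k2 k3 k4 : ℚ) :
    q12j q ⟨j1, j2, j3, j4, l1, l2, l3, l4, k1, k2, k3, k4⟩ =
      sgn (l1 - l2 - l3 + l4) * spinSum q (k1 + k2) fun x =>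
        sixj q k1 j1 l1 j3 k2 x * sixj q k3 j1 l2 j3 k4 x * sixj q k3 j2 l4 j4 k4 x *
          sixj q k1 j2 l3 j4 k2 x := by
  rw [q12j]
  congr 2; ext x
  rw [sixj_swap_rows_right k3 k4, sixj_swap_rows_right k1 k2]

theorem q12j_eq_expansionB (s : Spins) : q12j q s = expansionB q s := by
  obtain ⟨j1, j2, j3, j4, l1, l2, l3, l4, k1, k2, k3, k4⟩ := s
  rw [q12j, expansionB]
  congr 2; ext x
  rw [sixj_swap_rows k3 k4 x j3, sixj_swap_columns_right j3 j1, sixj_swap_rows_right k3 j2,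
    sixj_swap_columns_right k1 k2]

theorem q12j_eq_expansionC (s : Spins) : q12j q s = expansionC q s := by
  obtain ⟨j1, j2, j3, j4, l1, l2, l3, l4, k1, k2, k3, k4⟩ := s
  rw [q12j, expansionC]
  congr 2; ext x
  rw [sixj_swap_rows_outer k3 j2, sixj_swap_columns_right j4 j2, sixj_swap_columns_right k1 k2]

theorem q12j_eq_expansionD (s : Spins) : q12j q s = expansionD q s := by
  obtain ⟨j1, j2, j3, j4, l1, l2, l3, l4, k1, k2, k3, k4⟩ := s
  rw [q12j, expansionD]
  congr 2; ext x
  rw [sixj_swap_rows_outer k1 j1, sixj_swap_columns_right j3 j1, sixj_swap_columns_right k3 k4,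
    sixj_swap_rows_outer k3 j2, sixj_swap_columns_right j4 j2, sixj_swap_rows_right k1 k2,
    sixj_swap_columns_left k1 j2, sixj_swap_columns_right j2 k1, sixj_swap_columns_left j2 l3]

/-- The substitution exchanges the second and fourth `6j` factors and swaps the rows of all four. -/
theorem q12j_flip (s : Spins) : q12j q s.flip = q12j q s := by
  obtain ⟨j1, j2, j3, j4, l1, l2, l3, l4, k1, k2, k3, k4⟩ := s
  rw [Spins.flip, q12j_eq_spinSum, q12j_eq_spinSum]
  -- The upper limit of the sum over `x` changes under the substitution, so both sums are extended
  -- to a common limit, with zero terms.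
  obtain ⟨M, hM⟩ := exists_nat_ge (max (2 * (k1 + k2)) (2 * (j3 + j1)))
  rw [spinSum_eq_sum_of_le ((le_max_left _ _).trans hM),
    spinSum_eq_sum_of_le ((le_max_right _ _).trans hM)]
  · congr 1
    · congr 1; ring
    · refine sum_congr rfl fun n _ => ?_
      rw [sixj_swap_rows k1 j1, sixj_swap_rows k3 j1, sixj_swap_rows k3 j2, sixj_swap_rows k1 j2]
      ring
  · intro x hx
    rw [sixj_eq_zero_of_lt (Or.inl hx)]; ring
  · intro x hx
    rw [sixj_eq_zero_of_lt (Or.inl hx)]; ring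

/-! ### Interchange of the sum over `x` with the expansions of the `6j` coefficients. -/

lemma triangle_of_le {a c x : ℚ} {A C m : ℤ} (hA : 2 * a = A) (hC : 2 * c = C)
    (hm : a + c - x = m) (h : a - c ≤ x ∧ c - a ≤ x ∧ x ≤ a + c) : Triangle a c x := by
  obtain ⟨h1, h2, h3⟩ := h
  obtain ⟨n, hn⟩ := Int.eq_ofNat_of_zero_le (a := m) (by
    rw [← @Int.cast_le ℚ]; push_cast; linarith)
  obtain ⟨n', hn'⟩ := Int.eq_ofNat_of_zero_le (a := A - m) (by
    rw [← @Int.cast_le ℚ]; push_cast; linarith)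
  obtain ⟨n'', hn''⟩ := Int.eq_ofNat_of_zero_le (a := C - m) (by
    rw [← @Int.cast_le ℚ]; push_cast; linarith)
  have hn : (m : ℚ) = n := by exact_mod_cast hn
  have hn' : (A - m : ℚ) = n' := by exact_mod_cast hn'
  have hn'' : (C - m : ℚ) = n'' := by exact_mod_cast hn''
  exact ⟨⟨n, by linarith⟩, ⟨n', by linarith⟩, ⟨n'', by linarith⟩⟩

/-- The summation over `x` in the definition of a `12j` coefficient is performed termwise for
expansions of the four `6j` coefficients whose product vanishes where a triangle condition
fails. -/
theorem q12j_eq_sum_latticeSum {j1 j2 j3 j4 l1 l2 l3 l4 k1 k2 k3 k4 : ℚ}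
    (hs : Admissible ⟨j1, j2, j3, j4, l1, l2, l3, l4, k1, k2, k3, k4⟩) (b : Fin 4 → ℕ)
    (g : Fin 4 → ℕ → ℚ → ℝ) (C : ℝ) (ε : ℚ → ℝ) (M : ℕ) (hM : 2 * (k1 + k2) ≤ M)
    (h1 : ∀ x, Triangle k1 k2 x → Triangle j3 j1 x → Triangle k3 k4 x → Triangle j4 j2 x →
      sixj q k1 j1 l1 j3 k2 x * sixj q k3 j1 l2 j3 k4 x * sixj q k3 j2 l4 j4 k4 x *
        sixj q k1 j2 l3 j4 k2 x = C * (ε x * ∏ i, ∑ z ∈ range (b i + 1), g i z x))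
    (h0 : ∀ x, 0 ≤ x → ∀ m : ℤ, k1 + k2 - x = m →
      (∀ i, ∑ z ∈ range (b i + 1), g i z x ≠ 0) →
      (k1 - k2 ≤ x ∧ k2 - k1 ≤ x ∧ x ≤ k1 + k2) ∧ (j3 - j1 ≤ x ∧ j1 - j3 ≤ x ∧ x ≤ j3 + j1) ∧
      (k3 - k4 ≤ x ∧ k4 - k3 ≤ x ∧ x ≤ k3 + k4) ∧ (j4 - j2 ≤ x ∧ j2 - j4 ≤ x ∧ x ≤ j4 + j2)) :
    q12j q ⟨j1, j2, j3, j4, l1, l2, l3, l4, k1, k2, k3, k4⟩ = sgn (l1 - l2 - l3 + l4) * C *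
      ∑ z ∈ sumBox b, latticeSum q (k1 + k2) M fun x => ε x * ∏ i, g i (z i) x := by
  rw [q12j_eq_spinSum, spinSum_eq_sum_of_le hM, mul_assoc, mul_sum (sumBox b)]
  · congr 1
    simp only [latticeSum]
    rw [← mul_sum, sum_comm, mul_sum]
    refine sum_congr rfl fun n _ => ?_
    rw [sum_ite_irrel]
    split_ifs with hn
    -- At fixed `x`, the sum of the products over the box is the product of the four expansions.
    · rw [← mul_sum, ← mul_sum, sumBox,
        ← prod_univ_sum (t := fun i => range (b i + 1)) (f := fun i z => g i z ((n : ℚ) / 2))]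
      obtain ⟨m, hm⟩ := hn
      by_cases hz : ∀ i, ∑ z ∈ range (b i + 1), g i z ((n : ℚ) / 2) ≠ 0
      · obtain ⟨i1, i2, i3, i4⟩ := h0 _ (by positivity) (-m) (by push_cast; linarith) hz
        obtain ⟨⟨⟨a1, ha1⟩, ⟨a2, ha2⟩, ⟨a3, ha3⟩⟩, ⟨⟨b1, hb1⟩, ⟨b2, hb2⟩, ⟨b3, hb3⟩⟩,
          ⟨⟨c1, hc1⟩, ⟨c2, hc2⟩, ⟨c3, hc3⟩⟩, ⟨⟨d1, hd1⟩, ⟨d2, hd2⟩, ⟨d3, hd3⟩⟩,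
          ⟨⟨e1, he1⟩, ⟨e2, he2⟩, ⟨e3, he3⟩⟩, ⟨⟨f1, hf1⟩, ⟨f2, hf2⟩, ⟨f3, hf3⟩⟩, -, -⟩ := hs
        rw [h1 _ (triangle_of_le (A := a1 + a2) (C := b1 + b3) (m := -m) (by push_cast; linarith)
            (by push_cast; linarith) (by push_cast; linarith) i1)
          (triangle_of_le (A := b1 + b2) (C := a1 + a3) (m := b2 - a2 - m)
            (by push_cast; linarith)
            (by push_cast; linarith) (by push_cast; linarith) i2)
          (triangle_of_le (A := c1 + c2) (C := d1 + d3)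
            (m := b2 - a2 + d3 - c3 - m)
            (by push_cast; linarith)
            (by push_cast; linarith) (by push_cast; linarith) i3)
          (triangle_of_le (A := f1 + f2) (C := e1 + e3)
            (m := f2 - e2 - m)
            (by push_cast; linarith)
            (by push_cast; linarith) (by push_cast; linarith) i4)]
        ring
      · obtain ⟨i, hi⟩ := not_forall_not.1 hz
        have hp : ∏ i, ∑ z ∈ range (b i + 1), g i z ((n : ℚ) / 2) = 0 :=
          prod_eq_zero (mem_univ i) hi
        rw [hp]
        -- One expansion vanishes, so the product of the `6j` coefficients must be shown to vanish:
        -- by `h1` where the triangle conditions hold, and by definition of the `6j` coefficient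
        -- elsewhere.
        by_cases ht : Triangle k1 k2 ((n : ℚ) / 2) ∧ Triangle j3 j1 ((n : ℚ) / 2) ∧
            Triangle k3 k4 ((n : ℚ) / 2) ∧ Triangle j4 j2 ((n : ℚ) / 2)
        · rw [h1 _ ht.1 ht.2.1 ht.2.2.1 ht.2.2.2, hp]; ring
        · have : sixj q k1 j1 l1 j3 k2 ((n : ℚ) / 2) * sixj q k3 j1 l2 j3 k4 ((n : ℚ) / 2) *
              sixj q k3 j2 l4 j4 k4 ((n : ℚ) / 2) * sixj q k1 j2 l3 j4 k2 ((n : ℚ) / 2) = 0 := by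
            by_contra h
            simp only [mul_ne_zero_iff] at h
            have e1 := not_not.1 (mt (sixj_eq_zero _ _ _ _ _ _) h.1.1.1)
            have e2 := not_not.1 (mt (sixj_eq_zero _ _ _ _ _ _) h.1.1.2)
            have e4 := not_not.1 (mt (sixj_eq_zero _ _ _ _ _ _) h.2)
            exact ht ⟨e1.2.1, e1.2.2.1, e2.2.1, e4.2.2.1⟩
          rw [this]; ring
    -- Outside the class of `k1 + k2` modulo integers the first `6j` coefficient vanishes. The
    -- expansions must not be evaluated there, since `qF` would take floors of non-integral
    -- arguments.
    · rw [sum_const_zero, mul_zero, sixj_eq_zero k1 j1 l1 j3 k2, zero_mul, zero_mul, zero_mul,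
        mul_zero]
      rintro ⟨-, ⟨⟨m, hm⟩, -, -⟩, -, -⟩
      exact hn ⟨-m, by push_cast; linarith⟩
  · intro x hx
    rw [sixj_eq_zero_of_lt (Or.inl hx)]; ring

lemma le_of_mem_sumBox {b : Fin 4 → ℕ} {z : Fin 4 → ℕ} (hz : z ∈ sumBox b) (i : Fin 4) :
    z i ≤ b i := by
  rw [sumBox, Fintype.mem_piFinset] at hz
  exact Nat.lt_succ_iff.1 (mem_range.1 (hz i))

lemma cast_le_of_le_floor_min {n : ℕ} {x y : ℚ} (h : n ≤ ⌊min x y⌋₊) (hx : 0 ≤ x) (hy : 0 ≤ y) :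
    (n : ℚ) ≤ x ∧ (n : ℚ) ≤ y := by
  rw [Nat.le_floor_iff (le_min hx hy)] at h
  exact le_min_iff.1 h

/-- Admissible parameters are expressed by integers. -/
lemma Admissible.exists_int {j1 j2 j3 j4 l1 l2 l3 l4 k1 k2 k3 k4 : ℚ}
    (hs : Admissible ⟨j1, j2, j3, j4, l1, l2, l3, l4, k1, k2, k3, k4⟩) :
    ∃ p r s u v a b c d e f g : ℤ, k1 = p / 2 ∧ j1 = r / 2 ∧ k2 = s / 2 ∧ k3 = u / 2 ∧ j2 = v / 2 ∧
      l1 = (p + r) / 2 - a ∧ j3 = (p + r + s) / 2 - b ∧ l2 = (u + r) / 2 - c ∧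
      k4 = (p + s + u) / 2 - d ∧ l3 = (p + v) / 2 - e ∧ j4 = (p + s + v) / 2 - f ∧
      l4 = (u + v) / 2 - g := by
  obtain ⟨⟨⟨a1, ha1⟩, ⟨a2, ha2⟩, ⟨a3, ha3⟩⟩, ⟨⟨b1, hb1⟩, ⟨b2, hb2⟩, ⟨b3, hb3⟩⟩,
    ⟨⟨c1, hc1⟩, ⟨c2, hc2⟩, ⟨c3, hc3⟩⟩, ⟨⟨d1, hd1⟩, ⟨d2, hd2⟩, ⟨d3, hd3⟩⟩,
    ⟨⟨e1, he1⟩, ⟨e2, he2⟩, ⟨e3, he3⟩⟩, ⟨⟨f1, hf1⟩, ⟨f2, hf2⟩, ⟨f3, hf3⟩⟩,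
    ⟨⟨g1, hg1⟩, ⟨g2, hg2⟩, ⟨g3, hg3⟩⟩, -⟩ := hs
  refine ⟨a1 + a2, a1 + a3, b1 + b3, c1 + c2, e1 + e3, a1, a1 + a2 + a3 - b2, c1,
      a2 - b2 + c1 + c2 + c3 - d3, e1, e1 + e2 + e3 - f2, g1, ?_⟩
  refine ⟨?_, ?_, ?_, ?_, ?_, ?_, ?_, ?_, ?_, ?_, ?_, ?_⟩ <;> push_cast <;> linarith

lemma Triangle.nonneg {a b c : ℚ} (h : Triangle a b c) :
    0 ≤ a + b - c ∧ 0 ≤ a - b + c ∧ 0 ≤ b + c - a := by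
  obtain ⟨⟨x, hx⟩, ⟨y, hy⟩, ⟨z, hz⟩⟩ := h
  rw [hx, hy, hz]
  exact ⟨x.cast_nonneg, y.cast_nonneg, z.cast_nonneg⟩

lemma Admissible.nonneg {s : Spins} (h : Admissible s) :
    ((0 ≤ s.k1 + s.j1 - s.l1 ∧ 0 ≤ s.k1 - s.j1 + s.l1 ∧ 0 ≤ s.j1 + s.l1 - s.k1) ∧
      (0 ≤ s.j3 + s.k2 - s.l1 ∧ 0 ≤ s.j3 - s.k2 + s.l1 ∧ 0 ≤ s.k2 + s.l1 - s.j3) ∧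
      (0 ≤ s.k3 + s.j1 - s.l2 ∧ 0 ≤ s.k3 - s.j1 + s.l2 ∧ 0 ≤ s.j1 + s.l2 - s.k3) ∧
      0 ≤ s.j3 + s.k4 - s.l2 ∧ 0 ≤ s.j3 - s.k4 + s.l2 ∧ 0 ≤ s.k4 + s.l2 - s.j3) ∧
    (0 ≤ s.k1 + s.j2 - s.l3 ∧ 0 ≤ s.k1 - s.j2 + s.l3 ∧ 0 ≤ s.j2 + s.l3 - s.k1) ∧
    (0 ≤ s.j4 + s.k2 - s.l3 ∧ 0 ≤ s.j4 - s.k2 + s.l3 ∧ 0 ≤ s.k2 + s.l3 - s.j4) ∧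
    (0 ≤ s.k3 + s.j2 - s.l4 ∧ 0 ≤ s.k3 - s.j2 + s.l4 ∧ 0 ≤ s.j2 + s.l4 - s.k3) ∧
    0 ≤ s.j4 + s.k4 - s.l4 ∧ 0 ≤ s.j4 - s.k4 + s.l4 ∧ 0 ≤ s.k4 + s.l4 - s.j4 := by
  obtain ⟨t1, t2, t3, t4, t5, t6, t7, t8⟩ := h
  exact ⟨⟨t1.nonneg, t2.nonneg, t3.nonneg, t4.nonneg⟩, t5.nonneg, t6.nonneg, t7.nonneg, t8.nonneg⟩

lemma le_of_mem_sumBox_boundA {s : Spins} {z : Fin 4 → ℕ} (hs : Admissible s)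
    (hz : z ∈ sumBox (boundA s)) :
    z 0 ≤ s.l1 + s.k2 - s.j3 ∧ z 0 ≤ s.j1 + s.l1 - s.k1 ∧ z 1 ≤ s.j1 - s.l2 + s.k3 ∧ z 1 ≤ s.j3 +
        s.k4 - s.l2 ∧
    z 2 ≤ s.k4 + s.l4 - s.j4 ∧ z 2 ≤ s.j2 - s.k3 + s.l4 ∧ z 3 ≤ s.k1 +
        s.j2 - s.l3 ∧ z 3 ≤ s.k2 - s.l3 + s.j4 := by
  have h := hs.nonneg
  have h0 := cast_le_of_le_floor_min (le_of_mem_sumBox hz 0) (by linarith) (by linarith)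
  have h1 := cast_le_of_le_floor_min (le_of_mem_sumBox hz 1) (by linarith) (by linarith)
  have h2 := cast_le_of_le_floor_min (le_of_mem_sumBox hz 2) (by linarith) (by linarith)
  have h3 := cast_le_of_le_floor_min (le_of_mem_sumBox hz 3) (by linarith) (by linarith)
  exact ⟨h0.1, h0.2, h1.1, h1.2, h2.1, h2.2, h3⟩

lemma le_of_mem_sumBox_boundB {s : Spins} {z : Fin 4 → ℕ} (hs : Admissible s)
    (hz : z ∈ sumBox (boundB s)) :
    z 0 ≤ s.l1 + s.k2 - s.j3 ∧ z 0 ≤ s.j1 + s.l1 - s.k1 ∧ z 1 ≤ s.l2 + s.j3 - s.k4 ∧ z 1 ≤ s.j1 +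
        s.l2 - s.k3 ∧
    z 2 ≤ s.j4 + s.k4 - s.l4 ∧ z 2 ≤ s.j2 + s.k3 - s.l4 ∧ z 3 ≤ s.k1 - s.j2 + s.l3 ∧ z 3 ≤ s.k2 +
        s.l3 - s.j4 := by
  have h := hs.nonneg
  have h0 := cast_le_of_le_floor_min (le_of_mem_sumBox hz 0) (by linarith) (by linarith)
  have h1 := cast_le_of_le_floor_min (le_of_mem_sumBox hz 1) (by linarith) (by linarith)
  have h2 := cast_le_of_le_floor_min (le_of_mem_sumBox hz 2) (by linarith) (by linarith)
  have h3 := cast_le_of_le_floor_min (le_of_mem_sumBox hz 3) (by linarith) (by linarith)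
  exact ⟨h0.1, h0.2, h1.1, h1.2, h2.1, h2.2, h3⟩

lemma le_of_mem_sumBox_boundC {s : Spins} {z : Fin 4 → ℕ} (hs : Admissible s)
    (hz : z ∈ sumBox (boundC s)) :
    z 0 ≤ s.l1 + s.k2 - s.j3 ∧ z 0 ≤ s.j1 - s.k1 + s.l1 ∧ z 1 ≤ s.j1 - s.l2 + s.k3 ∧ z 1 ≤ s.j3 +
        s.k4 - s.l2 ∧
    z 2 ≤ s.j4 - s.k4 + s.l4 ∧ z 2 ≤ s.j2 - s.k3 + s.l4 ∧ z 3 ≤ s.k1 - s.j2 + s.l3 ∧ z 3 ≤ s.k2 +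
        s.l3 - s.j4 := by
  have h := hs.nonneg
  have h0 := cast_le_of_le_floor_min (le_of_mem_sumBox hz 0) (by linarith) (by linarith)
  have h1 := cast_le_of_le_floor_min (le_of_mem_sumBox hz 1) (by linarith) (by linarith)
  have h2 := cast_le_of_le_floor_min (le_of_mem_sumBox hz 2) (by linarith) (by linarith)
  have h3 := cast_le_of_le_floor_min (le_of_mem_sumBox hz 3) (by linarith) (by linarith)
  exact ⟨h0.1, h0.2, h1.1, h1.2, h2.1, h2.2, h3⟩

lemma le_of_mem_sumBox_boundD {s : Spins} {z : Fin 4 → ℕ} (hs : Admissible s)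
    (hz : z ∈ sumBox (boundD s)) :
    z 0 ≤ s.l1 - s.k2 + s.j3 ∧ z 0 ≤ s.j1 - s.k1 + s.l1 ∧ z 1 ≤ s.k3 +
        s.l2 - s.j1 ∧ z 1 ≤ s.l2 - s.j3 + s.k4 ∧
    z 2 ≤ s.j4 + s.l4 - s.k4 ∧ z 2 ≤ s.j2 - s.k3 + s.l4 ∧ z 3 ≤ s.k1 + s.j2 - s.l3 := by
  have h := hs.nonneg
  have h0 := cast_le_of_le_floor_min (le_of_mem_sumBox hz 0) (by linarith) (by linarith)
  have h1 := cast_le_of_le_floor_min (le_of_mem_sumBox hz 1) (by linarith) (by linarith)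
  have h2 := cast_le_of_le_floor_min (le_of_mem_sumBox hz 2) (by linarith) (by linarith)
  exact ⟨h0.1, h0.2, h1.1, h1.2, h2.1, h2.2,
    (Nat.le_floor_iff (by linarith)).1 (le_of_mem_sumBox hz 3)⟩

lemma latticeSum_const_mul (w : ℚ) (M : ℕ) (c : ℝ) (f : ℚ → ℝ) :
    latticeSum q w M (fun x => c * f x) = c * latticeSum q w M f := by
  rw [latticeSum, latticeSum, mul_sum]
  refine sum_congr rfl fun n _ => ?_
  split_ifs
  · ring
  · ring

/-- The unconditional bounds come from the support of a single non-zero term, the implications from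
cancellation in the alternating sum. The three analogues below have the same structure, except that
`coefTwo` needs only the supports. -/
lemma le_of_sum_coefOne_ne_zero (hq : 0 < q) {a b l d c x : ℚ} (h1 : Triangle a b l)
    (h4 : Triangle d c l) (hx : ∃ k : ℤ, a + c - x = k) {N : ℕ}
    (hN : min (c + l - d) (b + l - a) < N)
    (h : ∑ z ∈ range N, coefOne q a b l d c z * cutAbove q (a + d - l + z) x ≠ 0) :
    x ≤ a + c ∧ x ≤ b + d ∧ (a - c ≤ x → b - d ≤ x) ∧ (d - b ≤ x → c - a ≤ x) := by
  obtain ⟨z, -, hz⟩ := exists_ne_zero_of_sum_ne_zero h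
  have e := cutAbove_ne_zero (right_ne_zero_of_mul hz)
  have hz := left_ne_zero_of_mul hz
  rw [coefOne] at hz
  simp only [mul_ne_zero_iff] at hz
  have e1 := nonneg_of_qR_ne_zero hz.2.1.2
  have e2 := nonneg_of_qR_ne_zero hz.2.2
  refine ⟨by linarith, by linarith, fun h' => ?_, fun h' => ?_⟩
  · by_contra hlt
    exact h (sum_coefOne_eq_zero hq h1 h4 hx (not_le.1 hlt) h' N hN)
  · by_contra hlt
    exact h (sum_coefOne_eq_zero' hq h1 h4 hx (not_le.1 hlt) h' N hN)

lemma le_of_sum_coefTwo_ne_zero {a b l d c x : ℚ} {N : ℕ}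
    (h : ∑ z ∈ range N, coefTwo q a b l d c z * cutBelow q (a + d - l - z) x ≠ 0) :
    d - b ≤ x ∧ a - c ≤ x := by
  obtain ⟨z, -, hz⟩ := exists_ne_zero_of_sum_ne_zero h
  have e := cutBelow_ne_zero (right_ne_zero_of_mul hz)
  have hz := left_ne_zero_of_mul hz
  rw [coefTwo] at hz
  simp only [mul_ne_zero_iff] at hz
  have e1 := nonneg_of_qR_ne_zero hz.2.1.1.2
  have e2 := nonneg_of_qR_ne_zero hz.2.1.2
  exact ⟨by linarith, by linarith⟩

lemma le_of_sum_coefThree_ne_zero (hq : 0 < q) {a b l d c x : ℚ} (h1 : Triangle a b l)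
    (h4 : Triangle d c l) (hx : ∃ k : ℤ, a + c - x = k) {N : ℕ}
    (hN : min (l + d - c) (b + l - a) < N)
    (h : ∑ z ∈ range N, coefThree q a b l d c z * cutBelow q (d - a + l - z) x ≠ 0) :
    c - a ≤ x ∧ d - b ≤ x ∧ (x ≤ b + d → x ≤ a + c) := by
  obtain ⟨z, -, hz⟩ := exists_ne_zero_of_sum_ne_zero h
  have e := cutBelow_ne_zero (right_ne_zero_of_mul hz)
  have hz := left_ne_zero_of_mul hz
  rw [coefThree] at hz
  simp only [mul_ne_zero_iff] at hz
  have e1 := nonneg_of_qR_ne_zero hz.2.1.1.2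
  have e2 := nonneg_of_qR_ne_zero hz.2.1.2
  refine ⟨by linarith, by linarith, fun h' => ?_⟩
  by_contra hlt
  exact h (sum_coefThree_eq_zero hq h1 h4 hx (not_le.1 hlt) h' N hN)

lemma le_of_sum_coefFour_ne_zero (hq : 0 < q) {a b l d c x : ℚ} (h1 : Triangle a b l)
    (h4 : Triangle d c l) (hx : ∃ k : ℤ, a + c - x = k) (hx0 : 0 ≤ x) {N : ℕ} (hN : a + b - l < N)
    (h : ∑ z ∈ range N, coefFour q a b l d c z * cutAbove q (b + d - z) x ≠ 0) :
    x ≤ b + d ∧ (d - b ≤ x → a - c ≤ x) ∧ (c - a ≤ x → b - d ≤ x) := by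
  obtain ⟨z, -, hz⟩ := exists_ne_zero_of_sum_ne_zero h
  have e := cutAbove_ne_zero (right_ne_zero_of_mul hz)
  have hz0 := Nat.cast_nonneg (α := ℚ) z
  have e1 : x ≤ b + d := by linarith
  refine ⟨e1, fun h' => ?_, fun h' => ?_⟩
  · by_contra hlt
    exact h (sum_coefFour_eq_zero hq h1 h4 hx hx0 (not_le.1 hlt) h' e1 N hN)
  · by_contra hlt
    exact h (sum_coefFour_eq_zero' hq h1 h4 hx (not_le.1 hlt) h' N hN)

lemma min_lt_floor_add_one {x y x' y' : ℚ} (hx : x = x') (hy : y = y') :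
    min x y < ((⌊min x' y'⌋₊ + 1 : ℕ) : ℚ) := by
  rw [hx, hy]; push_cast; exact Nat.lt_floor_add_one _

lemma sgn_mul_four {u₁ u₂ u₃ u₄ : ℚ} (h₁ : ∃ m : ℤ, u₁ = m) (h₂ : ∃ m : ℤ, u₂ = m)
    (h₃ : ∃ m : ℤ, u₃ = m) (h₄ : ∃ m : ℤ, u₄ = m) :
    sgn u₁ * sgn u₂ * sgn u₃ * sgn u₄ = sgn (u₁ + u₂ + u₃ + u₄) := by
  obtain ⟨a, ha⟩ := h₁
  obtain ⟨b, hb⟩ := h₂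
  obtain ⟨c, hc⟩ := h₃
  obtain ⟨d, hd⟩ := h₄
  rw [sgn_mul_sgn a b ha hb, sgn_mul_sgn (a + b) c (by push_cast; rw [ha, hb]) hc,
    sgn_mul_sgn (a + b + c) d (by push_cast; rw [ha, hb, hc]) hd]

/-- Bookkeeping for a product of four expansions: `sᵢ` are their signs, `nᵢ` their `∇` quotients,
`Sᵢ` their sums. -/
lemma prod_four_eq {s₁ s₂ s₃ s₄ n₁ n₂ n₃ n₄ S₁ S₂ S₃ S₄ σ ε n : ℝ} (hs : s₁ * s₂ * s₃ * s₄ = σ * ε)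
    (hn : n₁ * n₂ * n₃ * n₄ = n) :
    s₁ * n₁ * S₁ * (s₂ * n₂ * S₂) * (s₃ * n₃ * S₃) * (s₄ * n₄ * S₄) =
      σ * n * (ε * (S₁ * S₂ * S₃ * S₄)) := by
  rw [← hn]; linear_combination (n₁ * n₂ * n₃ * n₄ * (S₁ * S₂ * S₃ * S₄)) * hs

/-! ### Proofs of the four fourfold sums. -/

/-- The expansions alternate between `coefOne` and `coefTwo` around the cycle of the four `6j`
coefficients. Each `∇` with `x` occurs once above and once below, and the two signs with `x` combine
to a sign free of `x`, so the sum over `x` is of type two-two. -/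
theorem q12j_eq_formulaA (hq : 0 < q) (s : Spins) (hs : Admissible s) (hd : DefinedA s) :
    q12j q s = formulaA q s := by
  obtain ⟨j1, j2, j3, j4, l1, l2, l3, l4, k1, k2, k3, k4⟩ := s
  obtain ⟨M, hM⟩ := exists_nat_ge (max (2 * (k1 + k2)) (2 * (j1 + j3)))
  obtain ⟨hM1, hM2⟩ := max_le_iff.1 hM
  obtain ⟨t1, t2, t3, t4, t5, t6, t7, t8⟩ := id hs
  obtain ⟨p, r, s, u, v, a, b, c, d, e, f, g, e1, e2, e3, e4, e5, e6, e7, e8, e9, e10, e11, e12⟩ :=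
    hs.exists_int
  have hN0 : min (k2 + l1 - j3) (j1 + l1 - k1) <
      ((boundA ⟨j1, j2, j3, j4, l1, l2, l3, l4, k1, k2, k3, k4⟩ 0 +
      1 : ℕ) : ℚ) := min_lt_floor_add_one (by ring) rfl
  have hN1 : min (k3 + j1 - l2) (k4 + j3 - l2) <
      ((boundA ⟨j1, j2, j3, j4, l1, l2, l3, l4, k1, k2, k3, k4⟩ 1 +
      1 : ℕ) : ℚ) := min_lt_floor_add_one (by ring) (by ring)
  have hN2 : min (k4 + l4 - j4) (j2 + l4 - k3) <
      ((boundA ⟨j1, j2, j3, j4, l1, l2, l3, l4, k1, k2, k3, k4⟩ 2 +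
      1 : ℕ) : ℚ) := min_lt_floor_add_one rfl (by ring)
  have hN3 : min (k1 + j2 - l3) (k2 + j4 - l3) <
      ((boundA ⟨j1, j2, j3, j4, l1, l2, l3, l4, k1, k2, k3, k4⟩ 3 +
      1 : ℕ) : ℚ) := min_lt_floor_add_one rfl (by ring)
  rw [q12j_eq_sum_latticeSum hs (boundA ⟨j1, j2, j3, j4, l1, l2, l3, l4, k1, k2, k3, k4⟩)
    ![fun z x => coefOne q k1 j1 l1 j3 k2 z * cutAbove q (k1 + j3 - l1 + z) x,
      fun z x => coefTwo q k3 j1 l2 j3 k4 z * cutBelow q (k3 + j3 - l2 - z) x,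
      fun z x => coefOne q k3 j2 l4 j4 k4 z * cutAbove q (k3 + j4 - l4 + z) x,
      fun z x => coefTwo q k1 j2 l3 j4 k2 z * cutBelow q (k1 + j4 - l3 - z) x]
    (sgn (l2 - l3 + k1 - k3 - j3 + j4 - (l1 - l2 - l3 + l4)) *
      ((nabla q k3 j1 l2 * nabla q j3 k4 l2 * nabla q k1 j2 l3 * nabla q j4 k2 l3) /
        (nabla q k1 j1 l1 * nabla q j3 k2 l1 * nabla q k3 j2 l4 * nabla q j4 k4 l4)))
    (fun _ => 1) M hM1,
    formulaA, prefactorA, mul_sum, mul_sum]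
  · refine sum_congr rfl fun z hz => ?_
    have hz0 := le_of_mem_sumBox_boundA hs hz
    dsimp only at hz0
    -- `v₂ + v₄` is the quantity that `DefinedA` requires to be non-negative, and `p₁ ≤ k1 + k2`
    -- holds because `z 0 ≤ l1 + k2 - j3`.
    have hl := latticeSum_two_two hq (w := k1 + k2) (M := M) (p₁ := k1 + j3 - l1 + z 0)
      (v₂ := k3 + j3 - l2 - z 1) (p₃ := k3 + j4 - l4 + z 2) (v₄ := k1 + j4 - l3 - z 3)
      (W := p + s) (P₁ := a - b + z 0) (V₂ := -b + c - z 1)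
      (P₃ := -f + g + z 2) (V₄ := e - f - z 3)
      (by push_cast; linarith) (by push_cast; linarith) (by push_cast; linarith)
      (by push_cast; linarith) (by push_cast; linarith) (by linarith) (by linarith [hd z hz])
    rw [show (fun x => _) = fun x => (coefOne q k1 j1 l1 j3 k2 (z 0) * coefTwo q k3 j1 l2 j3 k4
        (z 1) * coefOne q k3 j2 l4 j4 k4 (z 2) * coefTwo q k1 j2 l3 j4 k2 (z 3)) *
      (cutAbove q (k1 + j3 - l1 + z 0) x * cutBelow q (k3 + j3 - l2 - z 1) x * cutAbove q
          (k3 + j4 - l4 + z 2) x * cutBelow q (k1 + j4 - l3 - z 3) x) from by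
        ext x; simp only [Fin.prod_univ_four, Matrix.cons_val]; ring, latticeSum_const_mul, hl,
      ← mul_assoc (sgn _) (sgn _), sgn_mul_sgn (-a + c + e - g) (a + b - 2 * c - f + g)
        (by push_cast; linarith) (by push_cast; linarith),
      show l1 - l2 - l3 + l4 + (l2 - l3 + k1 - k3 - j3 + j4 - (l1 - l2 - l3 + l4)) = l2 - l3 +
          k1 - k3 - j3 + j4 by ring]
    refine congrArg _ ?_
    simp only [summandA, coefOne, coefTwo]
    ring_nf
  · intro x x1 x2 x3 x4
    obtain ⟨⟨n, hn⟩, -, -⟩ := id x1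
    rw [sixj_eq_coefOne hq t1 x1 x2 t2 _ hN0,
      sixj_eq_coefTwo hq t3 x3 x2 t4 _ hN1,
      sixj_eq_coefOne hq t7 x3 x4 t8 _ hN2,
      sixj_eq_coefTwo hq t5 x1 x4 t6 _ hN3]
    have hsg : sgn (j1 + k2 + l1 + x) * sgn (k3 + j1 + k4 + j3) * sgn (j2 + k4 + l4 + x) * sgn
        (k1 + j2 + k2 + j4) =
        sgn (l2 - l3 + k1 - k3 - j3 + j4 - (l1 - l2 - l3 + l4)) := by
      rw [sgn_mul_four ⟨-a - n + p + r + s, by push_cast; linarith⟩ ⟨-b - d + p + r + s +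
          u, by push_cast; linarith⟩ ⟨-d - g - n + p + s + u + v, by push_cast; linarith⟩ ⟨-f + p +
          s + v, by push_cast; linarith⟩]
      exact sgn_congr (-a - b + c - d - g - n + 2 * p + r + 2 * s + u + v) (by push_cast; linarith)
    simp only [Fin.prod_univ_four, Matrix.cons_val]
    have hn : ∀ a b c, nabla q a b c ≠ 0 := fun a b c => (nabla_pos hq a b c).ne'
    refine prod_four_eq (hsg.trans (mul_one _).symm) ?_
    field_simp [hn]
  · intro x hx m hm h
    obtain ⟨i1, i2, i3, i4⟩ := And.intro (h 0) (And.intro (h 1) (And.intro (h 2) (h 3)))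
    simp only [Matrix.cons_val] at i1 i2 i3 i4
    have i1 := le_of_sum_coefOne_ne_zero hq t1 t2 ⟨m, by linarith⟩ hN0 i1
    have i2 := le_of_sum_coefTwo_ne_zero i2
    have i3 := le_of_sum_coefOne_ne_zero hq t7 t8 ⟨-d + m + u, by push_cast; linarith⟩ hN2 i3
    have i4 := le_of_sum_coefTwo_ne_zero i4
    -- `coefTwo` gives `j3 - j1`, `k3 - k4`, `j4 - j2`, `k1 - k2 ≤ x` outright. These are the
    -- premises of the implications from `coefOne`, which give the four opposite bounds; the upper
    -- bounds come from the support of `cutAbove`.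
    grind

/-- With `coefOne`, `coefThree`, `coefTwo`, `coefThree` the `∇` factors with `x` cancel again, but
three signs depend on `x`. The sum over `x` is alternating, of type one-three. -/
theorem q12j_eq_formulaB (hq : 0 < q) (s : Spins) (hs : Admissible s) (hd : DefinedB s) :
    q12j q s = formulaB q s := by
  obtain ⟨j1, j2, j3, j4, l1, l2, l3, l4, k1, k2, k3, k4⟩ := s
  obtain ⟨M, hM⟩ := exists_nat_ge (max (2 * (k1 + k2)) (2 * (j1 + j3)))
  obtain ⟨hM1, hM2⟩ := max_le_iff.1 hM
  obtain ⟨t1, t2, t3, t4, t5, t6, t7, t8⟩ := id hs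
  obtain ⟨p, r, s, u, v, a, b, c, d, e, f, g, e1, e2, e3, e4, e5, e6, e7, e8, e9, e10, e11, e12⟩ :=
    hs.exists_int
  have hN0 : min (k2 + l1 - j3) (j1 + l1 - k1) <
      ((boundB ⟨j1, j2, j3, j4, l1, l2, l3, l4, k1, k2, k3, k4⟩ 0 +
      1 : ℕ) : ℚ) := min_lt_floor_add_one (by ring) rfl
  have hN1 : min (l2 + j3 - k4) (j1 + l2 - k3) <
      ((boundB ⟨j1, j2, j3, j4, l1, l2, l3, l4, k1, k2, k3, k4⟩ 1 +
      1 : ℕ) : ℚ) := min_lt_floor_add_one rfl rfl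
  have hN2 : min (k3 + j2 - l4) (k4 + j4 - l4) <
      ((boundB ⟨j1, j2, j3, j4, l1, l2, l3, l4, k1, k2, k3, k4⟩ 2 + 1 : ℕ) : ℚ) := by
    rw [min_comm]; exact min_lt_floor_add_one (by ring) (by ring)
  have hN3 : min (l3 + k1 - j2) (k2 + l3 - j4) <
      ((boundB ⟨j1, j2, j3, j4, l1, l2, l3, l4, k1, k2, k3, k4⟩ 3 +
      1 : ℕ) : ℚ) := min_lt_floor_add_one (by ring) rfl
  rw [q12j_eq_sum_latticeSum hs (boundB ⟨j1, j2, j3, j4, l1, l2, l3, l4, k1, k2, k3, k4⟩)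
    ![fun z x => coefOne q k1 j1 l1 j3 k2 z * cutAbove q (k1 + j3 - l1 + z) x,
      fun z x => coefThree q k3 j1 l2 j3 k4 z * cutBelow q (j3 - k3 + l2 - z) x,
      fun z x => coefTwo q k3 j2 l4 j4 k4 z * cutBelow q (k3 + j4 - l4 - z) x,
      fun z x => coefThree q j4 k2 l3 k1 j2 z * cutBelow q (k1 - j4 + l3 - z) x]
    (sgn (j1 - j3 - k1 + k2 - l1 - l2 - l3 + l4 - (l1 - l2 - l3 + l4)) *
      ((nabla q j3 k4 l2 * nabla q k3 j2 l4 * nabla q k1 j2 l3 * nabla q j4 k4 l4) /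
        (nabla q k1 j1 l1 * nabla q j3 k2 l1 * nabla q k3 j1 l2 * nabla q j4 k2 l3)))
    -- Normalized at `k1 + j3 - l1 = p - z 0`, so that the evaluated sum has sign `(-1)^(z 0)`,
    -- which cancels that of `coefOne`; hence only three of the `z` appear in the sign of the
    -- general term.
    (fun x => sgn (k1 + j3 - l1 - x)) M hM1,
    formulaB, prefactorB, mul_sum, mul_sum]
  · refine sum_congr rfl fun z hz => ?_
    obtain ⟨n1, n2, n3⟩ := hd z hz
    have hz0 := le_of_mem_sumBox_boundB hs hz
    dsimp only at hz0
    have hl := latticeSum_one_three hq (w := k1 + k2) (u := k1 + j3 - l1) (M := M)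
      (p := k1 + j3 - l1 + z 0) (v₁ := j3 - k3 + l2 - z 1) (v₂ := k3 + j4 - l4 - z 2)
      (v₃ := k1 - j4 + l3 - z 3) (W := p + s) (U := a - b)
      (P := a - b + z 0) (V₁ := -b - c + r - z 1)
      (V₂ := -f + g - z 2) (V₃ := -e + f - s - z 3)
      (by push_cast; linarith) (by push_cast; linarith) (by push_cast; linarith)
      (by push_cast; linarith) (by push_cast; linarith) (by push_cast; linarith) (by linarith)
      (by linarith) (by linarith) (by linarith)
    rw [show (fun x => _) = fun x => (coefOne q k1 j1 l1 j3 k2 (z 0) * coefThree q k3 j1 l2 j3 k4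
        (z 1) * coefTwo q k3 j2 l4 j4 k4 (z 2) * coefThree q j4 k2 l3 k1 j2 (z 3)) *
      (sgn (k1 + j3 - l1 - x) * (cutAbove q (k1 + j3 - l1 + z 0) x * cutBelow q
          (j3 - k3 + l2 - z 1) x * cutBelow q (k3 + j4 - l4 - z 2) x * cutBelow q
          (k1 - j4 + l3 - z 3) x)) from by
        ext x; simp only [Fin.prod_univ_four, Matrix.cons_val]; ring, latticeSum_const_mul, hl,
      ← mul_assoc (sgn _) (sgn _), sgn_mul_sgn (-a + c + e - g) (2 * a + b - 2 * p - r)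
        (by push_cast; linarith) (by push_cast; linarith),
      show l1 - l2 - l3 + l4 + (j1 - j3 - k1 + k2 - l1 - l2 - l3 + l4 - (l1 - l2 - l3 + l4)) =
          j1 - j3 - k1 + k2 - l1 - l2 - l3 + l4 by ring]
    refine congrArg _ ?_
    simp only [summandB, coefOne, coefThree, coefTwo]
    rw [show k1 + j3 - l1 - (k1 + j3 - l1 + z 0) = -(z 0 : ℚ) by ring, sgn_neg_natCast]
    have h2 : (-1 : ℝ) ^ (z 0 * 2) = 1 := by rw [mul_comm, pow_mul]; simp
    ring_nf
    simp only [h2, mul_one]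
  · intro x x1 x2 x3 x4
    obtain ⟨⟨n, hn⟩, -, -⟩ := id x1
    rw [sixj_eq_coefOne hq t1 x1 x2 t2 _ hN0,
      sixj_eq_coefThree hq t3 x3 x2 t4 _ hN1,
      sixj_eq_coefTwo hq t7 x3 x4 t8 _ hN2,
      -- The rows are swapped so that `∇` of `(k1, k2, x)` ends up in the denominator and `∇` of
      -- `(j4, j2, x)` in the numerator, as cancellation demands.
      sixj_swap_rows k1 j2,
      sixj_eq_coefThree hq t6 x4 x1 t5 _ hN3]
    have hsg : sgn (j1 + k2 + l1 + x) * sgn (k3 + k4 + x) * sgn (k3 + j2 + k4 + j4) * sgn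
        (j4 + j2 + x) =
        sgn (j1 - j3 - k1 + k2 - l1 - l2 - l3 + l4 - (l1 - l2 - l3 + l4)) * sgn
            (k1 + j3 - l1 - x) := by
      rw [sgn_mul_four ⟨-a - n + p + r + s, by push_cast; linarith⟩ ⟨-d - n + p + s +
          u, by push_cast; linarith⟩ ⟨-d - f + p + s + u + v, by push_cast; linarith⟩ ⟨-f - n + p +
          s + v, by push_cast; linarith⟩,
        sgn_mul_sgn (2 * a + b - 2 * p - r) (a - b + n) (by push_cast; linarith)
            (by push_cast; linarith)]
      exact sgn_congr (-2 * a - d - f - 2 * n + 3 * p + r + 2 * s + u + v) (by push_cast; linarith)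
    simp only [Fin.prod_univ_four, Matrix.cons_val]
    have hn : ∀ a b c, nabla q a b c ≠ 0 := fun a b c => (nabla_pos hq a b c).ne'
    refine prod_four_eq hsg ?_
    field_simp [hn]
  · intro x hx m hm h
    obtain ⟨i1, i2, i3, i4⟩ := And.intro (h 0) (And.intro (h 1) (And.intro (h 2) (h 3)))
    simp only [Matrix.cons_val] at i1 i2 i3 i4
    have i1 := le_of_sum_coefOne_ne_zero hq t1 t2 ⟨m, by linarith⟩ hN0 i1
    have i2 := le_of_sum_coefThree_ne_zero hq t3 t4 ⟨-d + m + u, by push_cast; linarith⟩ hN1 i2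
    have i3 := le_of_sum_coefTwo_ne_zero i3
    have i4 := le_of_sum_coefThree_ne_zero hq t6 t5 ⟨-f + m + v, by push_cast; linarith⟩ hN3 i4
    -- `coefOne` bounds `x` by `k1 + k2` and `j1 + j3`; the implications from the two `coefThree`
    -- pass these bounds on to `j4 + j2` and `k3 + k4`. The bound `k1 - k2 ≤ x` from the fourth and
    -- `j3 - j1 ≤ x` from the second are the premises of the implications of the first; the
    -- remaining bounds hold by support.
    grind

/-- As for (B), with the roles of `coefTwo` and `coefThree` exchanged in the second and third `6j`
coefficients. -/
theorem q12j_eq_formulaC (hq : 0 < q) (s : Spins) (hs : Admissible s) (hd : DefinedC s) :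
    q12j q s = formulaC q s := by
  obtain ⟨j1, j2, j3, j4, l1, l2, l3, l4, k1, k2, k3, k4⟩ := s
  obtain ⟨M, hM⟩ := exists_nat_ge (max (2 * (k1 + k2)) (2 * (j1 + j3)))
  obtain ⟨hM1, hM2⟩ := max_le_iff.1 hM
  obtain ⟨t1, t2, t3, t4, t5, t6, t7, t8⟩ := id hs
  obtain ⟨p, r, s, u, v, a, b, c, d, e, f, g, e1, e2, e3, e4, e5, e6, e7, e8, e9, e10, e11, e12⟩ :=
    hs.exists_int
  have hN0 : min (k2 + l1 - j3) (j1 + l1 - k1) <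
      ((boundC ⟨j1, j2, j3, j4, l1, l2, l3, l4, k1, k2, k3, k4⟩ 0 +
      1 : ℕ) : ℚ) := min_lt_floor_add_one (by ring) (by ring)
  have hN1 : min (k3 + j1 - l2) (k4 + j3 - l2) <
      ((boundC ⟨j1, j2, j3, j4, l1, l2, l3, l4, k1, k2, k3, k4⟩ 1 +
      1 : ℕ) : ℚ) := min_lt_floor_add_one (by ring) (by ring)
  have hN2 : min (l4 + j4 - k4) (j2 + l4 - k3) <
      ((boundC ⟨j1, j2, j3, j4, l1, l2, l3, l4, k1, k2, k3, k4⟩ 2 +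
      1 : ℕ) : ℚ) := min_lt_floor_add_one (by ring) (by ring)
  have hN3 : min (l3 + k1 - j2) (k2 + l3 - j4) <
      ((boundC ⟨j1, j2, j3, j4, l1, l2, l3, l4, k1, k2, k3, k4⟩ 3 +
      1 : ℕ) : ℚ) := min_lt_floor_add_one (by ring) rfl
  rw [q12j_eq_sum_latticeSum hs (boundC ⟨j1, j2, j3, j4, l1, l2, l3, l4, k1, k2, k3, k4⟩)
    ![fun z x => coefOne q k1 j1 l1 j3 k2 z * cutAbove q (k1 + j3 - l1 + z) x,
      fun z x => coefTwo q k3 j1 l2 j3 k4 z * cutBelow q (k3 + j3 - l2 - z) x,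
      fun z x => coefThree q k3 j2 l4 j4 k4 z * cutBelow q (j4 - k3 + l4 - z) x,
      fun z x => coefThree q j4 k2 l3 k1 j2 z * cutBelow q (k1 - j4 + l3 - z) x]
    (sgn (k1 - k2 + l1 - l2 + l3 + l4 - j2 + j4 - (l1 - l2 - l3 + l4)) *
      ((nabla q k3 j1 l2 * nabla q j3 k4 l2 * nabla q j4 k4 l4 * nabla q k1 j2 l3) /
        (nabla q k1 j1 l1 * nabla q j3 k2 l1 * nabla q k3 j2 l4 * nabla q j4 k2 l3)))
    (fun x => sgn (k1 + j3 - l1 - x)) M hM1,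
    formulaC, prefactorC, mul_sum, mul_sum]
  · refine sum_congr rfl fun z hz => ?_
    obtain ⟨n1, n2, n3⟩ := hd z hz
    have hz0 := le_of_mem_sumBox_boundC hs hz
    dsimp only at hz0
    have hl := latticeSum_one_three hq (w := k1 + k2) (u := k1 + j3 - l1) (M := M)
      (p := k1 + j3 - l1 + z 0) (v₁ := k3 + j3 - l2 - z 1) (v₂ := j4 - k3 + l4 - z 2)
      (v₃ := k1 - j4 + l3 - z 3) (W := p + s) (U := a - b)
      (P := a - b + z 0) (V₁ := -b + c - z 1)
      (V₂ := -f - g + v - z 2) (V₃ := -e + f - s - z 3)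
      (by push_cast; linarith) (by push_cast; linarith) (by push_cast; linarith)
      (by push_cast; linarith) (by push_cast; linarith) (by push_cast; linarith) (by linarith)
      (by linarith) (by linarith) (by linarith)
    rw [show (fun x => _) = fun x => (coefOne q k1 j1 l1 j3 k2 (z 0) * coefTwo q k3 j1 l2 j3 k4
        (z 1) * coefThree q k3 j2 l4 j4 k4 (z 2) * coefThree q j4 k2 l3 k1 j2 (z 3)) *
      (sgn (k1 + j3 - l1 - x) * (cutAbove q (k1 + j3 - l1 + z 0) x * cutBelow q
          (k3 + j3 - l2 - z 1) x * cutBelow q (j4 - k3 + l4 - z 2) x * cutBelow q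
          (k1 - j4 + l3 - z 3) x)) from by
        ext x; simp only [Fin.prod_univ_four, Matrix.cons_val]; ring, latticeSum_const_mul, hl,
      ← mul_assoc (sgn _) (sgn _), sgn_mul_sgn (-a + c + e - g) (-2 * e - f + 2 * p + v)
        (by push_cast; linarith) (by push_cast; linarith),
      show l1 - l2 - l3 + l4 + (k1 - k2 + l1 - l2 + l3 + l4 - j2 + j4 - (l1 - l2 - l3 + l4)) =
          k1 - k2 + l1 - l2 + l3 + l4 - j2 + j4 by ring]
    refine congrArg _ ?_
    simp only [summandC, coefOne, coefThree, coefTwo]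
    rw [show k1 + j3 - l1 - (k1 + j3 - l1 + z 0) = -(z 0 : ℚ) by ring, sgn_neg_natCast]
    have h2 : (-1 : ℝ) ^ (z 0 * 2) = 1 := by rw [mul_comm, pow_mul]; simp
    ring_nf
    simp only [h2, mul_one]
  · intro x x1 x2 x3 x4
    obtain ⟨⟨n, hn⟩, -, -⟩ := id x1
    rw [sixj_eq_coefOne hq t1 x1 x2 t2 _ hN0,
      sixj_eq_coefTwo hq t3 x3 x2 t4 _ hN1,
      sixj_eq_coefThree hq t7 x3 x4 t8 _ hN2,
      sixj_swap_rows k1 j2,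
      sixj_eq_coefThree hq t6 x4 x1 t5 _ hN3]
    have hsg : sgn (j1 + k2 + l1 + x) * sgn (k3 + j1 + k4 + j3) * sgn (k3 + k4 + x) * sgn
        (j4 + j2 + x) =
        sgn (k1 - k2 + l1 - l2 + l3 + l4 - j2 + j4 - (l1 - l2 - l3 + l4)) * sgn
            (k1 + j3 - l1 - x) := by
      rw [sgn_mul_four ⟨-a - n + p + r + s, by push_cast; linarith⟩ ⟨-b - d + p + r + s +
          u, by push_cast; linarith⟩ ⟨-d - n + p + s + u, by push_cast; linarith⟩ ⟨-f - n + p + s +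
          v, by push_cast; linarith⟩,
        sgn_mul_sgn (-2 * e - f + 2 * p + v) (a - b + n) (by push_cast; linarith)
            (by push_cast; linarith)]
      exact sgn_congr (-a - d + e - 2 * n + p + r + 2 * s + u) (by push_cast; linarith)
    simp only [Fin.prod_univ_four, Matrix.cons_val]
    have hn : ∀ a b c, nabla q a b c ≠ 0 := fun a b c => (nabla_pos hq a b c).ne'
    refine prod_four_eq hsg ?_
    field_simp [hn]
  · intro x hx m hm h
    obtain ⟨i1, i2, i3, i4⟩ := And.intro (h 0) (And.intro (h 1) (And.intro (h 2) (h 3)))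
    simp only [Matrix.cons_val] at i1 i2 i3 i4
    have i1 := le_of_sum_coefOne_ne_zero hq t1 t2 ⟨m, by linarith⟩ hN0 i1
    have i2 := le_of_sum_coefTwo_ne_zero i2
    have i3 := le_of_sum_coefThree_ne_zero hq t7 t8 ⟨-d + m + u, by push_cast; linarith⟩ hN2 i3
    have i4 := le_of_sum_coefThree_ne_zero hq t6 t5 ⟨-f + m + v, by push_cast; linarith⟩ hN3 i4
    grind

/-- Three `coefThree` expansions supply the `cutBelow` factors, and `coefFour` the single
`cutAbove`. The rows of the second `6j` symbol are swapped so that the `∇` factors with `x` cancel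
around the cycle. -/
theorem q12j_eq_formulaD (hq : 0 < q) (s : Spins) (hs : Admissible s) (hd : DefinedD s) :
    q12j q s = formulaD q s := by
  obtain ⟨j1, j2, j3, j4, l1, l2, l3, l4, k1, k2, k3, k4⟩ := s
  obtain ⟨M, hM⟩ := exists_nat_ge (max (2 * (k1 + k2)) (2 * (j4 + j2)))
  obtain ⟨hM1, hM2⟩ := max_le_iff.1 hM
  obtain ⟨t1, t2, t3, t4, t5, t6, t7, t8⟩ := id hs
  obtain ⟨p, r, s, u, v, a, b, c, d, e, f, g, e1, e2, e3, e4, e5, e6, e7, e8, e9, e10, e11, e12⟩ :=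
    hs.exists_int
  have hN0 : min (l1 + j3 - k2) (j1 + l1 - k1) <
      ((boundD ⟨j1, j2, j3, j4, l1, l2, l3, l4, k1, k2, k3, k4⟩ 0 +
      1 : ℕ) : ℚ) := min_lt_floor_add_one (by ring) (by ring)
  have hN1 : min (l2 + k3 - j1) (k4 + l2 - j3) <
      ((boundD ⟨j1, j2, j3, j4, l1, l2, l3, l4, k1, k2, k3, k4⟩ 1 +
      1 : ℕ) : ℚ) := min_lt_floor_add_one (by ring) (by ring)
  have hN2 : min (l4 + j4 - k4) (j2 + l4 - k3) <
      ((boundD ⟨j1, j2, j3, j4, l1, l2, l3, l4, k1, k2, k3, k4⟩ 2 +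
      1 : ℕ) : ℚ) := min_lt_floor_add_one (by ring) (by ring)
  have hN3 : k1 + j2 - l3 < ((boundD ⟨j1, j2, j3, j4, l1, l2, l3, l4, k1, k2, k3, k4⟩ 3 +
      1 : ℕ) : ℚ) := by
    push_cast; exact Nat.lt_floor_add_one _
  rw [q12j_eq_sum_latticeSum hs (boundD ⟨j1, j2, j3, j4, l1, l2, l3, l4, k1, k2, k3, k4⟩)
    ![fun z x => coefThree q k1 j1 l1 j3 k2 z * cutBelow q (j3 - k1 + l1 - z) x,
      fun z x => coefThree q j3 k4 l2 k3 j1 z * cutBelow q (k3 - j3 + l2 - z) x,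
      fun z x => coefThree q k3 j2 l4 j4 k4 z * cutBelow q (j4 - k3 + l4 - z) x,
      fun z x => coefFour q k1 j2 l3 j4 k2 z * cutAbove q (j2 + j4 - z) x]
    (sgn (k3 + k4 - l1 + l2 + l3 - l4 - j1 - j3 - (l1 - l2 - l3 + l4)) *
      ((nabla q j3 k2 l1 * nabla q k3 j1 l2 * nabla q j4 k4 l4 * nabla q k1 j2 l3) /
        (nabla q k1 j1 l1 * nabla q j3 k4 l2 * nabla q k3 j2 l4 * nabla q j4 k2 l3)))
    -- Here `j4 + j2 = p + z 3`, so the evaluated sum has sign `(-1)^(z 3)`, cancelling that of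
    -- `coefFour`.
    (fun x => sgn (j4 + j2 - x)) M hM1,
    formulaD, prefactorD, mul_sum, mul_sum]
  · refine sum_congr rfl fun z hz => ?_
    obtain ⟨n1, n2, n3⟩ := hd z hz
    have hz0 := Nat.cast_nonneg (α := ℚ) (z 3)
    have hl := latticeSum_one_three hq (w := k1 + k2) (u := j4 + j2) (M := M)
      (p := j2 + j4 - z 3) (v₁ := j3 - k1 + l1 - z 0) (v₂ := k3 - j3 + l2 - z 1)
      (v₃ := j4 - k3 + l4 - z 2) (W := p + s) (U := -f + v)
      (P := -f + v - z 3) (V₁ := -a - b + r - z 0)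
      (V₂ := b - c - p - s + u - z 1) (V₃ := -f - g + v - z 2)
      (by push_cast; linarith) (by push_cast; linarith) (by push_cast; linarith)
      (by push_cast; linarith) (by push_cast; linarith) (by push_cast; linarith) (by linarith)
      (by linarith) (by linarith) (by linarith)
    rw [show (fun x => _) = fun x => (coefThree q k1 j1 l1 j3 k2 (z 0) * coefThree q j3 k4 l2 k3 j1
        (z 1) * coefThree q k3 j2 l4 j4 k4 (z 2) * coefFour q k1 j2 l3 j4 k2 (z 3)) *
      (sgn (j4 + j2 - x) * (cutAbove q (j2 + j4 - z 3) x * cutBelow q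
          (j3 - k1 + l1 - z 0) x * cutBelow q (k3 - j3 + l2 - z 1) x * cutBelow q
          (j4 - k3 + l4 - z 2) x)) from by
        ext x; simp only [Fin.prod_univ_four, Matrix.cons_val]; ring, latticeSum_const_mul, hl,
      ← mul_assoc (sgn _) (sgn _), sgn_mul_sgn (-a + c + e - g)
          (2 * a + b - 2 * c - d - 2 * e + 2 * g - r + u)
        (by push_cast; linarith) (by push_cast; linarith),
      show l1 - l2 - l3 + l4 + (k3 + k4 - l1 + l2 + l3 - l4 - j1 - j3 - (l1 - l2 - l3 + l4)) = k3 +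
          k4 - l1 + l2 + l3 - l4 - j1 - j3 by ring]
    refine congrArg _ ?_
    simp only [summandD, coefFour, coefThree]
    rw [show j4 + j2 - (j2 + j4 - z 3) = (z 3 : ℚ) by ring, sgn_natCast]
    have h2 : (-1 : ℝ) ^ (z 3 * 2) = 1 := by rw [mul_comm, pow_mul]; simp
    ring_nf
    simp only [h2, mul_one]
  · intro x x1 x2 x3 x4
    obtain ⟨⟨n, hn⟩, -, -⟩ := id x1
    rw [sixj_eq_coefThree hq t1 x1 x2 t2 _ hN0,
      sixj_swap_rows k3 j1,
      sixj_eq_coefThree hq t4 x2 x3 t3 _ hN1,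
      sixj_eq_coefThree hq t7 x3 x4 t8 _ hN2,
      sixj_eq_coefFour hq t5 x1 x4 t6 _ hN3]
    have hsg : sgn (k1 + k2 + x) * sgn (j3 + j1 + x) * sgn (k3 + k4 + x) * sgn (k1 + j2 + k2 + j4) =
        sgn (k3 + k4 - l1 + l2 + l3 - l4 - j1 - j3 - (l1 - l2 - l3 + l4)) * sgn (j4 + j2 - x) := by
      rw [sgn_mul_four ⟨-n + p + s, by push_cast; linarith⟩ ⟨-b - n + p + r +
          s, by push_cast; linarith⟩ ⟨-d - n + p + s + u, by push_cast; linarith⟩ ⟨-f + p + s +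
          v, by push_cast; linarith⟩,
        sgn_mul_sgn (2 * a + b - 2 * c - d - 2 * e + 2 * g - r + u) (-f + n + v)
            (by push_cast; linarith) (by push_cast; linarith)]
      exact sgn_congr (-a - b + c + e - g - 2 * n + 2 * p + r + 2 * s) (by push_cast; linarith)
    simp only [Fin.prod_univ_four, Matrix.cons_val]
    have hn : ∀ a b c, nabla q a b c ≠ 0 := fun a b c => (nabla_pos hq a b c).ne'
    refine prod_four_eq hsg ?_
    field_simp [hn]
  · intro x hx m hm h
    obtain ⟨i1, i2, i3, i4⟩ := And.intro (h 0) (And.intro (h 1) (And.intro (h 2) (h 3)))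
    simp only [Matrix.cons_val] at i1 i2 i3 i4
    have i1 := le_of_sum_coefThree_ne_zero hq t1 t2 ⟨m, by linarith⟩ hN0 i1
    have i2 := le_of_sum_coefThree_ne_zero hq t4 t3 ⟨-b + m + r, by push_cast; linarith⟩ hN1 i2
    have i3 := le_of_sum_coefThree_ne_zero hq t7 t8 ⟨-d + m + u, by push_cast; linarith⟩ hN2 i3
    have i4 := le_of_sum_coefFour_ne_zero hq t5 t6 ⟨m, by linarith⟩ hx hN3 i4
    -- Only `x ≤ j2 + j4` is an upper bound by support; the three `coefThree` implications pass it
    -- on in turn to `k3 + k4`, `j1 + j3` and `k1 + k2`. The bounds `k1 - k2 ≤ x` and `j2 - j4 ≤ x`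
    -- follow from the implications of `coefFour`.
    grind

/-! ### Symmetry of formulas (A) and (B). -/

lemma swap_zero : Equiv.swap (1 : Fin 4) 3 0 = 0 := by decide
lemma swap_one : Equiv.swap (1 : Fin 4) 3 1 = 3 := by decide
lemma swap_two : Equiv.swap (1 : Fin 4) 3 2 = 2 := by decide
lemma swap_three : Equiv.swap (1 : Fin 4) 3 3 = 1 := by decide

/-- The substitution negates the exponent of the sign. This is harmless only because admissibility
makes the exponent an integer; in (B) the exponent does not change at all. -/
theorem prefactorA_flip (s : Spins) (hs : Admissible s) :
    prefactorA q s.flip = prefactorA q s := by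
  obtain ⟨j1, j2, j3, j4, l1, l2, l3, l4, k1, k2, k3, k4⟩ := s
  obtain ⟨t1, t2, ⟨⟨c1, hc1⟩, ⟨c2, hc2⟩, ⟨c3, hc3⟩⟩, ⟨⟨d1, hd1⟩, -, -⟩,
      ⟨⟨e1, he1⟩, ⟨e2, he2⟩, ⟨e3, he3⟩⟩,
    ⟨⟨f1, hf1⟩, ⟨f2, hf2⟩, ⟨f3, hf3⟩⟩, -, -⟩ := hs
  obtain ⟨⟨a1, ha1⟩, ⟨a2, ha2⟩, ⟨a3, ha3⟩⟩ := t1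
  obtain ⟨⟨b1, hb1⟩, ⟨b2, hb2⟩, ⟨b3, hb3⟩⟩ := t2
  rw [Spins.flip, prefactorA, prefactorA,
    sgn_congr (u := l3 - l2 + j3 - j4 - k1 + k3) (v := l2 - l3 + k1 - k3 - j3 + j4)
      (-a1 - b3 + c1 + e2 + e3 - f2) (by push_cast; linarith)]
  ring

theorem prefactorB_flip (s : Spins) : prefactorB q s.flip = prefactorB q s := by
  obtain ⟨j1, j2, j3, j4, l1, l2, l3, l4, k1, k2, k3, k4⟩ := s
  rw [Spins.flip, prefactorB, prefactorB, show k2 - k1 - j3 + j1 - l1 - l3 - l2 + l4 =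
    j1 - j3 - k1 + k2 - l1 - l2 - l3 + l4 by ring]
  ring

theorem boundA_flip (s : Spins) (i : Fin 4) :
    boundA s.flip i = boundA s (Equiv.swap 1 3 i) := by
  obtain ⟨j1, j2, j3, j4, l1, l2, l3, l4, k1, k2, k3, k4⟩ := s
  have h (x y x' y' : ℚ) (h1 : x = y') (h2 : y = x') : ⌊min x y⌋₊ = ⌊min x' y'⌋₊ := by
    rw [h1, h2, min_comm]
  fin_cases i <;>
    simp only [Fin.zero_eta, Fin.mk_one, Fin.reduceFinMk, swap_zero, swap_one, swap_two, swap_three]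
  all_goals exact h _ _ _ _ (by ring) (by ring)

theorem boundB_flip (s : Spins) (i : Fin 4) :
    boundB s.flip i = boundB s (Equiv.swap 1 3 i) := by
  obtain ⟨j1, j2, j3, j4, l1, l2, l3, l4, k1, k2, k3, k4⟩ := s
  have h (x y x' y' : ℚ) (h1 : x = y') (h2 : y = x') : ⌊min x y⌋₊ = ⌊min x' y'⌋₊ := by
    rw [h1, h2, min_comm]
  have h' (x y x' y' : ℚ) (h1 : x = x') (h2 : y = y') : ⌊min x y⌋₊ = ⌊min x' y'⌋₊ := by
    rw [h1, h2]
  fin_cases i <;>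
    simp only [Fin.zero_eta, Fin.mk_one, Fin.reduceFinMk, swap_zero, swap_one, swap_two, swap_three]
  exacts [h _ _ _ _ (by ring) (by ring), h' _ _ _ _ (by ring) (by ring),
    h _ _ _ _ (by ring) (by ring), h' _ _ _ _ (by ring) (by ring)]

theorem summandA_flip (s : Spins) (z : Fin 4 → ℕ) :
    summandA q s.flip (fun i => z (Equiv.swap 1 3 i)) = summandA q s z := by
  obtain ⟨j1, j2, j3, j4, l1, l2, l3, l4, k1, k2, k3, k4⟩ := s
  simp only [Spins.flip, summandA, swap_zero, swap_one, swap_two, swap_three]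
  ring_nf

theorem summandB_flip (s : Spins) (z : Fin 4 → ℕ) :
    summandB q s.flip (fun i => z (Equiv.swap 1 3 i)) = summandB q s z := by
  obtain ⟨j1, j2, j3, j4, l1, l2, l3, l4, k1, k2, k3, k4⟩ := s
  simp only [Spins.flip, summandB, swap_zero, swap_one, swap_two, swap_three]
  ring_nf

lemma sum_sumBox_comp_equiv (e : Equiv.Perm (Fin 4)) {b b' : Fin 4 → ℕ} (hb : ∀ i, b' i = b (e i))
    {f f' : (Fin 4 → ℕ) → ℝ} (hf : ∀ z, f' (fun i => z (e i)) = f z) :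
    ∑ z ∈ sumBox b', f' z = ∑ z ∈ sumBox b, f z := by
  symm
  refine sum_equiv (Equiv.arrowCongr e.symm (Equiv.refl ℕ)) (fun z => ?_) (fun z _ => (hf z).symm)
  simp only [sumBox, Fintype.mem_piFinset, mem_range, hb, Equiv.arrowCongr_apply, Equiv.symm_symm,
    Equiv.coe_refl, Function.comp_apply, id]
  exact ⟨fun h i => h (e i), fun h i => by simpa using h (e.symm i)⟩

theorem formulaA_flip (s : Spins) (hs : Admissible s) : formulaA q s.flip = formulaA q s := by
  rw [formulaA, formulaA, prefactorA_flip s hs,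
    sum_sumBox_comp_equiv _ (boundA_flip s) (summandA_flip s)]

theorem formulaB_flip (s : Spins) : formulaB q s.flip = formulaB q s := by
  rw [formulaB, formulaB, prefactorB_flip, sum_sumBox_comp_equiv _ (boundB_flip s)
      (summandB_flip s)]

/-! ### Recurrences of terms and balanced series. -/

lemma qF_add_one {x y a : ℚ} (m : ℤ) (hm : x = m) (h0 : 0 ≤ x) (hy : y = x + 1)
    (ha : a = x + 1) : qF q y = qnum q a * qF q x := by
  have h : 0 ≤ m := by rw [← @Int.cast_le ℚ]; push_cast; linarith
  rw [qF_eq_qFac (m + 1) (by push_cast; linarith), qF_eq_qFac m hm, ha, hm, qFac_succ h, qInt]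
  push_cast; ring

lemma qF_add_one_neg {x y a : ℚ} (m : ℤ) (hm : x = m) (h0 : 0 ≤ x) (hy : y = x + 1)
    (ha : a = -(x + 1)) : qF q y = -qnum q a * qF q x := by
  rw [qF_add_one m hm h0 hy rfl, show a = ((-(m + 1) : ℤ) : ℚ) by push_cast; linarith,
    show x + 1 = ((m + 1 : ℤ) : ℚ) by push_cast; linarith]
  have := qInt_neg (q := q) (m + 1)
  rw [qInt, qInt] at this
  rw [this]; ring

lemma qR_eq_mul_add_one (hq : 0 < q) {x y a : ℚ} (m : ℤ) (hm : x = m) (hy : y = x + 1)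
    (ha : a = x + 1) : qR q x = qnum q a * qR q y := by
  rw [qR_eq_qInv (m + 1) (by push_cast; linarith : y = _), qR_eq_qInv m hm, ha, hm,
    qInv_eq_mul_succ hq, qInt]
  push_cast; rfl

lemma qR_eq_mul_add_one_neg (hq : 0 < q) {x y a : ℚ} (m : ℤ) (hm : x = m) (hy : y = x + 1)
    (ha : a = -(x + 1)) : qR q x = -qnum q a * qR q y := by
  rw [qR_eq_mul_add_one hq m hm hy rfl, show a = ((-(m + 1) : ℤ) : ℚ) by push_cast; linarith,
    show x + 1 = ((m + 1 : ℤ) : ℚ) by push_cast; linarith]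
  have := qInt_neg (q := q) (m + 1)
  rw [qInt, qInt] at this
  rw [this]; ring

lemma qnum_ne_zero (hq : 0 < q) {x : ℚ} (m : ℤ) (hm : x = m) (h : x ≠ 0) : qnum q x ≠ 0 := by
  subst hm
  exact qInt_ne_zero hq (by exact_mod_cast h)

/-- A sum is balanced if its terms satisfy the recurrence relation of a balanced series. -/
theorem isBalancedSum_of_recurrence (hq : 0 < q) {α : Fin 5 → ℚ} {β : Fin 4 → ℚ} {N : ℕ}
    {t : ℕ → ℝ} (hβ : ∀ i, ∃ b : ℤ, β i = b) (hsum : ∑ i, α i - ∑ i, β i = -1)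
    (h0 : ∀ i, β i + N ≤ 0 ∨ ∀ n : ℕ, β i + n ≤ 0 → t n = 0)
    (hrec : ∀ n < N, t (n + 1) * ((∏ i, qnum q (β i + n)) * qnum q (n + 1)) =
      t n * ∏ i, qnum q (α i + n)) : IsBalancedSum q α β N t := by
  set c : Fin 5 → ℚ := Fin.cons 1 β with hc
  have hci : ∀ i, ∃ b : ℤ, c i = b := Fin.cases ⟨1, by simp [hc]⟩ fun i => by simpa [hc] using hβ i
  choose b hb using hci
  have hb0 : b 0 = 1 := by
    rw [← @Int.cast_inj ℚ, ← hb]; simp [hc]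
  -- Parameters with `b i + N ≤ 0` do not produce a zero bracket at any step `n < N` and are left
  -- out. Among the others, the smallest one determines the leading index `m = 1 - b r`: from there
  -- on no denominator bracket vanishes. The parameter `1` always takes part, which gives `m ≥ 0`.
  obtain ⟨r, hr, hmin⟩ := exists_min_image (univ.filter fun i => 0 < b i + N) b
    ⟨0, by simp [hb0]; positivity⟩
  simp only [mem_filter, mem_univ, true_and] at hr hmin
  have hr1 : b r ≤ 1 := hb0 ▸ hmin 0 (by rw [hb0]; positivity)
  obtain ⟨m, hm⟩ := Int.eq_ofNat_of_zero_le (sub_nonneg.2 hr1)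
  have hm : (m : ℤ) = 1 - b r := hm.symm
  have hmQ : (m : ℚ) = 1 - c r := by rw [hb]; exact_mod_cast hm
  have hmN : m ≤ N := by omega
  have hpos : ∀ (i : Fin 4) (j : ℕ), m + j < N → c (r.succAbove i) + m + j ≠ 0 := by
    intro i j hj h
    have h' : b (r.succAbove i) + m + j = 0 := by
      rw [hb] at h; exact_mod_cast h
    have := hmin (r.succAbove i) (by omega)
    omega
  have hne : ∀ k, m + k ≤ N → ∀ i, qPoch q (c (r.succAbove i) + m) k ≠ 0 := by
    intro k hk i
    rw [qPoch, prod_ne_zero_iff]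
    intro j hj
    rw [mem_range] at hj
    exact qnum_ne_zero hq (b (r.succAbove i) + m + j) (by rw [hb]; push_cast; ring)
      (hpos i j (by omega))
  have hne1 : ∀ k, qPoch q 1 k ≠ 0 := by
    intro k
    rw [qPoch, prod_ne_zero_iff]
    intro j _
    exact qnum_ne_zero hq (1 + j) (by push_cast; ring) (by positivity)
  have ht : ∀ k, m + k ≤ N → t (m + k) =
      t m * hypTerm q (fun i => α i + m) (fun i => c (r.succAbove i) + m) 1 k := by
    intro k
    induction k with
    | zero => intro _; simp [hypTerm, qPoch]
    | succ k ih =>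
      intro hk
      have h := hrec (m + k) (by omega)
      rw [ih (by omega)] at h
      -- In the list `1, β` the entry `r` is split off instead of the entry `1`; after the shift by
      -- `m` it contributes the bracket `[1+k]`, the new `(1|q)` factor.
      have e1 : (∏ i, qnum q (β i + (m + k : ℕ))) * qnum q ((m + k : ℕ) + 1) =
          qnum q (1 + k) * ∏ i, qnum q (c (r.succAbove i) + m + k) := by
        have : ∏ i, qnum q (c i + (m + k : ℕ)) = qnum q (1 + (m + k : ℕ)) *
            ∏ i, qnum q (β i + (m + k : ℕ)) := by rw [Fin.prod_univ_succ]; simp [hc]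
        rw [Fin.prod_univ_succAbove _ r] at this
        rw [mul_comm, add_comm ((m + k : ℕ) : ℚ) 1, ← this]
        congr 2
        · push_cast; linarith
        · ext i; push_cast; ring_nf
      have n1 := hne (k + 1) hk
      have n2 := hne k (by omega)
      have n3 := hne1 (k + 1)
      have n4 := hne1 k
      have s (a : ℚ) : qPoch q a (k + 1) = qPoch q a k * qnum q (a + k) := prod_range_succ _ _
      have p1 : ∏ i, qPoch q (c (r.succAbove i) + m) k ≠ 0 := prod_ne_zero_iff.2 fun i _ => n2 i
      have p2 : ∏ i, qnum q (c (r.succAbove i) + m + k) ≠ 0 := prod_ne_zero_iff.2 fun i _ =>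
        right_ne_zero_of_mul (s _ ▸ n1 i)
      have p3 : qnum q (1 + k) ≠ 0 := right_ne_zero_of_mul (s 1 ▸ n3)
      have e2 : ∏ i, qnum q (α i + (m + k : ℕ)) = ∏ i, qnum q (α i + m + k) :=
        prod_congr rfl fun i _ => by push_cast; ring_nf
      rw [e1, e2] at h
      simp only [hypTerm, s, prod_mul_distrib, one_pow, mul_one] at h ⊢
      rw [← add_assoc, ← mul_left_inj' (mul_ne_zero p3 p2), h]
      field_simp
  have hz : ∀ k < m, t k = 0 := by
    intro k hk
    rcases Fin.eq_zero_or_eq_succ r with h | ⟨i, h⟩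
    · rw [h, hb0] at hm; omega
    · have hbi : β i = b r := by rw [← hb, h, hc, Fin.cons_succ]
      rcases h0 i with h | h
      · rw [hbi] at h
        have : b r + N ≤ 0 := by exact_mod_cast h
        omega
      · refine h k ?_
        rw [hbi]
        have : b r + k ≤ 0 := by omega
        exact_mod_cast this
  refine ⟨m, r, fun i => α i + m, fun i => c (r.succAbove i) + m, fun _ => rfl, by rw [hmQ]; ring,
    fun _ => rfl, ?_, hz, fun k hk => ⟨hne k hk, ht k hk⟩, ?_⟩
  -- Balance survives the shift: both `α` and the list `1, β` gain `5m`, and the shifted list again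
  -- contains the entry `1` that is removed.
  · have h1 : ∑ i, c i = 1 + ∑ i, β i := by rw [Fin.sum_univ_succ]; simp [hc]
    rw [Fin.sum_univ_succAbove _ r] at h1
    rw [sum_add_distrib, sum_add_distrib]
    simp only [sum_const, card_univ, Fintype.card_fin, nsmul_eq_mul]
    push_cast
    linarith
  · rw [mul_sum, ← sum_subset (s₁ := Ico m (N + 1)), sum_Ico_eq_sum_range]
    · exact sum_congr rfl fun k hk => ht k (by rw [mem_range] at hk; omega)
    · intro k hk; rw [mem_Ico] at hk; exact mem_range.2 hk.2
    · intro k hk hk'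
      rw [mem_Ico, not_and] at hk'
      rw [mem_range] at hk
      exact hz k (by by_contra h; exact hk' (not_lt.1 h) hk)

lemma update_zero (z : Fin 4 → ℕ) (n : ℕ) : Function.update z 0 n = ![n, z 1, z 2, z 3] := by
  ext i; fin_cases i <;> rfl

lemma update_one (z : Fin 4 → ℕ) (n : ℕ) : Function.update z 1 n = ![z 0, n, z 2, z 3] := by
  ext i; fin_cases i <;> rfl

lemma update_two (z : Fin 4 → ℕ) (n : ℕ) : Function.update z 2 n = ![z 0, z 1, n, z 3] := by
  ext i; fin_cases i <;> rfl

lemma update_three (z : Fin 4 → ℕ) (n : ℕ) : Function.update z 3 n = ![z 0, z 1, z 2, n] := by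
  ext i; fin_cases i <;> rfl

lemma update_mem_sumBox {b z : Fin 4 → ℕ} (hz : z ∈ sumBox b) (i : Fin 4) {n : ℕ} (hn : n ≤ b i) :
    Function.update z i n ∈ sumBox b := by
  rw [sumBox, Fintype.mem_piFinset] at hz ⊢
  intro j
  by_cases h : j = i
  · subst h; rw [Function.update_self]; exact mem_range.2 (Nat.lt_succ_of_le hn)
  · rw [Function.update_of_ne h]; exact hz j

/-- The factor of the general term of a `q`-hypergeometric series with the numerator parameter `a`:
a factorial in the numerator or, for `s = false`, in the denominator. -/
noncomputable def upperFactor (q : ℝ) (s : Bool) (a : ℚ) (n : ℕ) : ℝ :=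
  bif s then qF q (a - 1 + n) else qR q (-a - n)

/-- The factor of the general term of a `q`-hypergeometric series with the denominator parameter
`b`: a factorial in the denominator or, for `s = false`, in the numerator. -/
noncomputable def lowerFactor (q : ℝ) (s : Bool) (b : ℚ) (n : ℕ) : ℝ :=
  bif s then qR q (b - 1 + n) else qF q (-b - n)

lemma upperFactor_succ (hq : 0 < q) {s : Bool} {a : ℚ} {n : ℕ} (ha : ∃ m : ℤ, a = m)
    (h : s = true → 0 < a + n) :
    upperFactor q s a (n + 1) = (bif s then 1 else -1) * qnum q (a + n) * upperFactor q s a n := by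
  obtain ⟨m, hm⟩ := ha
  cases s
  · simp only [upperFactor, cond_false]
    rw [qR_eq_mul_add_one_neg hq (x := -a - (n + 1 : ℕ)) (y := -a - n) (a := a + n) (-m - (n + 1))
      (by rw [hm]; push_cast; ring) (by push_cast; ring) (by push_cast; ring)]
    ring
  · have h1 : 0 ≤ m + n - 1 := by
      have := h rfl
      rw [hm] at this
      have : 0 < m + n := by exact_mod_cast this
      omega
    simp only [upperFactor, cond_true]
    rw [qF_add_one (x := a - 1 + n) (y := a - 1 + (n + 1 : ℕ)) (a := a + n) (m + n - 1)
      (by rw [hm]; push_cast; ring) (by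
        have : ((0 : ℤ) : ℚ) ≤ ((m + n - 1 : ℤ) : ℚ) := Int.cast_le.2 h1
        push_cast at this; linarith) (by push_cast; ring) (by ring)]
    ring

lemma lowerFactor_eq (hq : 0 < q) {s : Bool} {b : ℚ} {n : ℕ} (hb : ∃ m : ℤ, b = m)
    (h : s = false → b + (n + 1) ≤ 0) :
    lowerFactor q s b n = (bif s then 1 else -1) * qnum q (b + n) * lowerFactor q s b (n + 1) := by
  obtain ⟨m, hm⟩ := hb
  cases s
  · simp only [lowerFactor, cond_false]
    rw [qF_add_one_neg (x := -b - (n + 1 : ℕ)) (y := -b - n) (a := b + n) (-m - (n + 1))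
      (by rw [hm]; push_cast; ring) (by have := h rfl; push_cast; linarith) (by push_cast; ring)
      (by push_cast; ring)]
    ring
  · simp only [lowerFactor, cond_true]
    rw [qR_eq_mul_add_one hq (x := b - 1 + n) (y := b - 1 + (n + 1 : ℕ)) (a := b + n) (m - 1 + n)
      (by rw [hm]; push_cast; ring) (by push_cast; ring) (by ring)]
    ring

/-- Sums of products of factors that belong to the parameters `α` and `β` are balanced. A factorial
in the numerator may have negative arguments where another factor vanishes. -/
theorem isBalancedSum_of_factors (hq : 0 < q) {α : Fin 5 → ℚ} {β : Fin 4 → ℚ} {N : ℕ} {t : ℕ → ℝ}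
    (K ε : ℝ) (s : Fin 5 → Bool) (s' : Fin 4 → Bool) (hα : ∀ i, ∃ a : ℤ, α i = a)
    (hβ : ∀ i, ∃ b : ℤ, β i = b) (hsum : ∑ i, α i - ∑ i, β i = -1)
    (hε : ε = (∏ i, bif s i then 1 else -1) * ∏ i, bif s' i then 1 else -1)
    (hu : ∀ i, s i = true → 1 ≤ α i ∨
      ∃ j, s' j = true ∧ ∀ n : ℕ, α i + n ≤ 0 → K = 0 ∨ β j + n ≤ 0)
    (hl : ∀ i, s' i = false → β i + N ≤ 0)
    (ht : ∀ n, t n = K * ε ^ n * (∏ i, upperFactor q (s i) (α i) n) *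
      (∏ i, lowerFactor q (s' i) (β i) n) * qR q n) : IsBalancedSum q α β N t := by
  have h0 (j : Fin 4) (hj : s' j = true) (n : ℕ) (h : β j + n ≤ 0) :
      lowerFactor q (s' j) (β j) n = 0 := by
    rw [lowerFactor, hj, cond_true, qR_of_neg (by linarith)]
  have hl' (n : ℕ) (hn : n < N) (j : Fin 4) : lowerFactor q (s' j) (β j) n =
      (bif s' j then 1 else -1) * qnum q (β j + n) * lowerFactor q (s' j) (β j) (n + 1) := by
    refine lowerFactor_eq hq (hβ j) fun h => ?_
    have : ((n + 1 : ℕ) : ℚ) ≤ N := Nat.cast_le.2 hn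
    push_cast at this
    linarith [hl j h]
  refine isBalancedSum_of_recurrence hq hβ hsum (fun i => ?_) fun n hn => ?_
  · cases h : s' i
    · exact Or.inl (hl i h)
    · exact Or.inr fun n hn => by rw [ht, prod_eq_zero (mem_univ i) (h0 i h n hn)]; ring
  have hε2 : (∏ i, bif s' i then (1 : ℝ) else -1) * ∏ i, (bif s' i then (1 : ℝ) else -1) = 1 := by
    rw [← prod_mul_distrib]
    exact prod_eq_one fun i _ => by cases s' i <;> simp
  have hR : qR q n = qnum q (n + 1) * qR q ((n + 1 : ℕ) : ℚ) :=
    qR_eq_mul_add_one hq n (by simp) (by push_cast; ring) rfl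
  have hL : ∏ i, lowerFactor q (s' i) (β i) n = (∏ i, bif s' i then 1 else -1) *
      (∏ i, qnum q (β i + n)) * ∏ i, lowerFactor q (s' i) (β i) (n + 1) := by
    rw [← prod_mul_distrib, ← prod_mul_distrib]
    exact prod_congr rfl fun i _ => hl' n hn i
  by_cases h : ∃ i, s i = true ∧ α i + n ≤ 0
  -- A numerator factorial has a negative argument at `n`, where `qF` is just `1` and obeys no
  -- recurrence. By `hu` either the whole sum is zero or the denominator parameter `β j` kills the
  -- term at `n` and its bracket kills the left-hand side.
  · obtain ⟨i, hi, h⟩ := h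
    rcases hu i hi with h1 | ⟨j, hj, h1⟩
    · have := Nat.cast_nonneg (α := ℚ) n; linarith
    rcases h1 n h with hK | h1
    · rw [ht, ht, hK]; ring
    have e := hl' n hn j
    rw [h0 j hj n h1, hj, cond_true, one_mul] at e
    have e1 : (∏ i, lowerFactor q (s' i) (β i) (n + 1)) * ∏ i, qnum q (β i + n) = 0 := by
      rw [← prod_mul_distrib]
      exact prod_eq_zero (mem_univ j) (by rw [hj, mul_comm]; exact e.symm)
    have e2 : ∏ i, lowerFactor q (s' i) (β i) n = 0 := prod_eq_zero (mem_univ j) (h0 j hj n h1)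
    rw [ht n, e2, ht (n + 1)]
    linear_combination (K * ε ^ (n + 1) * (∏ i, upperFactor q (s i) (α i) (n + 1)) *
      qR q ((n + 1 : ℕ) : ℚ) * qnum q (n + 1)) * e1
  · have hU : ∏ i, upperFactor q (s i) (α i) (n + 1) = (∏ i, bif s i then 1 else -1) *
        (∏ i, qnum q (α i + n)) * ∏ i, upperFactor q (s i) (α i) n := by
      rw [← prod_mul_distrib, ← prod_mul_distrib]
      exact prod_congr rfl fun i _ => upperFactor_succ hq (hα i) fun hi =>
        not_le.1 fun h' => h ⟨i, hi, h'⟩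
    have hS2 : (∏ i, bif s i then (1 : ℝ) else -1) * ∏ i, (bif s i then (1 : ℝ) else -1) = 1 := by
      rw [← prod_mul_distrib]
      exact prod_eq_one fun i _ => by cases s i <;> simp
    rw [ht, ht, hU, hL, hR, pow_succ]
    generalize (∏ i, bif s i then (1 : ℝ) else -1) = S at *
    generalize (∏ i, bif s' i then (1 : ℝ) else -1) = S' at *
    -- Every factorial of the form `[B-n]!` contributes a sign to the term ratio; the explicit sign
    -- `ε` of the sum compensates these, so the series has argument `1`.
    have e : ε * S = S' := by rw [hε]; linear_combination S' * hS2
    linear_combination (K * ε ^ n * (∏ i, qnum q (α i + n)) *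
      (∏ i, upperFactor q (s i) (α i) n) * (∏ i, lowerFactor q (s' i) (β i) (n + 1)) *
      qR q ((n + 1 : ℕ) : ℚ) * (∏ i, qnum q (β i + n)) * qnum q (n + 1)) * e

/-! ### Balancedness of the separate sums in formulas (A)-(D). -/

lemma exists_int_upper {s : Spins} (hs : Admissible s) (z : Fin 4 → ℕ) (i : Fin 4) (j : Fin 5) :
    ((∃ m : ℤ, upperA s z i j = m) ∧ ∃ m : ℤ, upperB s z i j = m) ∧
      (∃ m : ℤ, upperC s z i j = m) ∧ ∃ m : ℤ, upperD s z i j = m := by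
  obtain ⟨j1, j2, j3, j4, l1, l2, l3, l4, k1, k2, k3, k4⟩ := s
  obtain ⟨p, r, s, u, v, a, b, c, d, e, f, g, rfl, rfl, rfl, rfl, rfl, rfl, rfl, rfl, rfl, rfl, rfl,
    rfl⟩ := hs.exists_int
  refine ⟨⟨?_, ?_⟩, ?_, ?_⟩ <;> fin_cases i <;> fin_cases j <;>
    (simp only [upperA, upperB, upperC, upperD, Fin.zero_eta, Fin.mk_one, Fin.reduceFinMk,
      Matrix.cons_val]
     ring_nf
     norm_cast
     exact ⟨_, rfl⟩)

lemma exists_int_lower {s : Spins} (hs : Admissible s) (z : Fin 4 → ℕ) (i : Fin 4) (j : Fin 4) :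
    ((∃ m : ℤ, lowerA s z i j = m) ∧ ∃ m : ℤ, lowerB s z i j = m) ∧
      (∃ m : ℤ, lowerC s z i j = m) ∧ ∃ m : ℤ, lowerD s z i j = m := by
  obtain ⟨j1, j2, j3, j4, l1, l2, l3, l4, k1, k2, k3, k4⟩ := s
  obtain ⟨p, r, s, u, v, a, b, c, d, e, f, g, rfl, rfl, rfl, rfl, rfl, rfl, rfl, rfl, rfl, rfl, rfl,
    rfl⟩ := hs.exists_int
  refine ⟨⟨?_, ?_⟩, ?_, ?_⟩ <;> fin_cases i <;> fin_cases j <;>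
    (simp only [lowerA, lowerB, lowerC, lowerD, Fin.zero_eta, Fin.mk_one, Fin.reduceFinMk,
      Matrix.cons_val]
     ring_nf
     norm_cast
     exact ⟨_, rfl⟩)

lemma sum_upper_sub_sum_lower (s : Spins) (z : Fin 4 → ℕ) (i : Fin 4) :
    (∑ j, upperA s z i j - ∑ j, lowerA s z i j = -1 ∧
      ∑ j, upperB s z i j - ∑ j, lowerB s z i j = -1) ∧
    ∑ j, upperC s z i j - ∑ j, lowerC s z i j = -1 ∧
      ∑ j, upperD s z i j - ∑ j, lowerD s z i j = -1 := by
  refine ⟨⟨?_, ?_⟩, ?_, ?_⟩ <;> fin_cases i <;>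
    simp only [upperA, lowerA, upperB, lowerB, upperC, lowerC, upperD, lowerD, Fin.zero_eta,
      Fin.mk_one, Fin.reduceFinMk, Matrix.cons_val, Fin.sum_univ_five, Fin.sum_univ_four] <;> ring

set_option linter.unusedSimpArgs false in
theorem isBalancedSum_summandA (hq : 0 < q) {s : Spins} (hs : Admissible s) (hd : DefinedA s)
    {z : Fin 4 → ℕ} (hz : z ∈ sumBox (boundA s)) (i : Fin 4) :
    IsBalancedSum q (upperA s z i) (lowerA s z i) (boundA s i) fun n =>
      summandA q s (Function.update z i n) := by
  have ha := fun i j => (exists_int_upper hs z i j).1.1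
  have hb := fun i j => (exists_int_lower hs z i j).1.1
  have hsum := fun i => (sum_upper_sub_sum_lower s z i).1.1
  have h1 := le_of_mem_sumBox_boundA hs hz
  -- Taken at the largest value of `z i`, where the arguments `B - z i` of the numerator factorials
  -- are smallest; this yields `β + N ≤ 0` for their parameters.
  have h2 := le_of_mem_sumBox_boundA hs (update_mem_sumBox hz i le_rfl)
  have h3 := hd _ (update_mem_sumBox hz i le_rfl)
  have h4 := hs.nonneg
  obtain ⟨j1, j2, j3, j4, l1, l2, l3, l4, k1, k2, k3, k4⟩ := s
  fin_cases i <;> simp only [Fin.zero_eta, Fin.mk_one, Fin.reduceFinMk, update_zero, update_one,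
    update_two, update_three, Matrix.cons_val] at h1 h2 h3 h4 ⊢
  -- The constant `K` collects all factors free of the summation variable. The Boolean vectors
  -- record which parameters come from `[A+z]!` (`true`) and which from `[B-z]!` (`false`).
  · refine isBalancedSum_of_factors hq
      ((-1) ^ (z 1 + z 2 + z 3) * qF q (j1 + l2 - k3 + z 1) * qF q (l2 - j3 + k4 + z 1) *
        qF q (j4 + k4 - l4 + z 2) * qF q (j2 + k3 - l4 + z 2) * qF q (2*l4 - z 2) *
        qF q (j2 + l3 - k1 + z 3) * qF q (k2 + l3 - j4 + z 3) *
        qF q (k1 + k3 + j3 + j4 - l2 - l3 - z 1 - z 3) * qR q (z 1) * qR q (z 2) * qR q (z 3) *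
        qR q (j1 - l2 + k3 - z 1) * qR q (j3 + k4 - l2 - z 1) * qR q (2*l2 + z 1 + 1) *
        qR q (k4 + l4 - j4 - z 2) * qR q (j2 - k3 + l4 - z 2) * qR q (k1 + j2 - l3 - z 3) *
        qR q (2*l3 + z 3 + 1) * qR q (k2 - l3 + j4 - z 3) * qR q (l2 - l4 - j3 + j4 + z 1 + z 2) *
        qR q (k3 - k1 + l3 - l4 + z 2 + z 3))
      (-1) ![true, true, false, false, true] ![false, true, true, true] (ha _) (hb _) (hsum _)
      (by simp [Fin.prod_univ_succ]) ?_ (fun i hi => ?_) fun n => ?_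
    · refine fun i hi => ?_
      fin_cases i
      · exact Or.inl (show 1 ≤ k2 + j3 - l1 + 1 by linarith)
      · exact Or.inl (show 1 ≤ k1 + j1 - l1 + 1 by linarith)
      · exact absurd hi (by decide)
      · exact absurd hi (by decide)
      -- The argument `l2 + l3 - l1 - l4 + z1 + z2 + z3 + z4` may be negative. It is the sum of `k1
      -- + l2 - l1 - k3 + z1 + z2` and `k3 - k1 + l3 - l4 + z3 + z4`, whose reciprocal factorials
      -- both occur, so one of these is then `0`: the one free of the summation variable is part of
      -- `K`, the other belongs to a denominator parameter. The other three variables are treated by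
      -- the same splitting.
      refine Or.inr ⟨2, rfl, fun n h => ?_⟩
      change l2 + l3 - l1 - l4 + z 1 + z 2 + z 3 + 1 + (n : ℚ) ≤ 0 at h
      change _ ∨ k1 + l2 - l1 - k3 + z 1 + 1 + (n : ℚ) ≤ 0
      rcases lt_or_ge (k3 - k1 + l3 - l4 + z 2 + z 3) 0 with h' | h'
      · rw [qR_of_neg h']; left; ring
      · right; linarith
    · fin_cases i <;> first | exact absurd hi (by decide) |
        (simp only [lowerA, Fin.zero_eta, Fin.mk_one, Fin.reduceFinMk, Matrix.cons_val]; linarith)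
    · simp only [summandA, upperA, lowerA, upperFactor, lowerFactor, Fin.prod_univ_five,
        Fin.prod_univ_four, Matrix.cons_val, cond_true, cond_false]
      ring_nf
  · refine isBalancedSum_of_factors hq
      ((-1) ^ (z 0 + z 2 + z 3) * qF q (k2 + j3 - l1 + z 0) * qF q (k1 + j1 - l1 + z 0) *
        qF q (2*l1 - z 0) * qF q (j4 + k4 - l4 + z 2) * qF q (j2 + k3 - l4 + z 2) *
        qF q (2*l4 - z 2) * qF q (j2 + l3 - k1 + z 3) * qF q (k2 + l3 - j4 + z 3) * qR q (z 0) *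
        qR q (z 2) * qR q (z 3) * qR q (l1 + k2 - j3 - z 0) * qR q (j1 + l1 - k1 - z 0) *
        qR q (k4 + l4 - j4 - z 2) * qR q (j2 - k3 + l4 - z 2) * qR q (k1 + j2 - l3 - z 3) *
        qR q (2*l3 + z 3 + 1) * qR q (k2 - l3 + j4 - z 3) *
        qR q (k1 + k3 + j3 + j4 - l1 - l4 + z 0 + z 2 + 1) * qR q (l3 - l1 + j3 - j4 + z 0 + z 3) *
        qR q (k3 - k1 + l3 - l4 + z 2 + z 3))
      (-1) ![true, true, false, false, true] ![true, false, true, true] (ha _) (hb _) (hsum _)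
      (by simp [Fin.prod_univ_succ]) ?_ (fun i hi => ?_) fun n => ?_
    · refine fun i hi => ?_
      fin_cases i
      · exact Or.inl (show 1 ≤ j1 + l2 - k3 + 1 by linarith)
      · exact Or.inl (show 1 ≤ l2 - j3 + k4 + 1 by linarith)
      · exact absurd hi (by decide)
      · exact absurd hi (by decide)
      refine Or.inr ⟨2, rfl, fun n h => ?_⟩
      change l2 + l3 - l1 - l4 + z 0 + z 2 + z 3 + 1 + (n : ℚ) ≤ 0 at h
      change _ ∨ k1 + l2 - l1 - k3 + z 0 + 1 + (n : ℚ) ≤ 0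
      rcases lt_or_ge (k3 - k1 + l3 - l4 + z 2 + z 3) 0 with h' | h'
      · rw [qR_of_neg h']; left; ring
      · right; linarith
    · fin_cases i <;> first | exact absurd hi (by decide) |
        (simp only [lowerA, Fin.zero_eta, Fin.mk_one, Fin.reduceFinMk, Matrix.cons_val]; linarith)
    · simp only [summandA, upperA, lowerA, upperFactor, lowerFactor, Fin.prod_univ_five,
        Fin.prod_univ_four, Matrix.cons_val, cond_true, cond_false]
      ring_nf
  · refine isBalancedSum_of_factors hq
      ((-1) ^ (z 0 + z 1 + z 3) * qF q (k2 + j3 - l1 + z 0) * qF q (k1 + j1 - l1 + z 0) *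
        qF q (2*l1 - z 0) * qF q (j1 + l2 - k3 + z 1) * qF q (l2 - j3 + k4 + z 1) *
        qF q (j2 + l3 - k1 + z 3) * qF q (k2 + l3 - j4 + z 3) *
        qF q (k1 + k3 + j3 + j4 - l2 - l3 - z 1 - z 3) * qR q (z 0) * qR q (z 1) * qR q (z 3) *
        qR q (l1 + k2 - j3 - z 0) * qR q (j1 + l1 - k1 - z 0) * qR q (j1 - l2 + k3 - z 1) *
        qR q (j3 + k4 - l2 - z 1) * qR q (2*l2 + z 1 + 1) * qR q (k1 + j2 - l3 - z 3) *
        qR q (2*l3 + z 3 + 1) * qR q (k2 - l3 + j4 - z 3) * qR q (k1 + l2 - l1 - k3 + z 0 + z 1) *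
        qR q (l3 - l1 + j3 - j4 + z 0 + z 3))
      (-1) ![true, true, false, false, true] ![false, true, true, true] (ha _) (hb _) (hsum _)
      (by simp [Fin.prod_univ_succ]) ?_ (fun i hi => ?_) fun n => ?_
    · refine fun i hi => ?_
      fin_cases i
      · exact Or.inl (show 1 ≤ j4 + k4 - l4 + 1 by linarith)
      · exact Or.inl (show 1 ≤ j2 + k3 - l4 + 1 by linarith)
      · exact absurd hi (by decide)
      · exact absurd hi (by decide)
      refine Or.inr ⟨3, rfl, fun n h => ?_⟩
      change l2 + l3 - l1 - l4 + z 0 + z 1 + z 3 + 1 + (n : ℚ) ≤ 0 at h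
      change _ ∨ k3 - k1 + l3 - l4 + z 3 + 1 + (n : ℚ) ≤ 0
      rcases lt_or_ge (k1 + l2 - l1 - k3 + z 0 + z 1) 0 with h' | h'
      · rw [qR_of_neg h']; left; ring
      · right; linarith
    · fin_cases i <;> first | exact absurd hi (by decide) |
        (simp only [lowerA, Fin.zero_eta, Fin.mk_one, Fin.reduceFinMk, Matrix.cons_val]; linarith)
    · simp only [summandA, upperA, lowerA, upperFactor, lowerFactor, Fin.prod_univ_five,
        Fin.prod_univ_four, Matrix.cons_val, cond_true, cond_false]
      ring_nf
  · refine isBalancedSum_of_factors hq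
      ((-1) ^ (z 0 + z 1 + z 2) * qF q (k2 + j3 - l1 + z 0) * qF q (k1 + j1 - l1 + z 0) *
        qF q (2*l1 - z 0) * qF q (j1 + l2 - k3 + z 1) * qF q (l2 - j3 + k4 + z 1) *
        qF q (j4 + k4 - l4 + z 2) * qF q (j2 + k3 - l4 + z 2) * qF q (2*l4 - z 2) * qR q (z 0) *
        qR q (z 1) * qR q (z 2) * qR q (l1 + k2 - j3 - z 0) * qR q (j1 + l1 - k1 - z 0) *
        qR q (j1 - l2 + k3 - z 1) * qR q (j3 + k4 - l2 - z 1) * qR q (2*l2 + z 1 + 1) *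
        qR q (k4 + l4 - j4 - z 2) * qR q (j2 - k3 + l4 - z 2) *
        qR q (k1 + k3 + j3 + j4 - l1 - l4 + z 0 + z 2 + 1) * qR q (k1 + l2 - l1 - k3 + z 0 + z 1) *
        qR q (l2 - l4 - j3 + j4 + z 1 + z 2))
      (-1) ![false, true, true, false, true] ![true, false, true, true] (ha _) (hb _) (hsum _)
      (by simp [Fin.prod_univ_succ]) ?_ (fun i hi => ?_) fun n => ?_
    · refine fun i hi => ?_
      fin_cases i
      · exact absurd hi (by decide)
      · exact Or.inl (show 1 ≤ j2 + l3 - k1 + 1 by linarith)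
      · exact Or.inl (show 1 ≤ k2 + l3 - j4 + 1 by linarith)
      · exact absurd hi (by decide)
      refine Or.inr ⟨3, rfl, fun n h => ?_⟩
      change l2 + l3 - l1 - l4 + z 0 + z 1 + z 2 + 1 + (n : ℚ) ≤ 0 at h
      change _ ∨ k3 - k1 + l3 - l4 + z 2 + 1 + (n : ℚ) ≤ 0
      rcases lt_or_ge (k1 + l2 - l1 - k3 + z 0 + z 1) 0 with h' | h'
      · rw [qR_of_neg h']; left; ring
      · right; linarith
    · fin_cases i <;> first | exact absurd hi (by decide) |
        (simp only [lowerA, Fin.zero_eta, Fin.mk_one, Fin.reduceFinMk, Matrix.cons_val]; linarith)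
    · simp only [summandA, upperA, lowerA, upperFactor, lowerFactor, Fin.prod_univ_five,
        Fin.prod_univ_four, Matrix.cons_val, cond_true, cond_false]
      ring_nf

set_option linter.unusedSimpArgs false in
theorem isBalancedSum_summandB (hq : 0 < q) {s : Spins} (hs : Admissible s) (hd : DefinedB s)
    {z : Fin 4 → ℕ} (hz : z ∈ sumBox (boundB s)) (i : Fin 4) :
    IsBalancedSum q (upperB s z i) (lowerB s z i) (boundB s i) fun n =>
      summandB q s (Function.update z i n) := by
  have ha := fun i j => (exists_int_upper hs z i j).1.2
  have hb := fun i j => (exists_int_lower hs z i j).1.2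
  have hsum := fun i => (sum_upper_sub_sum_lower s z i).1.2
  have h1 := le_of_mem_sumBox_boundB hs hz
  have h2 := le_of_mem_sumBox_boundB hs (update_mem_sumBox hz i le_rfl)
  have h3 := hd _ (update_mem_sumBox hz i le_rfl)
  have h4 := hs.nonneg
  obtain ⟨j1, j2, j3, j4, l1, l2, l3, l4, k1, k2, k3, k4⟩ := s
  fin_cases i <;> simp only [Fin.zero_eta, Fin.mk_one, Fin.reduceFinMk, update_zero, update_one,
    update_two, update_three, Matrix.cons_val] at h1 h2 h3 h4 ⊢
  · refine isBalancedSum_of_factors hq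
      ((-1) ^ (z 1 + z 2 + z 3) * qF q (2*l2 - z 1) * qF q (j1 - l2 + k3 + z 1) *
        qF q (j2 - k3 + l4 + z 2) * qF q (k4 + l4 - j4 + z 2) * qF q (2*l3 - z 3) *
        qF q (k2 - l3 + j4 + z 3) * qF q (j3 + j4 + l2 - l4 - z 1 - z 2) *
        qF q (k1 + k3 + l3 - l4 - z 2 - z 3) * qF q (j3 - j4 + k1 - k3 + l2 + l3 - z 1 - z 3) *
        qR q (z 1) * qR q (z 2) * qR q (z 3) * qR q (l2 + j3 - k4 - z 1) *
        qR q (j1 + l2 - k3 - z 1) * qR q (l2 + j3 + k4 - z 1 + 1) * qR q (j4 + k4 - l4 - z 2) *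
        qR q (j2 + k3 - l4 - z 2) * qR q (2*l4 + z 2 + 1) * qR q (k1 - j2 + l3 - z 3) *
        qR q (k2 + l3 - j4 - z 3) * qR q (k1 + j2 + l3 - z 3 + 1))
      1 ![true, true, false, false, false] ![false, true, true, true] (ha _) (hb _) (hsum _)
      (by simp [Fin.prod_univ_succ]) ?_ (fun i hi => ?_) fun n => ?_
    · refine fun i hi => Or.inl ?_
      fin_cases i <;> first | exact absurd hi (by decide) |
          (simp only [upperB, Fin.zero_eta, Fin.mk_one, Fin.reduceFinMk, Matrix.cons_val]; linarith)
    · fin_cases i <;> first | exact absurd hi (by decide) |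
        (simp only [lowerB, Fin.zero_eta, Fin.mk_one, Fin.reduceFinMk, Matrix.cons_val]; linarith)
    · simp only [summandB, upperB, lowerB, upperFactor, lowerFactor, Fin.prod_univ_five,
        Fin.prod_univ_four, Matrix.cons_val, cond_true, cond_false]
      ring_nf
  · refine isBalancedSum_of_factors hq
      ((-1) ^ (z 2 + z 3) * qF q (k2 + j3 - l1 + z 0) * qF q (k1 + j1 - l1 + z 0) *
        qF q (2*l1 - z 0) * qF q (j2 - k3 + l4 + z 2) * qF q (k4 + l4 - j4 + z 2) *
        qF q (2*l3 - z 3) * qF q (k2 - l3 + j4 + z 3) * qF q (k1 + k3 + l3 - l4 - z 2 - z 3) *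
        qR q (z 0) * qR q (z 2) * qR q (z 3) * qR q (l1 + k2 - j3 - z 0) *
        qR q (j1 + l1 - k1 - z 0) * qR q (j4 + k4 - l4 - z 2) * qR q (j2 + k3 - l4 - z 2) *
        qR q (2*l4 + z 2 + 1) * qR q (k1 - j2 + l3 - z 3) * qR q (k2 + l3 - j4 - z 3) *
        qR q (k1 + j2 + l3 - z 3 + 1) * qR q (k1 - k3 + j3 - j4 - l1 + l4 + z 0 + z 2) *
        qR q (j3 + j4 - l1 - l3 + z 0 + z 3))
      (-1) ![true, false, false, false, false] ![false, true, false, false] (ha _) (hb _) (hsum _)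
      (by simp [Fin.prod_univ_succ]) ?_ (fun i hi => ?_) fun n => ?_
    · refine fun i hi => Or.inl ?_
      fin_cases i <;> first | exact absurd hi (by decide) |
          (simp only [upperB, Fin.zero_eta, Fin.mk_one, Fin.reduceFinMk, Matrix.cons_val]; linarith)
    · fin_cases i <;> first | exact absurd hi (by decide) |
        (simp only [lowerB, Fin.zero_eta, Fin.mk_one, Fin.reduceFinMk, Matrix.cons_val]; linarith)
    · simp only [summandB, upperB, lowerB, upperFactor, lowerFactor, Fin.prod_univ_five,
        Fin.prod_univ_four, Matrix.cons_val, cond_true, cond_false]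
      ring_nf
  · refine isBalancedSum_of_factors hq
      ((-1) ^ (z 1 + z 3) * qF q (k2 + j3 - l1 + z 0) * qF q (k1 + j1 - l1 + z 0) *
        qF q (2*l1 - z 0) * qF q (2*l2 - z 1) * qF q (j1 - l2 + k3 + z 1) * qF q (2*l3 - z 3) *
        qF q (k2 - l3 + j4 + z 3) * qF q (j3 - j4 + k1 - k3 + l2 + l3 - z 1 - z 3) * qR q (z 0) *
        qR q (z 1) * qR q (z 3) * qR q (l1 + k2 - j3 - z 0) * qR q (j1 + l1 - k1 - z 0) *
        qR q (l2 + j3 - k4 - z 1) * qR q (j1 + l2 - k3 - z 1) * qR q (l2 + j3 + k4 - z 1 + 1) *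
        qR q (k1 - j2 + l3 - z 3) * qR q (k2 + l3 - j4 - z 3) * qR q (k1 + j2 + l3 - z 3 + 1) *
        qR q (k1 + k3 - l1 - l2 + z 0 + z 1) * qR q (j3 + j4 - l1 - l3 + z 0 + z 3))
      (-1) ![true, true, false, false, false] ![true, false, false, true] (ha _) (hb _) (hsum _)
      (by simp [Fin.prod_univ_succ]) ?_ (fun i hi => ?_) fun n => ?_
    · refine fun i hi => Or.inl ?_
      fin_cases i <;> first | exact absurd hi (by decide) |
          (simp only [upperB, Fin.zero_eta, Fin.mk_one, Fin.reduceFinMk, Matrix.cons_val]; linarith)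
    · fin_cases i <;> first | exact absurd hi (by decide) |
        (simp only [lowerB, Fin.zero_eta, Fin.mk_one, Fin.reduceFinMk, Matrix.cons_val]; linarith)
    · simp only [summandB, upperB, lowerB, upperFactor, lowerFactor, Fin.prod_univ_five,
        Fin.prod_univ_four, Matrix.cons_val, cond_true, cond_false]
      ring_nf
  · refine isBalancedSum_of_factors hq
      ((-1) ^ (z 1 + z 2) * qF q (k2 + j3 - l1 + z 0) * qF q (k1 + j1 - l1 + z 0) *
        qF q (2*l1 - z 0) * qF q (2*l2 - z 1) * qF q (j1 - l2 + k3 + z 1) *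
        qF q (j2 - k3 + l4 + z 2) * qF q (k4 + l4 - j4 + z 2) *
        qF q (j3 + j4 + l2 - l4 - z 1 - z 2) * qR q (z 0) * qR q (z 1) * qR q (z 2) *
        qR q (l1 + k2 - j3 - z 0) * qR q (j1 + l1 - k1 - z 0) * qR q (l2 + j3 - k4 - z 1) *
        qR q (j1 + l2 - k3 - z 1) * qR q (l2 + j3 + k4 - z 1 + 1) * qR q (j4 + k4 - l4 - z 2) *
        qR q (j2 + k3 - l4 - z 2) * qR q (2*l4 + z 2 + 1) * qR q (k1 + k3 - l1 - l2 + z 0 + z 1) *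
        qR q (k1 - k3 + j3 - j4 - l1 + l4 + z 0 + z 2))
      (-1) ![false, true, false, false, false] ![false, false, true, false] (ha _) (hb _) (hsum _)
      (by simp [Fin.prod_univ_succ]) ?_ (fun i hi => ?_) fun n => ?_
    · refine fun i hi => Or.inl ?_
      fin_cases i <;> first | exact absurd hi (by decide) |
          (simp only [upperB, Fin.zero_eta, Fin.mk_one, Fin.reduceFinMk, Matrix.cons_val]; linarith)
    · fin_cases i <;> first | exact absurd hi (by decide) |
        (simp only [lowerB, Fin.zero_eta, Fin.mk_one, Fin.reduceFinMk, Matrix.cons_val]; linarith)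
    · simp only [summandB, upperB, lowerB, upperFactor, lowerFactor, Fin.prod_univ_five,
        Fin.prod_univ_four, Matrix.cons_val, cond_true, cond_false]
      ring_nf

set_option linter.unusedSimpArgs false in
theorem isBalancedSum_summandC (hq : 0 < q) {s : Spins} (hs : Admissible s) (hd : DefinedC s)
    {z : Fin 4 → ℕ} (hz : z ∈ sumBox (boundC s)) (i : Fin 4) :
    IsBalancedSum q (upperC s z i) (lowerC s z i) (boundC s i) fun n =>
      summandC q s (Function.update z i n) := by
  have ha := fun i j => (exists_int_upper hs z i j).2.1
  have hb := fun i j => (exists_int_lower hs z i j).2.1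
  have hsum := fun i => (sum_upper_sub_sum_lower s z i).2.1
  have h1 := le_of_mem_sumBox_boundC hs hz
  have h2 := le_of_mem_sumBox_boundC hs (update_mem_sumBox hz i le_rfl)
  have h3 := hd _ (update_mem_sumBox hz i le_rfl)
  have h4 := hs.nonneg
  obtain ⟨j1, j2, j3, j4, l1, l2, l3, l4, k1, k2, k3, k4⟩ := s
  fin_cases i <;> simp only [Fin.zero_eta, Fin.mk_one, Fin.reduceFinMk, update_zero, update_one,
    update_two, update_three, Matrix.cons_val] at h1 h2 h3 h4 ⊢
  · refine isBalancedSum_of_factors hq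
      ((-1) ^ (z 1 + z 2 + z 3) * qF q (j1 + l2 - k3 + z 1) * qF q (l2 - j3 + k4 + z 1) *
        qF q (2*l4 - z 2) * qF q (j2 - l4 + k3 + z 2) * qF q (2*l3 - z 3) *
        qF q (k2 - l3 + j4 + z 3) * qF q (j3 + j4 - l2 + l4 - z 1 - z 2) *
        qF q (j3 - j4 + k1 + k3 - l2 + l3 - z 1 - z 3) * qF q (k1 - k3 + l3 + l4 - z 2 - z 3) *
        qR q (z 1) * qR q (z 2) * qR q (z 3) * qR q (j1 - l2 + k3 - z 1) *
        qR q (j3 + k4 - l2 - z 1) * qR q (2*l2 + z 1 + 1) * qR q (j4 - k4 + l4 - z 2) *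
        qR q (j2 - k3 + l4 - z 2) * qR q (j4 + k4 + l4 - z 2 + 1) * qR q (k1 - j2 + l3 - z 3) *
        qR q (k2 + l3 - j4 - z 3) * qR q (k1 + j2 + l3 - z 3 + 1))
      1 ![true, true, false, false, false] ![false, true, true, true] (ha _) (hb _) (hsum _)
      (by simp [Fin.prod_univ_succ]) ?_ (fun i hi => ?_) fun n => ?_
    · refine fun i hi => Or.inl ?_
      fin_cases i <;> first | exact absurd hi (by decide) |
          (simp only [upperC, Fin.zero_eta, Fin.mk_one, Fin.reduceFinMk, Matrix.cons_val]; linarith)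
    · fin_cases i <;> first | exact absurd hi (by decide) |
        (simp only [lowerC, Fin.zero_eta, Fin.mk_one, Fin.reduceFinMk, Matrix.cons_val]; linarith)
    · simp only [summandC, upperC, lowerC, upperFactor, lowerFactor, Fin.prod_univ_five,
        Fin.prod_univ_four, Matrix.cons_val, cond_true, cond_false]
      ring_nf
  · refine isBalancedSum_of_factors hq
      ((-1) ^ (z 2 + z 3) * qF q (j3 + k2 - l1 + z 0) * qF q (j1 + k1 - l1 + z 0) *
        qF q (2*l1 - z 0) * qF q (2*l4 - z 2) * qF q (j2 - l4 + k3 + z 2) * qF q (2*l3 - z 3) *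
        qF q (k2 - l3 + j4 + z 3) * qF q (k1 - k3 + l3 + l4 - z 2 - z 3) * qR q (z 0) *
        qR q (z 2) * qR q (z 3) * qR q (l1 + k2 - j3 - z 0) * qR q (j1 - k1 + l1 - z 0) *
        qR q (j4 - k4 + l4 - z 2) * qR q (j2 - k3 + l4 - z 2) * qR q (j4 + k4 + l4 - z 2 + 1) *
        qR q (k1 - j2 + l3 - z 3) * qR q (k2 + l3 - j4 - z 3) * qR q (k1 + j2 + l3 - z 3 + 1) *
        qR q (j3 - j4 + k1 + k3 - l1 - l4 + z 0 + z 2) * qR q (j3 + j4 - l1 - l3 + z 0 + z 3))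
      (-1) ![true, true, false, false, false] ![true, true, false, false] (ha _) (hb _) (hsum _)
      (by simp [Fin.prod_univ_succ]) ?_ (fun i hi => ?_) fun n => ?_
    · refine fun i hi => Or.inl ?_
      fin_cases i <;> first | exact absurd hi (by decide) |
          (simp only [upperC, Fin.zero_eta, Fin.mk_one, Fin.reduceFinMk, Matrix.cons_val]; linarith)
    · fin_cases i <;> first | exact absurd hi (by decide) |
        (simp only [lowerC, Fin.zero_eta, Fin.mk_one, Fin.reduceFinMk, Matrix.cons_val]; linarith)
    · simp only [summandC, upperC, lowerC, upperFactor, lowerFactor, Fin.prod_univ_five,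
        Fin.prod_univ_four, Matrix.cons_val, cond_true, cond_false]
      ring_nf
  · refine isBalancedSum_of_factors hq
      ((-1) ^ (z 1 + z 3) * qF q (j3 + k2 - l1 + z 0) * qF q (j1 + k1 - l1 + z 0) *
        qF q (2*l1 - z 0) * qF q (j1 + l2 - k3 + z 1) * qF q (l2 - j3 + k4 + z 1) *
        qF q (2*l3 - z 3) * qF q (k2 - l3 + j4 + z 3) *
        qF q (j3 - j4 + k1 + k3 - l2 + l3 - z 1 - z 3) * qR q (z 0) * qR q (z 1) * qR q (z 3) *
        qR q (l1 + k2 - j3 - z 0) * qR q (j1 - k1 + l1 - z 0) * qR q (j1 - l2 + k3 - z 1) *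
        qR q (j3 + k4 - l2 - z 1) * qR q (2*l2 + z 1 + 1) * qR q (k1 - j2 + l3 - z 3) *
        qR q (k2 + l3 - j4 - z 3) * qR q (k1 + j2 + l3 - z 3 + 1) *
        qR q (k1 - k3 - l1 + l2 + z 0 + z 1) * qR q (j3 + j4 - l1 - l3 + z 0 + z 3))
      (-1) ![false, true, false, false, false] ![false, false, true, false] (ha _) (hb _) (hsum _)
      (by simp [Fin.prod_univ_succ]) ?_ (fun i hi => ?_) fun n => ?_
    · refine fun i hi => Or.inl ?_
      fin_cases i <;> first | exact absurd hi (by decide) |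
          (simp only [upperC, Fin.zero_eta, Fin.mk_one, Fin.reduceFinMk, Matrix.cons_val]; linarith)
    · fin_cases i <;> first | exact absurd hi (by decide) |
        (simp only [lowerC, Fin.zero_eta, Fin.mk_one, Fin.reduceFinMk, Matrix.cons_val]; linarith)
    · simp only [summandC, upperC, lowerC, upperFactor, lowerFactor, Fin.prod_univ_five,
        Fin.prod_univ_four, Matrix.cons_val, cond_true, cond_false]
      ring_nf
  · refine isBalancedSum_of_factors hq
      ((-1) ^ (z 1 + z 2) * qF q (j3 + k2 - l1 + z 0) * qF q (j1 + k1 - l1 + z 0) *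
        qF q (2*l1 - z 0) * qF q (j1 + l2 - k3 + z 1) * qF q (l2 - j3 + k4 + z 1) *
        qF q (2*l4 - z 2) * qF q (j2 - l4 + k3 + z 2) * qF q (j3 + j4 - l2 + l4 - z 1 - z 2) *
        qR q (z 0) * qR q (z 1) * qR q (z 2) * qR q (l1 + k2 - j3 - z 0) *
        qR q (j1 - k1 + l1 - z 0) * qR q (j1 - l2 + k3 - z 1) * qR q (j3 + k4 - l2 - z 1) *
        qR q (2*l2 + z 1 + 1) * qR q (j4 - k4 + l4 - z 2) * qR q (j2 - k3 + l4 - z 2) *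
        qR q (j4 + k4 + l4 - z 2 + 1) * qR q (k1 - k3 - l1 + l2 + z 0 + z 1) *
        qR q (j3 - j4 + k1 + k3 - l1 - l4 + z 0 + z 2))
      (-1) ![false, true, false, false, false] ![false, false, true, false] (ha _) (hb _) (hsum _)
      (by simp [Fin.prod_univ_succ]) ?_ (fun i hi => ?_) fun n => ?_
    · refine fun i hi => Or.inl ?_
      fin_cases i <;> first | exact absurd hi (by decide) |
          (simp only [upperC, Fin.zero_eta, Fin.mk_one, Fin.reduceFinMk, Matrix.cons_val]; linarith)
    · fin_cases i <;> first | exact absurd hi (by decide) |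
        (simp only [lowerC, Fin.zero_eta, Fin.mk_one, Fin.reduceFinMk, Matrix.cons_val]; linarith)
    · simp only [summandC, upperC, lowerC, upperFactor, lowerFactor, Fin.prod_univ_five,
        Fin.prod_univ_four, Matrix.cons_val, cond_true, cond_false]
      ring_nf

set_option linter.unusedSimpArgs false in
theorem isBalancedSum_summandD (hq : 0 < q) {s : Spins} (hs : Admissible s) (hd : DefinedD s)
    {z : Fin 4 → ℕ} (hz : z ∈ sumBox (boundD s)) (i : Fin 4) :
    IsBalancedSum q (upperD s z i) (lowerD s z i) (boundD s i) fun n =>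
      summandD q s (Function.update z i n) := by
  have ha := fun i j => (exists_int_upper hs z i j).2.2
  have hb := fun i j => (exists_int_lower hs z i j).2.2
  have hsum := fun i => (sum_upper_sub_sum_lower s z i).2.2
  have h1 := le_of_mem_sumBox_boundD hs hz
  have h2 := le_of_mem_sumBox_boundD hs (update_mem_sumBox hz i le_rfl)
  have h3 := hd _ (update_mem_sumBox hz i le_rfl)
  have h4 := hs.nonneg
  obtain ⟨j1, j2, j3, j4, l1, l2, l3, l4, k1, k2, k3, k4⟩ := s
  fin_cases i <;> simp only [Fin.zero_eta, Fin.mk_one, Fin.reduceFinMk, update_zero, update_one,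
    update_two, update_three, Matrix.cons_val] at h1 h2 h3 h4 ⊢
  · refine isBalancedSum_of_factors hq
      ((-1) ^ (z 1 + z 2) * qF q (2*l2 - z 1) * qF q (k4 + j3 - l2 + z 1) * qF q (2*l4 - z 2) *
        qF q (j2 + k3 - l4 + z 2) * qF q (2*j2 - z 3) * qF q (j2 + j4 + k1 - k2 - z 3) *
        qF q (j2 + j4 + k1 + k2 - z 3 + 1) * qF q (l2 + l4 - j3 + j4 - z 1 - z 2) * qR q (z 1) *
        qR q (k3 + l2 - j1 - z 1) * qR q (l2 - j3 + k4 - z 1) * qR q (j1 + l2 + k3 - z 1 + 1) *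
        qR q (z 2) * qR q (z 3) * qR q (j4 + l4 - k4 - z 2) * qR q (j2 - k3 + l4 - z 2) *
        qR q (j4 + k4 + l4 - z 2 + 1) * qR q (k1 + j2 - l3 - z 3) * qR q (k1 + j2 + l3 - z 3 + 1) *
        qR q (j2 + k3 - l4 + z 2 - z 3) * qR q (j2 + j3 + j4 - k3 - l2 + z 1 - z 3))
      (-1) ![true, false, false, false, false] ![false, false, false, true] (ha _) (hb _) (hsum _)
      (by simp [Fin.prod_univ_succ]) ?_ (fun i hi => ?_) fun n => ?_
    · refine fun i hi => Or.inl ?_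
      fin_cases i <;> first | exact absurd hi (by decide) |
          (simp only [upperD, Fin.zero_eta, Fin.mk_one, Fin.reduceFinMk, Matrix.cons_val]; linarith)
    · fin_cases i <;> first | exact absurd hi (by decide) |
        (simp only [lowerD, Fin.zero_eta, Fin.mk_one, Fin.reduceFinMk, Matrix.cons_val]; linarith)
    · simp only [summandD, upperD, lowerD, upperFactor, lowerFactor, Fin.prod_univ_five,
        Fin.prod_univ_four, Matrix.cons_val, cond_true, cond_false]
      ring_nf
  · refine isBalancedSum_of_factors hq
      ((-1) ^ (z 0 + z 2) * qF q (2*l1 - z 0) * qF q (j1 + k1 - l1 + z 0) * qF q (2*l4 - z 2) *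
        qF q (j2 + k3 - l4 + z 2) * qF q (2*j2 - z 3) * qF q (j2 + j4 + k1 - k2 - z 3) *
        qF q (j2 + j4 + k1 + k2 - z 3 + 1) * qF q (j3 + j4 - k3 - k1 + l1 + l4 - z 0 - z 2) *
        qR q (z 0) * qR q (l1 - k2 + j3 - z 0) * qR q (j1 - k1 + l1 - z 0) *
        qR q (l1 + k2 + j3 - z 0 + 1) * qR q (z 2) * qR q (z 3) * qR q (j4 + l4 - k4 - z 2) *
        qR q (j2 - k3 + l4 - z 2) * qR q (j4 + k4 + l4 - z 2 + 1) * qR q (k1 + j2 - l3 - z 3) *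
        qR q (k1 + j2 + l3 - z 3 + 1) * qR q (j2 + k3 - l4 + z 2 - z 3) *
        qR q (j2 - j3 + j4 + k1 - l1 + z 0 - z 3))
      (-1) ![true, false, false, false, false] ![false, false, true, false] (ha _) (hb _) (hsum _)
      (by simp [Fin.prod_univ_succ]) ?_ (fun i hi => ?_) fun n => ?_
    · refine fun i hi => Or.inl ?_
      fin_cases i <;> first | exact absurd hi (by decide) |
          (simp only [upperD, Fin.zero_eta, Fin.mk_one, Fin.reduceFinMk, Matrix.cons_val]; linarith)
    · fin_cases i <;> first | exact absurd hi (by decide) |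
        (simp only [lowerD, Fin.zero_eta, Fin.mk_one, Fin.reduceFinMk, Matrix.cons_val]; linarith)
    · simp only [summandD, upperD, lowerD, upperFactor, lowerFactor, Fin.prod_univ_five,
        Fin.prod_univ_four, Matrix.cons_val, cond_true, cond_false]
      ring_nf
  · refine isBalancedSum_of_factors hq
      ((-1) ^ (z 0 + z 1) * qF q (2*l1 - z 0) * qF q (j1 + k1 - l1 + z 0) * qF q (2*l2 - z 1) *
        qF q (k4 + j3 - l2 + z 1) * qF q (2*j2 - z 3) * qF q (j2 + j4 + k1 - k2 - z 3) *
        qF q (j2 + j4 + k1 + k2 - z 3 + 1) * qF q (l1 + l2 - k1 + k3 - z 0 - z 1) * qR q (z 0) *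
        qR q (l1 - k2 + j3 - z 0) * qR q (j1 - k1 + l1 - z 0) * qR q (l1 + k2 + j3 - z 0 + 1) *
        qR q (z 1) * qR q (k3 + l2 - j1 - z 1) * qR q (l2 - j3 + k4 - z 1) *
        qR q (j1 + l2 + k3 - z 1 + 1) * qR q (z 3) * qR q (k1 + j2 - l3 - z 3) *
        qR q (k1 + j2 + l3 - z 3 + 1) * qR q (j2 - j3 + j4 + k1 - l1 + z 0 - z 3) *
        qR q (j2 + j3 + j4 - k3 - l2 + z 1 - z 3))
      (-1) ![true, false, false, false, false] ![false, true, false, false] (ha _) (hb _) (hsum _)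
      (by simp [Fin.prod_univ_succ]) ?_ (fun i hi => ?_) fun n => ?_
    · refine fun i hi => Or.inl ?_
      fin_cases i <;> first | exact absurd hi (by decide) |
          (simp only [upperD, Fin.zero_eta, Fin.mk_one, Fin.reduceFinMk, Matrix.cons_val]; linarith)
    · fin_cases i <;> first | exact absurd hi (by decide) |
        (simp only [lowerD, Fin.zero_eta, Fin.mk_one, Fin.reduceFinMk, Matrix.cons_val]; linarith)
    · simp only [summandD, upperD, lowerD, upperFactor, lowerFactor, Fin.prod_univ_five,
        Fin.prod_univ_four, Matrix.cons_val, cond_true, cond_false]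
      ring_nf
  · refine isBalancedSum_of_factors hq
      ((-1) ^ (z 0 + z 1 + z 2) * qF q (2*l1 - z 0) * qF q (j1 + k1 - l1 + z 0) *
        qF q (2*l2 - z 1) * qF q (k4 + j3 - l2 + z 1) * qF q (2*l4 - z 2) *
        qF q (j2 + k3 - l4 + z 2) * qF q (l1 + l2 - k1 + k3 - z 0 - z 1) *
        qF q (j3 + j4 - k3 - k1 + l1 + l4 - z 0 - z 2) * qF q (l2 + l4 - j3 + j4 - z 1 - z 2) *
        qR q (z 0) * qR q (l1 - k2 + j3 - z 0) * qR q (j1 - k1 + l1 - z 0) *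
        qR q (l1 + k2 + j3 - z 0 + 1) * qR q (z 1) * qR q (k3 + l2 - j1 - z 1) *
        qR q (l2 - j3 + k4 - z 1) * qR q (j1 + l2 + k3 - z 1 + 1) * qR q (z 2) *
        qR q (j4 + l4 - k4 - z 2) * qR q (j2 - k3 + l4 - z 2) * qR q (j4 + k4 + l4 - z 2 + 1))
      -- No numerator factorial of (D) grows with `z 3`, so there is no condition on numerator
      -- arguments. Five signs from above and three from below make `ε = 1`.
      1 ![false, false, false, false, false] ![false, false, false, true] (ha _) (hb _) (hsum _)
      (by simp [Fin.prod_univ_succ]) ?_ (fun i hi => ?_) fun n => ?_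
    · intro i hi
      fin_cases i <;> exact absurd hi (by decide)
    · fin_cases i <;> first | exact absurd hi (by decide) |
        (simp only [lowerD, Fin.zero_eta, Fin.mk_one, Fin.reduceFinMk, Matrix.cons_val]; linarith)
    · simp only [summandD, upperD, lowerD, upperFactor, lowerFactor, Fin.prod_univ_five,
        Fin.prod_univ_four, Matrix.cons_val, cond_true, cond_false]
      ring_nf

end

theorem mainTheorem6 (q : ℝ) (hq : 0 < q) (s : Spins) (hs : Admissible s) :
    (q12j q s = expansionB q s ∧ q12j q s = expansionC q s ∧ q12j q s = expansionD q s) ∧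
    (DefinedA s → q12j q s = formulaA q s) ∧
    (DefinedB s → q12j q s = formulaB q s) ∧
    (DefinedC s → q12j q s = formulaC q s) ∧
    (DefinedD s → q12j q s = formulaD q s) ∧
    (DefinedA s → ∀ z ∈ sumBox (boundA s), ∀ i : Fin 4,
      IsBalancedSum q (upperA s z i) (lowerA s z i) (boundA s i)
        fun n => summandA q s (Function.update z i n)) ∧
    (DefinedB s → ∀ z ∈ sumBox (boundB s), ∀ i : Fin 4,
      IsBalancedSum q (upperB s z i) (lowerB s z i) (boundB s i)
        fun n => summandB q s (Function.update z i n)) ∧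
    (DefinedC s → ∀ z ∈ sumBox (boundC s), ∀ i : Fin 4,
      IsBalancedSum q (upperC s z i) (lowerC s z i) (boundC s i)
        fun n => summandC q s (Function.update z i n)) ∧
    (DefinedD s → ∀ z ∈ sumBox (boundD s), ∀ i : Fin 4,
      IsBalancedSum q (upperD s z i) (lowerD s z i) (boundD s i)
        fun n => summandD q s (Function.update z i n)) ∧
    q12j q s.flip = q12j q s ∧
    formulaA q s.flip = formulaA q s ∧
    prefactorA q s.flip = prefactorA q s ∧
    (∀ i, boundA s.flip i = boundA s (Equiv.swap 1 3 i)) ∧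
    (∀ z, summandA q s.flip (fun i => z (Equiv.swap 1 3 i)) = summandA q s z) ∧
    formulaB q s.flip = formulaB q s ∧
    prefactorB q s.flip = prefactorB q s ∧
    (∀ i, boundB s.flip i = boundB s (Equiv.swap 1 3 i)) ∧
    (∀ z, summandB q s.flip (fun i => z (Equiv.swap 1 3 i)) = summandB q s z) := by
  refine ⟨⟨q12j_eq_expansionB s, q12j_eq_expansionC s, q12j_eq_expansionD s⟩,
    q12j_eq_formulaA hq s hs, q12j_eq_formulaB hq s hs, q12j_eq_formulaC hq s hs,
    q12j_eq_formulaD hq s hs, fun hd _ hz => isBalancedSum_summandA hq hs hd hz,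
    fun hd _ hz => isBalancedSum_summandB hq hs hd hz,
    fun hd _ hz => isBalancedSum_summandC hq hs hd hz,
    fun hd _ hz => isBalancedSum_summandD hq hs hd hz, q12j_flip s, formulaA_flip s hs,
    prefactorA_flip s hs, boundA_flip s, summandA_flip s, formulaB_flip s, prefactorB_flip s,
    boundB_flip s, summandB_flip s⟩
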